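/- Throughout, "topos" means Grothendieck topos. An object of a topos is *connected* if it is not initial and if, whenever $X = X_1 \amalg X_2$, one of $X_1, X_2$ is initial; a topos $\mathcal{T}$ is *locally connected* if it is generated by its connected objects (two morphisms $X \rightrightarrows Y$ that agree on all morphisms $Z \to X$ with $Z$ connected are equal). A *constant* object is a coproduct of a (small) set of copies of the final object $*$. An object $U$ *trivializes* $F$ if $F \times U \to U$ is a constant object of $\mathcal{T}/U$, and $F$ is *locally constant* if the objects trivializing it cover $*$ (for the canonical topology). Let $\mathrm{SLC}\,\mathcal{T}$ be the full subcategory of $\mathcal{T}$ of disjoint sums of locally constant objects and let $J(*)$ be the set of covering sieves of $*$, ordered by inclusion; for $R \in J(*)$ let $\mathrm{LC}(\mathcal{T},R)$ be the full subcategory of the objects of $\mathcal{T}$ trivialized by all connected objects belonging to $R$. (One has $\mathrm{LC}(\mathcal{T},R) \subseteq \mathrm{SLC}\,\mathcal{T}$, and $\mathrm{LC}(\mathcal{T},R) \subseteq \mathrm{LC}(\mathcal{T},R')$ if $R' \subseteq R$.) A topos morphism $\mathcal{E} \to \mathcal{F}$ is given by its inverse image functor $\mathcal{F} \to \mathcal{E}$,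 which preserves finite limits and has a right adjoint; 2-morphisms are natural transformations of inverse image functors. A *base point* of $\mathcal{T}$ is a topos morphism $p : \mathrm{Set} \to \mathrm{SLC}\,\mathcal{T}$; it lies in a connected component of $\mathrm{SLC}\,\mathcal{T}$ (that is, in a connected summand $C$ of the final object of $\mathrm{SLC}\,\mathcal{T}$) if $p^*C \neq \emptyset$. A *progroupoid* is a functor $i \mapsto G_i$ from a cofiltered category to the category of groupoids; it is *strict* if all the transition functors $G_i \to G_j$ are bijective on objects and induce surjections $\mathrm{Hom}_{G_i}(x,y) \to \mathrm{Hom}_{G_j}(x,y)$ for all objects $x, y$ of $G_i$ (whose images in $G_j$ are still denoted $x, y$). The *classifying topos* of a groupoid $G$ is the category $\mathfrak{B}G$ of functors $G \to \mathrm{Set}$, and that of a progroupoid $(G_i)$ is the 2-limit of the $\mathfrak{B}G_i$ in the 2-category of toposes. **Theorem.** Let $\mathcal{T}$ be a locally connected topos and let $P$ be a set of base points of $\mathcal{T}$, at least one in each connected component of $\mathrm{SLC}\,\mathcal{T}$. For $R \in J(*)$ let $G_R$ be the groupoid whose objects are the elements of $P$ and whose morphisms $p \to q$ are the 2-isomorphisms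 between $p$ and $q$ seen as points of $\mathrm{LC}(\mathcal{T},R)$, i.e. the natural isomorphisms $p^*|_{\mathrm{LC}(\mathcal{T},R)} \cong q^*|_{\mathrm{LC}(\mathcal{T},R)}$. For $R' \subseteq R$ let $G_{R'} \to G_R$ be the identity on objects and restriction on morphisms, and let $\pi_1(\mathcal{T},P)$ be the resulting projective system $(G_R)_{R \in J(*)}$. Then 1. $\pi_1(\mathcal{T},P)$ is a strict progroupoid; 2. $\mathrm{SLC}\,\mathcal{T}$ is equivalent to the classifying topos of $\pi_1(\mathcal{T},P)$: the categories $\mathfrak{B}G_R$ and $\mathrm{SLC}\,\mathcal{T}$ are toposes, and $\mathrm{SLC}\,\mathcal{T}$ is the vertex of a 2-limit cone, in the 2-category of toposes, over the system $(\mathfrak{B}G_R)_{R \in J(*)}$. -/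

import Mathlib

open CategoryTheory Limits Opposite

universe u v₁ v₂ v₃ v₄ w₁ w₂ w₃ w₄

namespace ToposPi

/-! ### Toposes and their morphisms -/

/-- A (Grothendieck) topos, relative to the universe `u`: a category equivalent to the category of
sheaves of sets on a small site. -/
class IsGrothendieckTopos (E : Type v₁) [Category.{w₁} E] : Prop where
  exists_site : ∃ (C : Type u) (_ : SmallCategory C) (J : GrothendieckTopology C),
    Nonempty (E ≌ Sheaf J (Type u))

instance {E : Type (u + 1)} [LargeCategory.{u} E] [hE : IsGrothendieckTopos.{u} E] :
    HasFiniteLimits E := by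
  obtain ⟨C, _, J, ⟨e⟩⟩ := hE.exists_site
  exact ⟨fun K _ _ => Adjunction.hasLimitsOfShape_of_equivalence (J := K) e.functor⟩

/-- The inverse image functors of topos morphisms `E ⟶ F`: the functors `F ⥤ E` that preserve
finite limits and have a right adjoint (the direct image functor). -/
def IsInverseImage (E : Type v₁) [Category.{w₁} E] (F : Type v₂) [Category.{w₂} F] :
    ObjectProperty (F ⥤ E) :=
  fun f => PreservesFiniteLimits f ∧ f.IsLeftAdjoint

/-- The category of topos morphisms `E ⟶ F`. A topos morphism is given by its inverse image functor
`F ⥤ E` (its direct image being determined up to a unique isomorphism); the 2-morphisms are the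
natural transformations between the inverse image functors. -/
abbrev ToposMor (E : Type v₁) [Category.{w₁} E] (F : Type v₂) [Category.{w₂} F] :=
  (IsInverseImage E F).FullSubcategory

/-- The composite of topos morphisms `E ⟶ F ⟶ H`. -/
def ToposMor.comp {E : Type v₁} [Category.{w₁} E] {F : Type v₂} [Category.{w₂} F]
    {H : Type v₃} [Category.{w₃} H] (f : ToposMor E F) (g : ToposMor F H) : ToposMor E H where
  obj := g.obj ⋙ f.obj
  property := by
    obtain ⟨_, _⟩ := f.property
    obtain ⟨_, _⟩ := g.property
    exact ⟨comp_preservesFiniteLimits _ _, inferInstance⟩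

/-! ### Connected, constant and locally constant objects -/

/-- An object is connected if it is not initial and if, whenever it is a coproduct of two objects,
one of these is initial. -/
def IsConnectedObject {C : Type v₁} [Category.{w₁} C] : ObjectProperty C := fun X =>
  IsEmpty (IsInitial X) ∧
    ∀ ⦃X₁ X₂ : C⦄ (i₁ : X₁ ⟶ X) (i₂ : X₂ ⟶ X), Nonempty (IsColimit (BinaryCofan.mk i₁ i₂)) →
      Nonempty (IsInitial X₁) ∨ Nonempty (IsInitial X₂)

/-- A topos is locally connected if it is generated by its connected objects: two morphisms
`X ⟶ Y` are equal as soon as they agree on all morphisms `Z ⟶ X` with `Z` connected. -/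
class IsLocallyConnected (T : Type v₁) [Category.{w₁} T] : Prop where
  isSeparating : (IsConnectedObject (C := T)).IsSeparating

/-- A constant object: a coproduct of a (`u`-small) set of copies of the final object. -/
def IsConstantObject {C : Type v₁} [Category.{w₁} C] (X : C) : Prop :=
  ∃ (I : Type u) (Y : I → C) (i : ∀ k, Y k ⟶ X),
    (∀ k, Nonempty (IsTerminal (Y k))) ∧ Nonempty (IsColimit (Cofan.mk X i))

section LocallyConstant

variable (T : Type (u + 1)) [LargeCategory.{u} T] [IsGrothendieckTopos.{u} T]

variable {T} in
/-- `F` is trivialized by `U` if `F × U ⟶ U` is a constant object of the topos `T/U`. -/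
def TrivializedBy (F U : T) : Prop :=
  IsConstantObject.{u} (Over.mk (prod.snd : F ⨯ U ⟶ U))

/-- The covering sieves of the final object of `T` (for the canonical topology of `T`), ordered by
inclusion. -/
abbrev CoveringSieve : Type (u + 1) := (Sheaf.canonicalTopology T).Cover (⊤_ T)

/-- An object is locally constant if the objects trivializing it cover the final object. -/
def IsLocallyConstant : ObjectProperty T := fun F =>
  Sieve.generate (fun (U : T) (_ : U ⟶ ⊤_ T) => TrivializedBy F U) ∈
    Sheaf.canonicalTopology T (⊤_ T)

/-- Disjoint sums of (`u`-small) families of locally constant objects. -/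
def IsSumOfLocallyConstant : ObjectProperty T := fun X =>
  ∃ (I : Type u) (Y : I → T) (i : ∀ k, Y k ⟶ X),
    (∀ k, IsLocallyConstant T (Y k)) ∧ Nonempty (IsColimit (Cofan.mk X i))

/-- The category `SLC T`: the full subcategory of `T` of disjoint sums of locally constant
objects. -/
abbrev SLC := (IsSumOfLocallyConstant T).FullSubcategory

variable {T}

/-- The objects of `T` trivialized by the connected objects of the sieve `R`. -/
def IsTrivializedBySieve (R : CoveringSieve T) : ObjectProperty T := fun F =>
  ∀ ⦃U : T⦄ (h : U ⟶ ⊤_ T), (R : Sieve (⊤_ T)) h → IsConnectedObject U → TrivializedBy F U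

/-- The category `LC(T, R)`: the full subcategory of `T` of the objects trivialized by the
connected objects of `R`. -/
abbrev LC (R : CoveringSieve T) := (IsTrivializedBySieve R).FullSubcategory

lemma isTrivializedBySieve_le {R' R : CoveringSieve T} (h : R' ≤ R) :
    IsTrivializedBySieve R ≤ IsTrivializedBySieve R' :=
  fun _ hF _ k hk hU => hF k (h _ hk) hU

/-- The inclusion `LC(T, R) ⥤ LC(T, R')` for a finer sieve `R' ≤ R`. -/
abbrev LC.inclusion {R' R : CoveringSieve T} (h : R' ≤ R) : LC R ⥤ LC R' :=
  ObjectProperty.ιOfLE (isTrivializedBySieve_le h)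

end LocallyConstant

/-! ### `LC(T, R)` is contained in `SLC T` -/

/-- In a topos `T ≌ Sheaf J`, the functor of sections over `c` is corepresentable. -/
noncomputable def sectionsCorep {T : Type (u + 1)} [LargeCategory.{u} T] {C : Type u} [SmallCategory C]
    {J : GrothendieckTopology C} (e : T ≌ Sheaf J (Type u)) (c : C) :
    (e.functor ⋙ sheafToPresheaf J (Type u) ⋙ (evaluation _ _).obj (op c)).CorepresentableBy
      (e.inverse.obj ((presheafToSheaf J (Type u)).obj (yoneda.obj c))) where
  homEquiv := ((e.symm.toAdjunction.homEquiv _ _).trans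
    ((sheafificationAdjunction J (Type u)).homEquiv _ _)).trans yonedaEquiv
  homEquiv_comp g f := by
    simp [Adjunction.homEquiv_naturality_right, yonedaEquiv]
    rw [Adjunction.homEquiv_naturality_right]
    rfl

/-- In a topos, a sieve containing all morphisms from the objects of a separating class is
effective-epimorphic. -/
lemma isSheafFor_of_isSeparating {T : Type (u + 1)} [LargeCategory.{u} T]
    [hT : IsGrothendieckTopos.{u} T] {K : ObjectProperty T} (hK : K.IsSeparating)
    {Y : T} (S : Sieve Y) (hS : ∀ ⦃Z : T⦄, K Z → ∀ g : Z ⟶ Y, S g) (W : T) :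
    Presieve.IsSheafFor (yoneda.obj W) S.arrows := by
  obtain ⟨C, _, J, ⟨e⟩⟩ := hT.exists_site
  let F : T ⥤ Cᵒᵖ ⥤ Type u := e.functor ⋙ sheafToPresheaf J (Type u)
  have hFsheaf (X : T) : Presieve.IsSheaf J (F.obj X) :=
    (isSheaf_iff_isSheaf_of_type J _).mp (e.functor.obj X).2
  intro x hx
  have indep (c : Cᵒᵖ) {Z Z' : T} (g : Z ⟶ Y) (hg : S g) (g' : Z' ⟶ Y) (hg' : S g')
      (z : (F.obj Z).obj c) (z' : (F.obj Z').obj c)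
      (h : (F.map g).app c z = (F.map g').app c z') :
      (F.map (x g hg)).app c z = (F.map (x g' hg')).app c z' := by
    let r := sectionsCorep e c.unop
    have key {V V' : T} (k : V ⟶ V') (y : (F.obj V).obj c) :
        r.homEquiv.symm y ≫ k = r.homEquiv.symm ((F.map k).app c y) :=
      r.homEquiv_symm_comp y k
    apply r.homEquiv.symm.injective
    rw [← key, ← key]
    exact hx _ _ hg hg' (by rw [key, key, h])
  let A : Subfunctor (F.obj Y) :=
    { obj c := {y | ∃ (Z : T) (g : Z ⟶ Y) (_ : S g) (z : (F.obj Z).obj c),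
        (F.map g).app c z = y}
      map := by
        rintro c d k _ ⟨Z, g, hg, z, rfl⟩
        exact ⟨Z, g, hg, (F.obj Z).map k z, (F.map g).naturality_apply k z⟩ }
  let A' : Sheaf J (Type u) := ⟨(A.sheafify J).toFunctor,
    (isSheaf_iff_isSheaf_of_type J _).mpr (Subfunctor.sheafify_isSheaf A (hFsheaf Y))⟩
  let i : A' ⟶ e.functor.obj Y := ⟨(A.sheafify J).ι⟩
  have : Mono i := (sheafToPresheaf J (Type u)).mono_of_mono_map
    (inferInstanceAs (Mono (A.sheafify J).ι))
  have : Epi i := by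
    refine ⟨fun {V} f₁ f₂ h => ?_⟩
    obtain ⟨k₁, hk₁⟩ := e.functor.map_surjective (f₁ ≫ e.counitInv.app V)
    obtain ⟨k₂, hk₂⟩ := e.functor.map_surjective (f₂ ≫ e.counitInv.app V)
    have : k₁ = k₂ := by
      refine hK _ _ fun Z hZ g => e.functor.map_injective ?_
      rw [e.functor.map_comp, e.functor.map_comp, hk₁, hk₂, ← Category.assoc, ← Category.assoc]
      congr 1
      ext c z
      have h1 := congr_fun (congr_arg (fun φ => φ.hom.app c) h |> fun q => congr_arg (fun s => (s : _ → _)) q)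
        ⟨(F.map g).app c z, A.le_sheafify J _ ⟨Z, g, hS hZ g, z, rfl⟩⟩
      exact h1
    rw [← cancel_mono (e.counitInv.app V), ← hk₁, ← hk₂, this]
  have : IsIso i := isIso_of_mono_of_epi i
  let ψ : A.toFunctor ⟶ F.obj W :=
    { app c := ↾fun y => (F.map (x y.2.choose_spec.choose
        y.2.choose_spec.choose_spec.choose)).app c y.2.choose_spec.choose_spec.choose_spec.choose
      naturality := by
        intro c d k
        ext y
        have hy := y.2.choose_spec.choose_spec.choose_spec.choose_spec
        have hy' := (A.toFunctor.map k y).2.choose_spec.choose_spec.choose_spec.choose_spec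
        refine Eq.trans ?_ ((F.map (x y.2.choose_spec.choose
          y.2.choose_spec.choose_spec.choose)).naturality_apply k _)
        refine indep d _ _ _ _ _ _ (hy'.trans ?_)
        refine Eq.trans ?_ ((F.map y.2.choose_spec.choose).naturality_apply k _).symm
        exact congr_arg ((F.obj Y).map k) hy.symm }
  have hψ (c : Cᵒᵖ) {Z : T} (g : Z ⟶ Y) (hg : S g) (z : (F.obj Z).obj c) :
      ψ.app c ⟨(F.map g).app c z, Z, g, hg, z, rfl⟩ = (F.map (x g hg)).app c z := by
    let y : A.toFunctor.obj c := ⟨(F.map g).app c z, Z, g, hg, z, rfl⟩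
    exact indep c _ _ _ _ _ _ y.2.choose_spec.choose_spec.choose_spec.choose_spec
  let j : A' ⟶ e.functor.obj W := ⟨A.sheafifyLift ψ (hFsheaf W)⟩
  obtain ⟨t, ht⟩ := e.functor.map_surjective (inv i ≫ j)
  have ht' : i ≫ e.functor.map t = j := by rw [ht, IsIso.hom_inv_id_assoc]
  have hglue : (x.IsAmalgamation t) := by
    intro Z g hg
    apply e.functor.map_injective
    ext c z
    let y : A.toFunctor.obj c := ⟨(F.map g).app c z, Z, g, hg, z, rfl⟩
    have h1 : (F.map t).app c y.1 = (A.sheafifyLift ψ (hFsheaf W)).app c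
        ((Subfunctor.homOfLe (A.le_sheafify J)).app c y) :=
      ConcreteCategory.congr_hom (congr_arg (fun φ => φ.hom.app c) ht')
        ((Subfunctor.homOfLe (A.le_sheafify J)).app c y)
    have h2 := ConcreteCategory.congr_hom
      (NatTrans.congr_app (A.to_sheafifyLift ψ (hFsheaf W)) c) y
    have h3 := h1.trans (Eq.trans h2 (hψ c g hg z))
    have h4 : (e.functor.map (g ≫ t)).hom.app c z = (F.map t).app c y.1 := by
      rw [e.functor.map_comp]; rfl
    exact h4.trans h3
  exact ⟨t, hglue, fun t' h' => hK _ _ fun Z hZ g =>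
    (h' g (hS hZ g)).trans (hglue g (hS hZ g)).symm⟩

/-- In a locally connected topos, a sieve containing all morphisms from connected objects is
covering. -/
lemma mem_canonicalTopology_of_connected {T : Type (u + 1)} [LargeCategory.{u} T]
    [IsGrothendieckTopos.{u} T] [hT : IsLocallyConnected T] {X : T} (S : Sieve X)
    (hS : ∀ ⦃Z : T⦄, IsConnectedObject Z → ∀ g : Z ⟶ X, S g) :
    S ∈ Sheaf.canonicalTopology T X := by
  refine Sheaf.mem_finestTopology_of_forall_isSheafFor ?_
  rintro _ ⟨W, rfl⟩ Y f
  exact isSheafFor_of_isSeparating hT.isSeparating (S.pullback f) (fun Z hZ g => hS hZ _) W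

lemma isTrivializedBySieve_le_isLocallyConstant {T : Type (u + 1)} [LargeCategory.{u} T]
    [IsGrothendieckTopos.{u} T] [IsLocallyConnected T] (R : CoveringSieve T) :
    IsTrivializedBySieve R ≤ IsLocallyConstant T := by
  intro F hF
  refine (Sheaf.canonicalTopology T).transitive R.2 _ fun U h hR => ?_
  refine mem_canonicalTopology_of_connected _ fun Z hZ g => ?_
  exact ⟨Z, 𝟙 Z, g ≫ h, hF (g ≫ h) ((R : Sieve (⊤_ T)).downward_closed hR g) hZ, by simp⟩

lemma isTrivializedBySieve_le_isSumOfLocallyConstant {T : Type (u + 1)} [LargeCategory.{u} T]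
    [IsGrothendieckTopos.{u} T] [IsLocallyConnected T] (R : CoveringSieve T) :
    IsTrivializedBySieve R ≤ IsSumOfLocallyConstant T := fun F hF =>
  ⟨PUnit, fun _ => F, fun _ => 𝟙 F,
    fun _ => isTrivializedBySieve_le_isLocallyConstant R F hF,
    ⟨Cofan.IsColimit.mk _ (fun s => s.inj PUnit.unit) (fun _ _ => Category.id_comp _)
      (fun s m hm => by simpa using hm PUnit.unit)⟩⟩

/-! ### Progroupoids and their classifying toposes -/

section Progroupoid

variable {I : Type v₁} [Category.{w₁} I]

/-- A strict progroupoid: a projective system of groupoids, indexed by a (co)filtering category,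
whose transition functors are bijective on objects and surjective on morphisms between any two
given objects. -/
structure IsStrictProgroupoid (G : I ⥤ Grpd.{w₂, v₂}) : Prop where
  isCofiltered : IsCofiltered I
  bijective_obj : ∀ ⦃i j : I⦄ (φ : i ⟶ j),
    Function.Bijective (fun x : G.obj i => (G.map φ : G.obj i ⥤ G.obj j).obj x)
  surjective_map : ∀ ⦃i j : I⦄ (φ : i ⟶ j) (x y : G.obj i),
    Function.Surjective (fun f : x ⟶ y => (G.map φ : G.obj i ⥤ G.obj j).map f)

/-- The classifying topos `𝔅G` of a groupoid `G`: the category of functors from `G` to sets, that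
is, of presheaves on the opposite category. -/
abbrev ClassifyingCat (G : Type v₁) [Groupoid.{w₁} G] := G ⥤ Type u

/-- The inverse image functor `𝔅(G j) ⥤ 𝔅(G i)` of the topos morphism `𝔅(G i) ⟶ 𝔅(G j)` induced by
`i ⟶ j`. -/
abbrev restr (G : I ⥤ Grpd.{w₂, v₂}) {i j : I} (φ : i ⟶ j) :
    ClassifyingCat.{u} (G.obj j) ⥤ ClassifyingCat.{u} (G.obj i) :=
  (Functor.whiskeringLeft _ _ _).obj (G.map φ : G.obj i ⥤ G.obj j)

/-- Restriction along the identity is the identity. -/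
def restrId (G : I ⥤ Grpd.{w₂, v₂}) (i : I) : restr.{u} G (𝟙 i) ≅ 𝟭 _ :=
  eqToIso (congr_arg (fun F : G.obj i ⥤ G.obj i =>
    (Functor.whiskeringLeft _ _ (Type u)).obj F) (G.map_id i))

/-- Restriction along a composite is the composite of the restrictions. -/
def restrComp (G : I ⥤ Grpd.{w₂, v₂}) {i j k : I} (φ : i ⟶ j) (ψ : j ⟶ k) :
    restr.{u} G (φ ≫ ψ) ≅ restr G ψ ⋙ restr G φ :=
  eqToIso (congr_arg (fun F : G.obj i ⥤ G.obj k =>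
    (Functor.whiskeringLeft _ _ (Type u)).obj F) (G.map_comp φ ψ))

/-- A 2-cone (pseudo-cone) with vertex `E` over the projective 2-system of toposes `i ↦ 𝔅(G i)`:
topos morphisms `E ⟶ 𝔅(G i)` together with coherent 2-isomorphisms between the composites
`E ⟶ 𝔅(G i) ⟶ 𝔅(G j)` and the morphisms `E ⟶ 𝔅(G j)`. -/
structure TwoCone (G : I ⥤ Grpd.{w₂, v₂}) (E : Type v₃) [Category.{w₃} E] where
  proj (i : I) : ToposMor E (ClassifyingCat.{u} (G.obj i))
  iso {i j : I} (φ : i ⟶ j) : restr G φ ⋙ (proj i).obj ≅ (proj j).obj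
  iso_id (i : I) (X : ClassifyingCat.{u} (G.obj i)) :
    (iso (𝟙 i)).hom.app X = (proj i).obj.map ((restrId G i).hom.app X)
  iso_comp {i j k : I} (φ : i ⟶ j) (ψ : j ⟶ k) (X : ClassifyingCat.{u} (G.obj k)) :
    (iso (φ ≫ ψ)).hom.app X = (proj i).obj.map ((restrComp G φ ψ).hom.app X) ≫
      (iso φ).hom.app ((restr G ψ).obj X) ≫ (iso ψ).hom.app X

namespace TwoCone

variable {G : I ⥤ Grpd.{w₂, v₂}} {E : Type v₃} [Category.{w₃} E]

/-- Morphisms of 2-cones: families of 2-morphisms compatible with the structural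
2-isomorphisms. -/
@[ext]
structure Hom (c d : TwoCone.{u} G E) where
  app (i : I) : c.proj i ⟶ d.proj i
  comm {i j : I} (φ : i ⟶ j) (X : ClassifyingCat.{u} (G.obj j)) :
    (c.iso φ).hom.app X ≫ (app j).hom.app X =
      (app i).hom.app ((restr G φ).obj X) ≫ (d.iso φ).hom.app X

instance : Category (TwoCone.{u} G E) where
  Hom c d := Hom c d
  id c :=
    { app i := 𝟙 _
      comm φ X := by simp }
  comp α β :=
    { app i := α.app i ≫ β.app i
      comm φ X := by
        have h₁ := α.comm φ X
        have h₂ := β.comm φ X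
        simp only [ObjectProperty.FullSubcategory.comp_hom, NatTrans.comp_app, Category.assoc]
        rw [reassoc_of% h₁, h₂] }
  id_comp α := Hom.ext (funext fun i => Category.id_comp (α.app i))
  comp_id α := Hom.ext (funext fun i => Category.comp_id (α.app i))
  assoc α β γ := Hom.ext (funext fun i => Category.assoc (α.app i) (β.app i) (γ.app i))

/-- Composing the projections of a 2-cone with vertex `S` with topos morphisms `E ⟶ S`. -/
def precomp {S : Type v₄} [Category.{w₄} S] (c : TwoCone.{u} G S)
    (E : Type v₃) [Category.{w₃} E] : ToposMor E S ⥤ TwoCone.{u} G E where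
  obj h :=
    { proj i := ToposMor.comp h (c.proj i)
      iso φ := Functor.isoWhiskerRight (c.iso φ) h.obj
      iso_id i X := congr_arg h.obj.map (c.iso_id i X)
      iso_comp φ ψ X := (congr_arg h.obj.map (c.iso_comp φ ψ X)).trans (by
        simp [ToposMor.comp]) }
  map {h h'} α :=
    { app i := ObjectProperty.homMk (Functor.whiskerLeft (c.proj i).obj α.hom)
      comm φ X := (α.hom.naturality ((c.iso φ).hom.app X)) }
  map_id _ := Hom.ext (funext fun i => by ext; rfl)
  map_comp _ _ := Hom.ext (funext fun i => by ext; rfl)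

/-- A 2-cone with vertex `S` is a 2-limit in the 2-category of toposes if, for each topos `E`,
composition with its projections is an equivalence from the category of topos morphisms `E ⟶ S` to
that of 2-cones with vertex `E`. -/
def IsTwoLimit {S : Type (u + 1)} [LargeCategory.{u} S] (c : TwoCone.{u} G S) : Prop :=
  ∀ (E : Type (u + 1)) [LargeCategory.{u} E] [IsGrothendieckTopos.{u} E],
    (c.precomp E).IsEquivalence

end TwoCone

/-- `S` is (equivalent to) the classifying topos of the progroupoid `G`: it is the 2-limit, in the
2-category of toposes, of the classifying toposes of the groupoids `G i`. -/
structure IsClassifyingTopos (G : I ⥤ Grpd.{w₂, v₂}) (S : Type (u + 1)) [LargeCategory.{u} S] :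
    Prop where
  isTopos_component (i : I) : IsGrothendieckTopos.{u} (ClassifyingCat.{u} (G.obj i))
  isTopos : IsGrothendieckTopos.{u} S
  exists_isTwoLimit : ∃ c : TwoCone.{u} G S, c.IsTwoLimit

end Progroupoid

/-! ### The fundamental progroupoid -/

section Fundamental

variable (T : Type (u + 1)) [LargeCategory.{u} T] [IsGrothendieckTopos.{u} T]

/-- The base points of `T`: the topos morphisms from sets to `SLC T`. -/
abbrev BasePoint := ToposMor (Type u) (SLC T)

variable {T}

/-- `P` contains a point of each connected component of `SLC T`. A connected component is a
connected summand `C` of the final object, and a point lies in `C` when its fiber at `C` is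
nonempty. -/
def MeetsEveryComponent (P : Set (BasePoint T)) : Prop :=
  ∀ ⦃C C' Z : SLC T⦄ (i : C ⟶ Z) (i' : C' ⟶ Z), Nonempty (IsTerminal Z) →
    Nonempty (IsColimit (BinaryCofan.mk i i')) → IsConnectedObject C →
      ∃ p ∈ P, Nonempty (p.obj.obj C)

variable [IsLocallyConnected T]

/-- The inverse image functor of a base point seen as a point of `LC(T, R)`: the restriction of its
inverse image functor along the inclusion of `LC(T, R)` in `SLC T`. -/
abbrev BasePoint.fiber (p : BasePoint T) (R : CoveringSieve T) : LC R ⥤ Type u :=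
  ObjectProperty.ιOfLE (isTrivializedBySieve_le_isSumOfLocallyConstant R) ⋙ p.obj

/-- The objects of the groupoid `G_R`: the elements of `P`. -/
structure PointGroupoid (P : Set (BasePoint T)) (R : CoveringSieve T) where
  pt : P

/-- The morphisms of `G_R`: the 2-isomorphisms between the elements of `P` seen as points of
`LC(T, R)`, i.e. the natural isomorphisms between their inverse image functors. -/
instance (P : Set (BasePoint T)) (R : CoveringSieve T) : Groupoid (PointGroupoid P R) where
  Hom p q := p.pt.1.fiber R ≅ q.pt.1.fiber R
  id p := Iso.refl _
  comp α β := α ≪≫ β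
  inv α := α.symm

/-- The restriction functor `G_{R'} ⥤ G_R` for a finer sieve `R' ≤ R`. -/
def PointGroupoid.restrict (P : Set (BasePoint T)) {R' R : CoveringSieve T} (h : R' ≤ R) :
    PointGroupoid P R' ⥤ PointGroupoid P R where
  obj p := ⟨p.pt⟩
  map α := Functor.isoWhiskerLeft (LC.inclusion h) α
  map_id _ := Iso.ext rfl
  map_comp _ _ := Iso.ext rfl

variable (T) in
/-- The fundamental progroupoid `π₁(T, P)`: the projective system of the groupoids `G_R`, indexed by
the covering sieves of the final object. -/
def fundamentalProgroupoid (P : Set (BasePoint T)) : CoveringSieve T ⥤ Grpd.{u + 1, u + 1} where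
  obj R := Grpd.of (PointGroupoid P R)
  map φ := PointGroupoid.restrict P φ.le
  map_id _ := rfl
  map_comp _ _ := rfl

end Fundamental

end ToposPi

/-!
A locally connected topos is handled through separating classes of connected objects: a morphism
from a connected object to a coproduct factors through a single summand, and by universality of
colimits an object is a coproduct of connected ones. For a covering sieve `R`, the connected objects
belonging to `R` form such a class, and `F` is in `LC(T, R)` if and only if each morphism `W ⟶ V`
between them induces a bijection `Hom(V, F) → Hom(W, F)` (`isTrivializedBySieve_eq_isLocal`). So a
morphism to `F` can be transported along zigzags of connected objects of `R`.

The relations between zigzags starting at `U` form a set, which bounds the morphisms from `U` to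
objects of `LC(T, R)`; as `LC(T, R)` is closed under limits, each connected `U` in `R` has a
reflection in it, a connected object called here a universal cover (`exists_isUniversalCover`).
Morphisms between universal covers are isomorphisms, and evaluation on a small groupoid of universal
covers is an equivalence from `LC(T, R)` to the presheaves on this groupoid
(`isEquivalence_nerve`). In particular the inclusion of `LC(T, R)` in `SLC T` is the inverse image
of a topos morphism (`isLeftAdjoint_ιOfLE`).

The objects of `SLC T` are the coproducts of connected objects belonging to some `LC(T, R)`. These
connected locally constant objects form an essentially small category in which all morphisms are
epimorphisms of `T` and which satisfies the right Ore condition. Every sheaf for its atomic topology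
is a coproduct of representable ones (`nonempty_connNerve_iso`), so that `SLC T` is the category of
these sheaves and a topos.

The fiber functor of a base point on `LC(T, R)` is corepresented by any universal cover with a point
(`BasePoint.bijective_fiber`). If `P` meets every component, each universal cover has a point over
an element of `P`. Hence `G_R` is equivalent to the opposite of the groupoid of universal covers,
and `LC(T, R)` is the classifying topos of `G_R` (`MeetsEveryComponent.isEquivalence_fiberFunctor`).
The system is strict because the points of a universal cover for `R` lift to universal covers for a
smaller sieve `R'` (`surjective_restrict`).

For the 2-limit, `𝔅(G_R)` is replaced by `LC(T, R)`. Inverse image functors preserve coproducts, so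
that natural transformations are determined by, and can be defined on, connected locally constant
objects; this gives full faithfulness. A compatible system of inverse image functors on the
`LC(T, R)` defines a functor on connected locally constant objects, extended to `SLC T` by
coproducts. The extension has a right adjoint because the presheaves `Y ↦ Hom(D Y, e)` are atomic
sheaves: each `LC(T, R)` contains the kernel pair of a morphism between its connected objects, and
the inverse image functor on it preserves the coequalizer. It is left exact because its restrictions
are, and pullbacks can be computed on summands (`GeneratesByCoproducts.preservesFiniteLimits`,
`LCSystem.exists_extension`).
-/

namespace ToposPi

/-! ### Universality of colimits in a topos -/

section Universal

variable {J : Type w₁} [Category.{v₁} J]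

/-- Colimits of sets are universal. -/
lemma isUniversalColimit_types {F : J ⥤ Type u} {c : Cocone F} (hc : IsColimit c) :
    IsUniversalColimit c := by
  intro F' c' α f hf hα H
  have hf' (k : J) (y : F'.obj k) : c.ι.app k (α.app k y) = f (c'.ι.app k y) :=
    ConcreteCategory.congr_hom (NatTrans.congr_app hf k) y
  rw [Types.isColimit_iff_coconeTypesIsColimit]
  refine ⟨⟨?_, ?_⟩⟩
  · intro p q hpq
    obtain ⟨j, x, rfl⟩ := F'.ιColimitType_jointly_surjective p
    obtain ⟨k, y, rfl⟩ := F'.ιColimitType_jointly_surjective q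
    have hxy : c'.ι.app k y = c'.ι.app j x := hpq.symm
    -- The sets of elements of the colimit of `F'` lying over a given element of `F` and over the
    -- point `c'.ι.app j x` form a cocone on `F`, and so depend only on the image in `c.pt`.
    let s : F.CoconeTypes :=
      { pt := Set F'.ColimitType
        ι k a := {q | ∃ y : F'.obj k, α.app k y = a ∧ c'.ι.app k y = c'.ι.app j x ∧
          F'.ιColimitType k y = q}
        ι_naturality {k l} φ := by
          ext a q
          constructor
          · rintro ⟨y, hy, hy', rfl⟩
            obtain ⟨y₀, rfl, hy₀⟩ := Types.exists_of_isPullback (hα φ) y a hy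
            refine ⟨y₀, hy₀, ?_, (F'.ιColimitType_map φ y₀).symm⟩
            rw [← hy']
            exact (ConcreteCategory.congr_hom (c'.w φ) y₀).symm
          · rintro ⟨y, rfl, hy', rfl⟩
            refine ⟨F'.map φ y, (NatTrans.naturality_apply α φ y), ?_, F'.ιColimitType_map φ y⟩
            rw [← hy']
            exact ConcreteCategory.congr_hom (c'.w φ) y }
    have hc₁ := (Types.isColimit_iff_coconeTypesIsColimit c).1 ⟨hc⟩
    have h₁ := hc₁.fac_apply s j (α.app j x)
    have h₂ := hc₁.fac_apply s k (α.app k y)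
    have h₃ : c.ι.app j (α.app j x) = c.ι.app k (α.app k y) := by rw [hf', hf', hxy]
    have h₄ : s.ι j (α.app j x) = s.ι k (α.app k y) := h₁.symm.trans ((congr_arg _ h₃).trans h₂)
    have h₅ : F'.ιColimitType k y ∈ s.ι k (α.app k y) := ⟨y, rfl, hxy, rfl⟩
    rw [← h₄] at h₅
    obtain ⟨x', hx', hx'', h⟩ := h₅
    rw [← h, Types.ext_of_isPullback (H j) hx'' hx']
  · intro z
    obtain ⟨j, y, hy⟩ := Types.jointly_surjective_of_isColimit hc (f z)
    obtain ⟨x, hx, -⟩ := Types.exists_of_isPullback (H j) z y hy.symm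
    exact ⟨F'.ιColimitType j x, hx⟩

/-- Colimits of presheaves of sets are universal. -/
lemma isUniversalColimit_presheaf {C : Type w₂} [Category.{v₂} C] [Small.{u} J]
    {F : J ⥤ C ⥤ Type u} {c : Cocone F} (hc : IsColimit c) : IsUniversalColimit c := by
  intro F' c' α f hf hα H
  refine ⟨evaluationJointlyReflectsColimits _ fun x => ?_⟩
  refine (isUniversalColimit_types (isColimitOfPreserves ((evaluation C (Type u)).obj x) hc)
    (((evaluation C _).obj x).mapCocone c') (Functor.whiskerRight α _)
    (((evaluation C _).obj x).map f) ?_ (hα.whiskerRight _)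
    fun j => (H j).map ((evaluation C _).obj x)).some
  ext y : 2
  exact NatTrans.congr_app (NatTrans.congr_app hf y) x

/-- Colimits of sheaves of sets are universal. -/
lemma isUniversalColimit_sheaf {C : Type u} [SmallCategory C] (K : GrothendieckTopology C)
    [Small.{u} J] {F : J ⥤ Sheaf K (Type u)} {c : Cocone F} (hc : IsColimit c) :
    IsUniversalColimit c := by
  let adj := sheafificationAdjunction K (Type u)
  have h := (isUniversalColimit_presheaf
    (colimit.isColimit (F ⋙ sheafToPresheaf K (Type u)))).map_reflective adj
  let β : F ⟶ (F ⋙ sheafToPresheaf K (Type u)) ⋙ presheafToSheaf K (Type u) :=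
    Functor.whiskerLeft F (inv adj.counit)
  have h' := h.precompose_isIso β
  exact h'.of_iso (h'.isColimit.uniqueUpToIso hc)

variable {T : Type (u + 1)} [LargeCategory.{u} T] [hT : IsGrothendieckTopos.{u} T]

instance : HasLimits T := by
  obtain ⟨C, _, K, ⟨e⟩⟩ := hT.exists_site
  exact Adjunction.has_limits_of_equivalence e.functor

instance : HasColimits T := by
  obtain ⟨C, _, K, ⟨e⟩⟩ := hT.exists_site
  exact ⟨fun J _ => Adjunction.hasColimitsOfShape_of_equivalence e.functor⟩

instance : FinitaryExtensive T := by
  obtain ⟨C, _, K, ⟨e⟩⟩ := hT.exists_site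
  exact finitaryExtensive_of_preserves_and_reflects_isomorphism e.functor

/-- Colimits in a topos are universal. -/
lemma isUniversalColimit [Small.{u} J] {F : J ⥤ T} {c : Cocone F} (hc : IsColimit c) :
    IsUniversalColimit c := by
  obtain ⟨C, _, K, ⟨e⟩⟩ := hT.exists_site
  exact (isUniversalColimit_sheaf K (isColimitOfPreserves e.functor hc)).of_mapCocone e.functor

end Universal

/-! ### Coproducts in a topos -/

section Coproducts

variable {T : Type (u + 1)} [LargeCategory.{u} T] [IsGrothendieckTopos.{u} T]

/-- A coproduct is the binary coproduct of one of its summands and of the sum of the others. -/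
lemma nonempty_isColimit_binaryCofan_of_cofan {I : Type u} {Y : I → T} {c : Cofan Y}
    (hc : IsColimit c) (i : I) :
    Nonempty (IsColimit (BinaryCofan.mk (c.inj i)
      (Sigma.desc (fun j : {j // j ≠ i} => c.inj j.1)))) := by
  classical
  refine ⟨BinaryCofan.IsColimit.mk _ (fun {W} f g => Cofan.IsColimit.desc hc fun j =>
    if h : j = i then eqToHom (by rw [h]) ≫ f else
      Sigma.ι (fun j : {j // j ≠ i} => Y j.1) ⟨j, h⟩ ≫ g) ?_ ?_ ?_⟩
  · intro W f g
    exact (Cofan.IsColimit.fac hc _ i).trans (by simp)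
  · intro W f g
    refine Sigma.hom_ext _ _ fun j => (Sigma.ι_desc_assoc _ _ _).trans ?_
    exact (Cofan.IsColimit.fac hc _ j.1).trans (dif_neg j.2)
  · intro W f g m h₁ h₂
    refine Cofan.IsColimit.hom_ext hc _ _ fun j => ?_
    rw [Cofan.IsColimit.fac]
    by_cases h : j = i
    · subst h
      refine Eq.trans h₁ (by simp)
    · rw [dif_neg h, ← h₂]
      exact (Sigma.ι_desc_assoc (fun j : {j // j ≠ i} => c.inj j.1) ⟨j, h⟩ m).symm

lemma mono_inj_of_isColimit {I : Type u} {Y : I → T} {c : Cofan Y} (hc : IsColimit c) (i : I) :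
    Mono (c.inj i) :=
  FinitaryExtensive.mono_inl_of_isColimit (nonempty_isColimit_binaryCofan_of_cofan hc i).some

lemma nonempty_isInitial_of_binaryCofan {X₁ X₂ X W : T} {i₁ : X₁ ⟶ X} {i₂ : X₂ ⟶ X}
    (hc : IsColimit (BinaryCofan.mk i₁ i₂)) (g : W ⟶ X₁) (h : W ⟶ X₂) (w : g ≫ i₁ = h ≫ i₂) :
    Nonempty (IsInitial W) := by
  have := FinitaryExtensive.isPullback_initial_to_binaryCofan hc
  exact ⟨(IsInitial.ofIso initialIsInitial (asIso (this.lift g h w)).symm)⟩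

/-- The summands of a coproduct are disjoint. -/
lemma eq_of_comp_inj_eq {I : Type u} {Y : I → T} {c : Cofan Y} (hc : IsColimit c) {W : T}
    (hW : IsEmpty (IsInitial W)) {i j : I} (g : W ⟶ Y i) (h : W ⟶ Y j)
    (w : g ≫ c.inj i = h ≫ c.inj j) : i = j := by
  by_contra hij
  obtain ⟨h₁⟩ := nonempty_isColimit_binaryCofan_of_cofan hc i
  obtain ⟨h₂⟩ := nonempty_isInitial_of_binaryCofan h₁ g
    (h ≫ Sigma.ι (fun j : {j // j ≠ i} => Y j.1) ⟨j, Ne.symm hij⟩) (by simpa using w)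
  exact hW.false h₂

/-- The pullback of a coproduct along a morphism is a coproduct. -/
lemma nonempty_isColimit_pullback_cofan {I : Type u} {Y : I → T} {c : Cofan Y} (hc : IsColimit c)
    {X : T} (t : X ⟶ c.pt) {P : I → T} (p : ∀ i, P i ⟶ X) (q : ∀ i, P i ⟶ Y i)
    (h : ∀ i, IsPullback (p i) (q i) t (c.inj i)) : Nonempty (IsColimit (Cofan.mk X p)) :=
  isUniversalColimit hc (Cofan.mk X p) (Discrete.natTrans fun i => q i.as) t
    (by ext ⟨i⟩; exact (h i).w.symm) (.of_discrete _) fun i => h i.as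

lemma isEmpty_isInitial_of_hom {V W : T} (g : V ⟶ W) (hV : IsEmpty (IsInitial V)) :
    IsEmpty (IsInitial W) :=
  ⟨fun h => by
    have := h.isIso_to g
    exact hV.false (h.ofIso (asIso g).symm)⟩

/-- A morphism from a connected object to a coproduct factors through a summand. -/
lemma IsConnectedObject.exists_factor {V : T} (hV : IsConnectedObject V) {I : Type u} {Y : I → T}
    {c : Cofan Y} (hc : IsColimit c) (f : V ⟶ c.pt) : ∃ i, ∃ g : V ⟶ Y i, g ≫ c.inj i = f := by
  have hp (i : I) := IsPullback.of_hasPullback f (c.inj i)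
  obtain ⟨hd⟩ := nonempty_isColimit_pullback_cofan hc f _ _ hp
  have : ∃ i, IsEmpty (IsInitial (pullback f (c.inj i))) := by
    by_contra! h
    refine hV.1.false (IsInitial.ofUniqueHom
      (fun W => Cofan.IsColimit.desc hd fun i => (h i).some.to W)
      fun W m => Cofan.IsColimit.hom_ext hd _ _ fun i => (h i).some.hom_ext _ _)
  obtain ⟨i, hi⟩ := this
  obtain ⟨hb⟩ := nonempty_isColimit_binaryCofan_of_cofan hd i
  obtain h | ⟨⟨h⟩⟩ := hV.2 _ _ ⟨hb⟩
  · exact hi.elim h.some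
  · obtain ⟨s, hs⟩ : ∃ s : V ⟶ pullback f (c.inj i), pullback.fst f (c.inj i) ≫ s = 𝟙 _ :=
      ⟨_, (BinaryCofan.IsColimit.desc' hb (𝟙 _) (h.to _)).2.1⟩
    refine ⟨i, s ≫ pullback.snd _ _, ?_⟩
    have : s ≫ pullback.fst f (c.inj i) = 𝟙 V := by
      refine BinaryCofan.IsColimit.hom_ext hb ?_ (h.hom_ext _ _)
      change pullback.fst f (c.inj i) ≫ s ≫ _ = pullback.fst f (c.inj i) ≫ _
      rw [← Category.assoc, hs, Category.id_comp, Category.comp_id]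
    rw [Category.assoc, ← pullback.condition, ← Category.assoc, this, Category.id_comp]

end Coproducts

/-! ### Separating classes of connected objects -/

section Separating

variable {T : Type (u + 1)} [LargeCategory.{u} T] [IsGrothendieckTopos.{u} T]
  {K : ObjectProperty T}

/-- Morphisms can be defined on the objects of a separating class. -/
lemma exists_amalgamation (hK : K.IsSeparating) {X Y : T}
    (φ : ∀ ⦃Z : T⦄, K Z → (Z ⟶ X) → (Z ⟶ Y))
    (hφ : ∀ ⦃Z Z' : T⦄ (hZ : K Z) (hZ' : K Z') (h : Z' ⟶ Z) (g : Z ⟶ X),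
      φ hZ' (h ≫ g) = h ≫ φ hZ g) :
    ∃ t : X ⟶ Y, ∀ ⦃Z : T⦄ (hZ : K Z) (g : Z ⟶ X), g ≫ t = φ hZ g := by
  let S : Sieve X := Sieve.generate (fun Z _ => K Z)
  have key {W : T} {Z Z' : T} (hZ : K Z) (hZ' : K Z') (h : W ⟶ Z) (g : Z ⟶ X) (h' : W ⟶ Z')
      (g' : Z' ⟶ X) (w : h ≫ g = h' ≫ g') : h ≫ φ hZ g = h' ≫ φ hZ' g' :=
    hK _ _ fun V hV k => by
      rw [← Category.assoc, ← Category.assoc, ← hφ hZ hV, ← hφ hZ' hV, Category.assoc, w,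
        Category.assoc]
  choose Z k l hZ hkl using fun (W : T) (g : W ⟶ X) (hg : S g) => hg
  let x : Presieve.FamilyOfElements (yoneda.obj Y) S.arrows := fun W g hg =>
    k W g hg ≫ φ (hZ W g hg) (l W g hg)
  have hx : x.Compatible := by
    intro W₁ W₂ V g₁ g₂ f₁ f₂ h₁ h₂ w
    change g₁ ≫ _ ≫ _ = g₂ ≫ _ ≫ _
    rw [← Category.assoc, ← Category.assoc]
    refine key _ _ _ _ _ _ ?_
    rw [Category.assoc, Category.assoc, hkl, hkl, w]
  obtain ⟨t, ht, -⟩ := isSheafFor_of_isSeparating hK S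
    (fun Z hZ g => ⟨Z, 𝟙 Z, g, hZ, Category.id_comp g⟩) Y x hx
  refine ⟨t, fun W hW g => ?_⟩
  have hg : S g := ⟨W, 𝟙 W, g, hW, Category.id_comp g⟩
  refine (ht g hg).trans ?_
  have := key (hZ W g hg) hW (k W g hg) (l W g hg) (𝟙 W) g (by rw [hkl, Category.id_comp])
  simpa using this

/-- The objects of a separating class detect isomorphisms. -/
lemma isIso_of_bijective (hK : K.IsSeparating) {X Y : T} (f : X ⟶ Y)
    (hf : ∀ ⦃Z : T⦄, K Z → Function.Bijective (fun g : Z ⟶ X => g ≫ f)) : IsIso f := by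
  have hf' ⦃Z : T⦄ (hZ : K Z) (g : Z ⟶ Y) : ∃ g' : Z ⟶ X, g' ≫ f = g := (hf hZ).2 g
  choose φ hφ using hf'
  obtain ⟨t, ht⟩ := exists_amalgamation hK φ fun Z Z' hZ hZ' h g => (hf hZ').1 (by
    dsimp only
    rw [hφ, Category.assoc, hφ])
  refine ⟨t, hK _ _ fun Z hZ g => (hf hZ).1 ?_, hK _ _ fun Z hZ g => ?_⟩
  · dsimp only
    rw [← Category.assoc g f t, ht hZ, hφ, Category.comp_id]
  · rw [← Category.assoc, ht hZ, hφ, Category.comp_id]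

lemma nonempty_isInitial_of_isSeparating (hK : K.IsSeparating) {X : T}
    (hX : ∀ ⦃Z : T⦄, K Z → IsEmpty (Z ⟶ X)) : Nonempty (IsInitial X) := by
  have := isIso_of_bijective hK (initial.to X) fun Z hZ =>
    ⟨fun g => ((hX hZ).false (g ≫ initial.to X)).elim, fun g => ((hX hZ).false g).elim⟩
  exact ⟨initialIsInitial.ofIso (asIso (initial.to X))⟩

lemma exists_hom_of_isSeparating (hK : K.IsSeparating) {X : T} (hX : IsEmpty (IsInitial X)) :
    ∃ Z, K Z ∧ Nonempty (Z ⟶ X) := by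
  by_contra! h
  exact hX.elim (nonempty_isInitial_of_isSeparating hK fun Z hZ => h Z hZ).some

/-- A separating class in a topos contains a small separating family. -/
lemma exists_small_isSeparating (hK : K.IsSeparating) :
    ∃ (ι : Type u) (s : ι → T), (∀ i, K (s i)) ∧ (ObjectProperty.ofObj s).IsSeparating := by
  obtain ⟨C, _, J, ⟨e⟩⟩ := (inferInstance : IsGrothendieckTopos.{u} T).exists_site
  let G (c : C) : T := e.inverse.obj ((presheafToSheaf J (Type u)).obj (yoneda.obj c))
  have hG {X Y : T} (f g : X ⟶ Y) (h : ∀ c (k : G c ⟶ X), k ≫ f = k ≫ g) : f = g := by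
    apply e.functor.map_injective
    ext c x
    have r := sectionsCorep e c.unop
    have h₁ := r.homEquiv_comp f (r.homEquiv.symm x)
    have h₂ := r.homEquiv_comp g (r.homEquiv.symm x)
    rw [h, h₂, Equiv.apply_symm_apply] at h₁
    exact h₁.symm
  -- One object of `K` is chosen for each morphism between generators that factors through `K`.
  let ι := Σ (c c' : C), {m : G c' ⟶ G c // ∃ (Z : T) (_ : K Z) (a : G c' ⟶ Z) (b : Z ⟶ G c),
    a ≫ b = m}
  let s (i : ι) : T := i.2.2.2.choose
  refine ⟨ι, s, fun i => i.2.2.2.choose_spec.choose, fun X Y f g h => ?_⟩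
  refine hG _ _ fun c k => hK _ _ fun Z hZ l => hG _ _ fun c' m => ?_
  let i : ι := ⟨c, c', m ≫ l, Z, hZ, m, l, rfl⟩
  obtain ⟨a, b, hab⟩ := i.2.2.2.choose_spec.choose_spec
  have hab' : a ≫ b = m ≫ l := hab
  have := h (s i) ⟨i⟩ (b ≫ k)
  rw [← Category.assoc m l, ← Category.assoc m l, ← hab']
  simp only [Category.assoc] at this ⊢
  rw [this]

/-- An invariant of the morphisms from the objects of a separating class of connected objects to
`X` decomposes `X` as a coproduct. -/
lemma exists_cofan_of_invariant (hK : K.IsSeparating) (hK' : K ≤ IsConnectedObject) {X : T}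
    {I : Type u} (κ : ∀ ⦃Z : T⦄, K Z → (Z ⟶ X) → I)
    (hκ : ∀ ⦃Z Z' : T⦄ (hZ : K Z) (hZ' : K Z') (h : Z' ⟶ Z) (g : Z ⟶ X),
      κ hZ' (h ≫ g) = κ hZ g) :
    ∃ (Y : I → T) (i : ∀ k, Y k ⟶ X), Nonempty (IsColimit (Cofan.mk X i)) ∧
      ∀ k ⦃Z : T⦄ (hZ : K Z) (g : Z ⟶ X), κ hZ g = k ↔ ∃ g' : Z ⟶ Y k, g' ≫ i k = g := by
  -- The invariant is given by a morphism to the constant object on `I`.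
  obtain ⟨t, ht⟩ := exists_amalgamation hK (Y := ∐ fun _ : I => ⊤_ T)
    (fun Z hZ g => terminal.from Z ≫ Sigma.ι (fun _ : I => ⊤_ T) (κ hZ g))
    (fun Z Z' hZ hZ' h g => by rw [hκ hZ hZ', ← Category.assoc, terminal.comp_from])
  let hc := coproductIsCoproduct (fun _ : I => ⊤_ T)
  refine ⟨fun k => pullback t (Sigma.ι _ k), fun k => pullback.fst _ _,
    nonempty_isColimit_pullback_cofan hc t _ _ fun k => IsPullback.of_hasPullback t (Sigma.ι _ k),
    fun k Z hZ g => ⟨?_, ?_⟩⟩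
  · rintro rfl
    exact ⟨pullback.lift g (terminal.from Z) (ht hZ g), pullback.lift_fst _ _ _⟩
  · rintro ⟨g', rfl⟩
    have h₁ := ht hZ (g' ≫ pullback.fst _ _)
    rw [Category.assoc, pullback.condition, ← Category.assoc] at h₁
    exact (eq_of_comp_inj_eq hc (hK' _ hZ).1 _ _ h₁).symm

/-- A predicate on the morphisms from the objects of a separating class of connected objects to
`X` that is invariant under composition splits `X` in two. -/
lemma exists_binaryCofan_of_invariant (hK : K.IsSeparating) (hK' : K ≤ IsConnectedObject) {X : T}
    (P : ∀ ⦃Z : T⦄, K Z → (Z ⟶ X) → Prop)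
    (hP : ∀ ⦃Z Z' : T⦄ (hZ : K Z) (hZ' : K Z') (h : Z' ⟶ Z) (g : Z ⟶ X),
      P hZ' (h ≫ g) ↔ P hZ g) :
    ∃ (X₁ X₂ : T) (i₁ : X₁ ⟶ X) (i₂ : X₂ ⟶ X), Nonempty (IsColimit (BinaryCofan.mk i₁ i₂)) ∧
      (∀ ⦃Z : T⦄ (hZ : K Z) (g : Z ⟶ X), P hZ g ↔ ∃ g', g' ≫ i₁ = g) ∧
      (∀ ⦃Z : T⦄ (hZ : K Z) (g : Z ⟶ X), ¬ P hZ g ↔ ∃ g', g' ≫ i₂ = g) := by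
  obtain ⟨Y, i, ⟨hc⟩, h⟩ := exists_cofan_of_invariant hK hK' (I := ULift.{u} Prop)
    (fun Z hZ g => ⟨P hZ g⟩) (fun Z Z' hZ hZ' h g => by rw [hP hZ hZ'])
  refine ⟨Y ⟨True⟩, Y ⟨False⟩, i ⟨True⟩, i ⟨False⟩, ⟨?_⟩, fun Z hZ g => ?_, fun Z hZ g => ?_⟩
  · classical
    refine BinaryCofan.IsColimit.mk _ (fun {W} f g => Cofan.IsColimit.desc hc fun j =>
      if h : j.down then eqToHom (by cases j; simp_all) ≫ f
        else eqToHom (by cases j; simp_all) ≫ g) ?_ ?_ ?_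
    · intro W f g
      exact (Cofan.IsColimit.fac hc _ (⟨True⟩ : ULift Prop)).trans (by simp)
    · intro W f g
      exact (Cofan.IsColimit.fac hc _ (⟨False⟩ : ULift Prop)).trans (by simp)
    · intro W f g m h₁ h₂
      refine Cofan.IsColimit.hom_ext hc _ _ fun j => ?_
      rw [Cofan.IsColimit.fac]
      obtain ⟨j⟩ := j
      by_cases hj : j
      · obtain rfl : j = True := by simp [hj]
        exact Eq.trans h₁ (by simp)
      · obtain rfl : j = False := by simp [hj]
        exact Eq.trans h₂ (by simp)
  · rw [← h _ hZ]; simp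
  · rw [← h _ hZ]; simp

/-- On a connected object `X`, a predicate on the morphisms from the objects of a separating class
of connected objects to `X` that is invariant under composition is constant. -/
lemma IsConnectedObject.forall_of_invariant (hK : K.IsSeparating) (hK' : K ≤ IsConnectedObject)
    {X : T} (hX : IsConnectedObject X) (P : ∀ ⦃Z : T⦄, K Z → (Z ⟶ X) → Prop)
    (hP : ∀ ⦃Z Z' : T⦄ (hZ : K Z) (hZ' : K Z') (h : Z' ⟶ Z) (g : Z ⟶ X),
      P hZ' (h ≫ g) ↔ P hZ g) {Z : T} (hZ : K Z) (g : Z ⟶ X) (hg : P hZ g) ⦃Z' : T⦄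
    (hZ' : K Z') (g' : Z' ⟶ X) : P hZ' g' := by
  obtain ⟨X₁, X₂, i₁, i₂, hc, h₁, h₂⟩ := exists_binaryCofan_of_invariant hK hK' P hP
  obtain ⟨⟨h⟩⟩ | ⟨⟨h⟩⟩ := hX.2 i₁ i₂ hc
  · obtain ⟨k, -⟩ := (h₁ hZ g).1 hg
    exact ((isEmpty_isInitial_of_hom k (hK' _ hZ).1).false h).elim
  · by_contra hg'
    obtain ⟨k, -⟩ := (h₂ hZ' g').1 hg'
    exact (isEmpty_isInitial_of_hom k (hK' _ hZ').1).false h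

end Separating

/-! ### Objects trivialized by a covering sieve -/

/-- A binary coproduct as a coproduct with index set in any universe. -/
lemma exists_cofan_of_binaryCofan {C : Type v₁} [Category.{w₁} C] {X₁ X₂ X : C} {i₁ : X₁ ⟶ X}
    {i₂ : X₂ ⟶ X} (hc : IsColimit (BinaryCofan.mk i₁ i₂)) :
    ∃ (Y : ULift.{u} Bool → C) (i : ∀ k, Y k ⟶ X) (_ : IsColimit (Cofan.mk X i)),
      Y ⟨true⟩ = X₁ ∧ Y ⟨false⟩ = X₂ := by
  refine ⟨fun b => b.down.rec X₂ X₁, fun b => match b with | ⟨true⟩ => i₁ | ⟨false⟩ => i₂,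
    Cofan.IsColimit.mk _ (fun s => BinaryCofan.IsColimit.desc hc (s.inj ⟨true⟩) (s.inj ⟨false⟩))
      ?_ ?_, rfl, rfl⟩
  · rintro s ⟨_ | _⟩
    · exact BinaryCofan.IsColimit.inr_desc hc _ _
    · exact BinaryCofan.IsColimit.inl_desc hc _ _
  · intro s m hm
    refine BinaryCofan.IsColimit.hom_ext hc ?_ ?_
    · exact (hm ⟨true⟩).trans (BinaryCofan.IsColimit.inl_desc hc _ _).symm
    · exact (hm ⟨false⟩).trans (BinaryCofan.IsColimit.inr_desc hc _ _).symm

section Trivialized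

variable {T : Type (u + 1)} [LargeCategory.{u} T] [IsGrothendieckTopos.{u} T]

/-- If `U` trivializes `F`, then `F × U` is the disjoint union of the graphs of a family of
morphisms `U ⟶ F`, so that each morphism to `F` from a connected object over `U` is the composite
of exactly one member of this family. -/
lemma TrivializedBy.exists_sections {F U : T} (h : TrivializedBy F U) :
    ∃ (I : Type u) (s : I → (U ⟶ F)), ∀ ⦃V : T⦄, IsConnectedObject V → ∀ (k : V ⟶ U) (x : V ⟶ F),
      ∃! i, k ≫ s i = x := by
  obtain ⟨I, Y, i, hY, ⟨hc⟩⟩ := h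
  have hiso (k : I) : IsIso (Y k).hom := by
    let e := (hY k).some.uniqueUpToIso (Over.mkIdTerminal (X := U))
    have he : e.hom.left = (Y k).hom := (Category.comp_id _).symm.trans (Over.w e.hom)
    rw [← he]
    exact inferInstanceAs (IsIso ((Over.forget U).map e.hom))
  let hd : IsColimit (Cofan.mk (F ⨯ U) fun k => (i k).left) :=
    (isColimitCofanMkObjOfIsColimit (Over.forget U) _ _ hc)
  have hi (k : I) : (i k).left ≫ (prod.snd : F ⨯ U ⟶ U) = (Y k).hom := Over.w (i k)
  refine ⟨I, fun k => inv (Y k).hom ≫ (i k).left ≫ prod.fst, fun V hV k x => ?_⟩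
  obtain ⟨j, g, hg⟩ := hV.exists_factor hd (prod.lift x k)
  replace hg : g ≫ (i j).left = prod.lift x k := hg
  have key {V : T} (k : V ⟶ U) (j : I) : k ≫ inv (Y j).hom ≫ (i j).left =
      prod.lift (k ≫ inv (Y j).hom ≫ (i j).left ≫ prod.fst) k := by
    apply Limits.prod.hom_ext
    · simp [prod.lift_fst]
    · simp [hi, prod.lift_snd]
  have hg' : g ≫ (Y j).hom = k := by rw [← hi, ← Category.assoc, hg, prod.lift_snd]
  refine ⟨j, ?_, fun l hl => ?_⟩
  · dsimp only
    rw [← hg']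
    simp only [Category.assoc, IsIso.hom_inv_id_assoc]
    rw [← Category.assoc, hg, prod.lift_fst]
  · dsimp only at hl
    refine (eq_of_comp_inj_eq hd hV.1 g (k ≫ inv (Y l).hom) ?_).symm
    change g ≫ (i j).left = (k ≫ inv (Y l).hom) ≫ (i l).left
    rw [hg, Category.assoc, key, hl]

/-- The converse of `TrivializedBy.exists_sections`: a family of morphisms `U ⟶ F` whose graphs
partition the connected points of `F × U` trivializes `F`. -/
lemma trivializedBy_of_sections {K : ObjectProperty T} (hK : K.IsSeparating)
    (hK' : K ≤ IsConnectedObject) {F U : T} {I : Type u} (s : I → (U ⟶ F))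
    (h : ∀ ⦃V : T⦄, K V → ∀ (k : V ⟶ U) (x : V ⟶ F), ∃! i, k ≫ s i = x) :
    TrivializedBy F U := by
  let i (k : I) : Over.mk (𝟙 U) ⟶ Over.mk (prod.snd : F ⨯ U ⟶ U) :=
    Over.homMk (prod.lift (s k) (𝟙 U)) (prod.lift_snd _ _)
  refine ⟨I, fun _ => Over.mk (𝟙 U), i, fun _ => ⟨Over.mkIdTerminal⟩, ⟨?_⟩⟩
  let hc := coproductIsCoproduct (fun _ : I => U)
  let t : (∐ fun _ : I => U) ⟶ F ⨯ U := Sigma.desc (fun k => (i k).left)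
  have : IsIso t := by
    refine isIso_of_bijective hK _ fun V hV => ⟨fun a b hab => ?_, fun y => ?_⟩
    · obtain ⟨j, a, rfl⟩ := (hK' _ hV).exists_factor hc a
      obtain ⟨l, b, rfl⟩ := (hK' _ hV).exists_factor hc b
      have hab' : a ≫ prod.lift (s j) (𝟙 U) = b ≫ prod.lift (s l) (𝟙 U) := by
        have hj (k : I) {V : T} (a : V ⟶ U) : (a ≫ (Cofan.inj (Cofan.mk (∐ fun _ : I => U)
            (Sigma.ι fun _ : I => U)) k)) ≫ (Sigma.desc (fun k => (i k).left) :
            (∐ fun _ : I => U) ⟶ F ⨯ U) = a ≫ prod.lift (s k) (𝟙 U) :=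
          (Category.assoc _ _ _).trans (congr_arg (a ≫ ·) (Sigma.ι_desc _ _))
        exact (hj j a).symm.trans (hab.trans (hj l b))
      have h₂ : a = b := by simpa [prod.lift_snd] using congr_arg (· ≫ prod.snd) hab'
      subst h₂
      have h₁ : a ≫ s j = a ≫ s l := by
        simpa [prod.lift_fst] using congr_arg (· ≫ prod.fst) hab'
      rw [(h hV a (a ≫ s j)).unique rfl h₁.symm]
    · obtain ⟨j, hj, -⟩ := h hV (y ≫ prod.snd) (y ≫ prod.fst)
      refine ⟨(y ≫ prod.snd) ≫ Sigma.ι (fun _ : I => U) j, ?_⟩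
      refine (Category.assoc _ _ _).trans
        ((congr_arg ((y ≫ prod.snd) ≫ ·) (Sigma.ι_desc _ _)).trans ?_)
      change (y ≫ prod.snd) ≫ prod.lift (s j) (𝟙 U) = y
      apply Limits.prod.hom_ext
      · simpa [prod.lift_fst] using hj
      · simp [prod.lift_snd]
  refine isColimitOfReflects (Over.forget U) ?_
  refine (isColimitMapCoconeCofanMkEquiv (Over.forget U) _ _).symm ?_
  exact IsColimit.ofIsoColimit hc (Cofan.ext
    (@asIso T _ (∐ fun _ : I => U) (F ⨯ U) t this)
    fun j => Sigma.ι_desc (f := fun _ : I => U) _ _)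

/-- Above an object that trivializes `F`, restriction between connected objects does not change the
morphisms to `F`. -/
lemma TrivializedBy.bijective {F U V W : T} (h : TrivializedBy F U) (k : V ⟶ U)
    (hV : IsConnectedObject V) (g : W ⟶ V) (hW : IsConnectedObject W) :
    Function.Bijective (fun x : V ⟶ F => g ≫ x) := by
  obtain ⟨I, s, hs⟩ := h.exists_sections
  refine ⟨fun x y hxy => ?_, fun x => ?_⟩
  · obtain ⟨i, rfl, -⟩ := hs hV k x
    obtain ⟨j, rfl, -⟩ := hs hV k y
    have : (g ≫ k) ≫ s i = (g ≫ k) ≫ s j := by simpa using hxy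
    rw [(hs hW (g ≫ k) ((g ≫ k) ≫ s i)).unique rfl this.symm]
  · obtain ⟨i, hi, -⟩ := hs hW (g ≫ k) x
    exact ⟨k ≫ s i, by simpa using hi⟩

/-- If each morphism to `F` from a connected object over `U` extends uniquely to `U`, then `F × U` is
the coproduct of copies of `U` indexed by `Hom(U, F)`. -/
lemma trivializedBy_of_bijective {K : ObjectProperty T} (hK : K.IsSeparating)
    (hK' : K ≤ IsConnectedObject) {F U : T}
    (h : ∀ ⦃V : T⦄, K V → ∀ k : V ⟶ U, Function.Bijective (fun x : U ⟶ F => k ≫ x)) :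
    TrivializedBy F U :=
  trivializedBy_of_sections hK hK' (fun x : U ⟶ F => x) fun _ hV k x =>
    ⟨_, ((h hV k).2 x).choose_spec, fun _ hy =>
      (h hV k).1 (hy.trans ((h hV k).2 x).choose_spec.symm)⟩

/-- The connected objects belonging to the covering sieve `R`. -/
def ConnectedIn (R : CoveringSieve T) : ObjectProperty T :=
  fun U => IsConnectedObject U ∧ (R : Sieve (⊤_ T)) (terminal.from U)

lemma connectedIn_le (R : CoveringSieve T) : ConnectedIn R ≤ IsConnectedObject :=
  fun _ hU => hU.1

lemma connectedIn_mono {R' R : CoveringSieve T} (h : R' ≤ R) : ConnectedIn R' ≤ ConnectedIn R :=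
  fun _ hU => ⟨hU.1, h _ hU.2⟩

/-- Since `R` is covering, every morphism is determined by its composites with the morphisms from
the connected objects of `R`. -/
lemma connectedIn_isSeparating [hT : IsLocallyConnected T] (R : CoveringSieve T) :
    (ConnectedIn R).IsSeparating := by
  intro X Y f g h
  refine hT.isSeparating _ _ fun Z hZ k => ?_
  have hR : (R : Sieve (⊤_ T)).pullback (terminal.from Z) ∈ Sheaf.canonicalTopology T Z :=
    (Sheaf.canonicalTopology T).pullback_stable _ R.2
  refine ((Sheaf.isSheaf_yoneda_obj Y).isSeparated _ hR).ext fun W l hl => ?_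
  refine hT.isSeparating _ _ fun V hV m => ?_
  have hV' : ConnectedIn R V := by
    refine ⟨hV, ?_⟩
    have := (R : Sieve (⊤_ T)).downward_closed hl m
    rwa [← Category.assoc, terminal.comp_from] at this
  simpa using h V hV' (m ≫ l ≫ k)

/-- The morphisms between the connected objects of `R`. -/
def connectedMaps (R : CoveringSieve T) : MorphismProperty T :=
  fun V U _ => ConnectedIn R V ∧ ConnectedIn R U

/-- The objects of `LC(T, R)` are those for which each morphism from a connected object of `R`
extends uniquely along all morphisms between connected objects of `R`. -/
lemma isTrivializedBySieve_eq_isLocal [IsLocallyConnected T] (R : CoveringSieve T) :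
    IsTrivializedBySieve R = (connectedMaps R).isLocal := by
  ext F
  refine ⟨fun hF V U g ⟨hV, hU⟩ => ?_, fun hF U h hU hU' => ?_⟩
  · exact (hF _ hU.2 hU.1).bijective (𝟙 U) hU.1 g hV.1
  · have hU₁ : ConnectedIn R U := ⟨hU', by rwa [Subsingleton.elim (terminal.from U) h]⟩
    exact trivializedBy_of_bijective (connectedIn_isSeparating R) (connectedIn_le R)
      fun V hV k => hF k ⟨hV, hU₁⟩

lemma IsTrivializedBySieve.bijective [IsLocallyConnected T] {R : CoveringSieve T} {F : T}
    (hF : IsTrivializedBySieve R F) {U V : T} (hU : ConnectedIn R U) (hV : ConnectedIn R V)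
    (g : V ⟶ U) : Function.Bijective (fun x : U ⟶ F => g ≫ x) :=
  (hF _ hU.2 hU.1).bijective (𝟙 U) hU.1 g hV.1

lemma isTrivializedBySieve_of_bijective [IsLocallyConnected T] {R : CoveringSieve T} {F : T}
    (hF : ∀ ⦃U V : T⦄, ConnectedIn R U → ConnectedIn R V → ∀ g : V ⟶ U,
      Function.Bijective (fun x : U ⟶ F => g ≫ x)) : IsTrivializedBySieve R F := by
  rw [isTrivializedBySieve_eq_isLocal]
  exact fun V U g ⟨hV, hU⟩ => hF hU hV g

instance [IsLocallyConnected T] (R : CoveringSieve T) (J : Type w₁) [Category.{v₁} J] :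
    (IsTrivializedBySieve R).IsClosedUnderLimitsOfShape J := by
  rw [isTrivializedBySieve_eq_isLocal]
  infer_instance

instance [IsLocallyConnected T] (R : CoveringSieve T) :
    (IsTrivializedBySieve R).IsClosedUnderIsomorphisms := by
  rw [isTrivializedBySieve_eq_isLocal]
  infer_instance

/-- A summand of an object of `LC(T, R)` is in `LC(T, R)`. -/
lemma IsTrivializedBySieve.of_cofan [IsLocallyConnected T] {R : CoveringSieve T} {I : Type u}
    {Y : I → T} {c : Cofan Y} (hc : IsColimit c) (h : IsTrivializedBySieve R c.pt) (i : I) :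
    IsTrivializedBySieve R (Y i) := by
  have := mono_inj_of_isColimit hc i
  refine isTrivializedBySieve_of_bijective fun U V hU hV g => ⟨fun x y hxy => ?_, fun y => ?_⟩
  · rw [← cancel_mono (c.inj i)]
    refine (h.bijective hU hV g).1 ?_
    dsimp only at hxy ⊢
    rw [← Category.assoc, hxy, Category.assoc]
  · obtain ⟨x, hx⟩ := (h.bijective hU hV g).2 (y ≫ c.inj i)
    obtain ⟨j, x', rfl⟩ := hU.1.exists_factor hc x
    dsimp only at hx
    rw [← Category.assoc] at hx
    obtain rfl := eq_of_comp_inj_eq hc hV.1.1 _ _ hx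
    exact ⟨x', (cancel_mono (c.inj j)).1 hx⟩

lemma IsTrivializedBySieve.of_binaryCofan [IsLocallyConnected T] {R : CoveringSieve T}
    {X₁ X₂ X : T} {i₁ : X₁ ⟶ X} {i₂ : X₂ ⟶ X} (hc : IsColimit (BinaryCofan.mk i₁ i₂))
    (h : IsTrivializedBySieve R X) : IsTrivializedBySieve R X₁ := by
  obtain ⟨Y, i, hd, rfl, -⟩ := exists_cofan_of_binaryCofan hc
  exact IsTrivializedBySieve.of_cofan (c := Cofan.mk X i) hd h _

end Trivialized

/-! ### Small separating families of connected objects -/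

section Family

variable {T : Type (u + 1)} [LargeCategory.{u} T] [IsGrothendieckTopos.{u} T]
  {ι : Type u} {s : ι → T}

lemma exists_amalgamation_family (hs : (ObjectProperty.ofObj s).IsSeparating) {X Y : T}
    (φ : ∀ i, (s i ⟶ X) → (s i ⟶ Y))
    (hφ : ∀ i j (h : s j ⟶ s i) (g : s i ⟶ X), φ j (h ≫ g) = h ≫ φ i g) :
    ∃ t : X ⟶ Y, ∀ i (g : s i ⟶ X), g ≫ t = φ i g := by
  have hZ' ⦃Z : T⦄ (hZ : ObjectProperty.ofObj s Z) : ∃ i, s i = Z := by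
    obtain ⟨i⟩ := hZ
    exact ⟨i, rfl⟩
  choose k hk using hZ'
  obtain ⟨t, ht⟩ := exists_amalgamation hs
    (fun Z hZ (g : Z ⟶ X) => eqToHom (hk hZ).symm ≫ φ (k hZ) (eqToHom (hk hZ) ≫ g))
    (fun Z Z' hZ hZ' h g => by
      have := hφ (k hZ) (k hZ') (eqToHom (hk hZ') ≫ h ≫ eqToHom (hk hZ).symm)
        (eqToHom (hk hZ) ≫ g)
      simp only [Category.assoc, eqToHom_trans_assoc, eqToHom_refl, Category.id_comp] at this
      rw [this]
      simp)
  refine ⟨t, fun i g => ?_⟩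
  rw [ht ⟨i⟩, ← hφ]
  simp

lemma exists_cofan_of_invariant_family (hs : (ObjectProperty.ofObj s).IsSeparating)
    (hs' : ∀ i, IsConnectedObject (s i)) {X : T} {I : Type u} (κ : ∀ i, (s i ⟶ X) → I)
    (hκ : ∀ i j (h : s j ⟶ s i) (g : s i ⟶ X), κ j (h ≫ g) = κ i g) :
    ∃ (Y : I → T) (i : ∀ k, Y k ⟶ X), Nonempty (IsColimit (Cofan.mk X i)) ∧
      ∀ k j (g : s j ⟶ X), κ j g = k ↔ ∃ g' : s j ⟶ Y k, g' ≫ i k = g := by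
  have hZ' ⦃Z : T⦄ (hZ : ObjectProperty.ofObj s Z) : ∃ i, s i = Z := by
    obtain ⟨i⟩ := hZ
    exact ⟨i, rfl⟩
  choose k hk using hZ'
  obtain ⟨Y, i, hc, h⟩ := exists_cofan_of_invariant (K := ObjectProperty.ofObj s) hs
    (by rintro _ ⟨i⟩; exact hs' i)
    (fun Z hZ (g : Z ⟶ X) => κ (k hZ) (eqToHom (hk hZ) ≫ g))
    (fun Z Z' hZ hZ' h g => by
      rw [← hκ (k hZ) (k hZ') (eqToHom (hk hZ') ≫ h ≫ eqToHom (hk hZ).symm)]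
      simp)
  refine ⟨Y, i, hc, fun l j g => ?_⟩
  rw [← h l ⟨j⟩, hκ]

lemma exists_binaryCofan_of_invariant_family (hs : (ObjectProperty.ofObj s).IsSeparating)
    (hs' : ∀ i, IsConnectedObject (s i)) {X : T} (P : ∀ i, (s i ⟶ X) → Prop)
    (hP : ∀ i j (h : s j ⟶ s i) (g : s i ⟶ X), P j (h ≫ g) ↔ P i g) :
    ∃ (X₁ X₂ : T) (i₁ : X₁ ⟶ X) (i₂ : X₂ ⟶ X), Nonempty (IsColimit (BinaryCofan.mk i₁ i₂)) ∧
      (∀ i (g : s i ⟶ X), P i g ↔ ∃ g', g' ≫ i₁ = g) ∧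
      (∀ i (g : s i ⟶ X), ¬ P i g ↔ ∃ g', g' ≫ i₂ = g) := by
  have hZ' ⦃Z : T⦄ (hZ : ObjectProperty.ofObj s Z) : ∃ i, s i = Z := by
    obtain ⟨i⟩ := hZ
    exact ⟨i, rfl⟩
  choose k hk using hZ'
  obtain ⟨X₁, X₂, i₁, i₂, hc, h₁, h₂⟩ := exists_binaryCofan_of_invariant
    (K := ObjectProperty.ofObj s) hs (by rintro _ ⟨i⟩; exact hs' i)
    (fun Z hZ (g : Z ⟶ X) => P (k hZ) (eqToHom (hk hZ) ≫ g))
    (fun Z Z' hZ hZ' h g => by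
      rw [← hP (k hZ) (k hZ') (eqToHom (hk hZ') ≫ h ≫ eqToHom (hk hZ).symm)]
      simp)
  refine ⟨X₁, X₂, i₁, i₂, hc, fun j g => ?_, fun j g => ?_⟩
  · rw [← h₁ ⟨j⟩, hP]
  · rw [← h₂ ⟨j⟩, hP]

lemma exists_hom_family (hs : (ObjectProperty.ofObj s).IsSeparating) {X : T}
    (hX : IsEmpty (IsInitial X)) : ∃ i, Nonempty (s i ⟶ X) := by
  obtain ⟨_, ⟨i⟩, h⟩ := exists_hom_of_isSeparating hs hX
  exact ⟨i, h⟩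

/-- A morphism from a connected object to a sum of two objects factors through one of them. -/
lemma IsConnectedObject.exists_factor_binary {V : T} (hV : IsConnectedObject V) {X₁ X₂ X : T}
    {i₁ : X₁ ⟶ X} {i₂ : X₂ ⟶ X} (hc : IsColimit (BinaryCofan.mk i₁ i₂)) (f : V ⟶ X) :
    (∃ g, g ≫ i₁ = f) ∨ ∃ g, g ≫ i₂ = f := by
  let Y : ULift.{u} Bool → T := fun b => b.down.rec X₂ X₁
  let i : ∀ b, Y b ⟶ X := fun b => match b with | ⟨true⟩ => i₁ | ⟨false⟩ => i₂
  have hd : IsColimit (Cofan.mk X i) := Cofan.IsColimit.mk _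
    (fun s => BinaryCofan.IsColimit.desc hc (s.inj ⟨true⟩) (s.inj ⟨false⟩))
    (by
      rintro s ⟨_ | _⟩
      · exact BinaryCofan.IsColimit.inr_desc hc _ _
      · exact BinaryCofan.IsColimit.inl_desc hc _ _)
    (fun s m hm => BinaryCofan.IsColimit.hom_ext hc
      ((hm ⟨true⟩).trans (BinaryCofan.IsColimit.inl_desc hc _ _).symm)
      ((hm ⟨false⟩).trans (BinaryCofan.IsColimit.inr_desc hc _ _).symm))
  obtain ⟨⟨_ | _⟩, g, hg⟩ := hV.exists_factor hd f
  · exact Or.inr ⟨g, hg⟩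
  · exact Or.inl ⟨g, hg⟩

/-- In a locally connected topos, every object is a coproduct of connected objects. -/
lemma exists_cofan_connected [hT : IsLocallyConnected T] (X : T) :
    ∃ (I : Type u) (Y : I → T) (i : ∀ k, Y k ⟶ X), Nonempty (IsColimit (Cofan.mk X i)) ∧
      ∀ k, IsConnectedObject (Y k) := by
  obtain ⟨ι, s, hs', hs⟩ := exists_small_isSeparating hT.isSeparating
  let r : (Σ i, (s i ⟶ X)) → (Σ i, (s i ⟶ X)) → Prop :=
    fun a b => ∃ h : s a.1 ⟶ s b.1, h ≫ b.2 = a.2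
  obtain ⟨Y, i, ⟨hc⟩, h⟩ := exists_cofan_of_invariant_family hs hs' (X := X) (I := Quot r)
    (fun i g => Quot.mk r ⟨i, g⟩) (fun i j h g => Quot.sound ⟨h, rfl⟩)
  refine ⟨Quot r, Y, i, ⟨hc⟩, fun k => ⟨?_, fun X₁ X₂ i₁ i₂ ⟨hd⟩ => ?_⟩⟩
  · obtain ⟨⟨j, g⟩, rfl⟩ := Quot.exists_rep k
    obtain ⟨g', -⟩ := (h _ _ _).1 rfl
    exact isEmpty_isInitial_of_hom g' (hs' j).1
  · by_contra! hX
    obtain ⟨j₁, ⟨g₁⟩⟩ := exists_hom_family hs hX.1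
    obtain ⟨j₂, ⟨g₂⟩⟩ := exists_hom_family hs hX.2
    have hm : Mono (i k) := mono_inj_of_isColimit hc k
    have hm₁ : Mono i₁ := FinitaryExtensive.mono_inl_of_isColimit hd
    -- The morphisms factoring through `X₁` form a union of classes.
    let P : Quot r → Prop := Quot.lift (fun a => ∃ g : s a.1 ⟶ X₁, g ≫ i₁ ≫ i k = a.2) (by
      rintro ⟨a, x⟩ ⟨b, y⟩ ⟨l, hl⟩
      dsimp only at l hl ⊢
      subst hl
      refine propext ⟨?_, ?_⟩
      · rintro ⟨g, hg⟩
        obtain ⟨y', rfl⟩ := (h k b y).1 ((Quot.sound ⟨l, rfl⟩ : Quot.mk r ⟨a, l ≫ y⟩ =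
          Quot.mk r ⟨b, y⟩).symm.trans ((h k a _).2 ⟨g ≫ i₁, by rw [Category.assoc, hg]⟩))
        obtain ⟨y'', rfl⟩ | ⟨y'', rfl⟩ := (hs' b).exists_factor_binary hd y'
        · exact ⟨y'', by simp⟩
        · simp only [← Category.assoc, cancel_mono] at hg
          obtain ⟨hi⟩ := nonempty_isInitial_of_binaryCofan hd g (l ≫ y'') hg
          exact ((hs' a).1.false hi).elim
      · rintro ⟨g, rfl⟩
        exact ⟨l ≫ g, by simp⟩)
    have h₁ := (h k j₁ (g₁ ≫ i₁ ≫ i k)).2 ⟨g₁ ≫ i₁, by simp⟩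
    have h₂ := (h k j₂ (g₂ ≫ i₂ ≫ i k)).2 ⟨g₂ ≫ i₂, by simp⟩
    have h₃ : P k := by
      rw [← h₁]
      exact ⟨g₁, rfl⟩
    rw [← h₂] at h₃
    obtain ⟨g, hg⟩ := h₃
    simp only [← Category.assoc, cancel_mono] at hg
    obtain ⟨hi⟩ := nonempty_isInitial_of_binaryCofan hd g g₂ hg
    exact (hs' j₂).1.false hi

end Family

/-! ### Universal covers -/

section UniversalCover

variable {T : Type (u + 1)} [LargeCategory.{u} T] [IsGrothendieckTopos.{u} T]
  [IsLocallyConnected T] {R : CoveringSieve T}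

/-- A universal cover for `R`: a connected object `A` of `LC(T, R)` such that every morphism from a
connected object of `R` to `A` is initial among the morphisms to objects of `LC(T, R)`. -/
def IsUniversalCover (R : CoveringSieve T) : ObjectProperty T := fun A =>
  IsTrivializedBySieve R A ∧ IsConnectedObject A ∧ ∀ ⦃V : T⦄, ConnectedIn R V → ∀ (h : V ⟶ A)
    ⦃F : T⦄, IsTrivializedBySieve R F → Function.Bijective (fun x : A ⟶ F => h ≫ x)

section Zigzag

variable {ι : Type u} {s : ι → T} {U : T}

/-- The zigzags of morphisms between the objects of the family `s` that start at `U`. -/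
inductive Zigzag (s : ι → T) (U : T) : ι → Type u
  | base {i : ι} (m : s i ⟶ U) : Zigzag s U i
  | fwd {i j : ι} (z : Zigzag s U i) (h : s j ⟶ s i) : Zigzag s U j
  | bwd {i j : ι} (z : Zigzag s U i) (h : s i ⟶ s j) : Zigzag s U j

/-- The transport of a morphism `U ⟶ F` along a zigzag, for `F` in `LC(T, R)`. -/
noncomputable def Zigzag.eval (hs : ∀ i, ConnectedIn R (s i)) {F : T}
    (hF : IsTrivializedBySieve R F) (a : U ⟶ F) : ∀ {i : ι}, Zigzag s U i → (s i ⟶ F)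
  | _, .base m => m ≫ a
  | _, .fwd z h => h ≫ z.eval hs hF a
  | _, .bwd (i := i) (j := j) z h => ((hF.bijective (hs j) (hs i) h).2 (z.eval hs hF a)).choose

lemma Zigzag.comp_eval_bwd (hs : ∀ i, ConnectedIn R (s i)) {F : T}
    (hF : IsTrivializedBySieve R F) (a : U ⟶ F) {i j : ι} (z : Zigzag s U i) (h : s i ⟶ s j) :
    h ≫ (Zigzag.bwd z h).eval hs hF a = z.eval hs hF a :=
  ((hF.bijective (hs j) (hs i) h).2 (z.eval hs hF a)).choose_spec

lemma Zigzag.eval_comp (hs : ∀ i, ConnectedIn R (s i)) {F F' : T}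
    (hF : IsTrivializedBySieve R F) (hF' : IsTrivializedBySieve R F') (a : U ⟶ F) (f : F ⟶ F')
    {i : ι} (z : Zigzag s U i) : z.eval hs hF' (a ≫ f) = z.eval hs hF a ≫ f := by
  induction z with
  | base m => simp [Zigzag.eval]
  | fwd z h ih => simp [Zigzag.eval, ih]
  | @bwd i j z h ih =>
    refine (hF'.bijective (hs j) (hs i) h).1 ?_
    dsimp only
    rw [comp_eval_bwd, ih, ← Category.assoc, comp_eval_bwd]

/-- Every morphism `U ⟶ F` factors through a summand of `F` all of whose points are reached by
zigzags. -/
lemma exists_reached (hs : ∀ i, ConnectedIn R (s i))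
    (hs' : (ObjectProperty.ofObj s).IsSeparating) (hU : ConnectedIn R U) {F : T}
    (hF : IsTrivializedBySieve R F) (a : U ⟶ F) :
    ∃ (F' : T) (hF' : IsTrivializedBySieve R F') (a' : U ⟶ F') (k : F' ⟶ F), a' ≫ k = a ∧
      ∀ i (y : s i ⟶ F'), ∃ z : Zigzag s U i, z.eval hs hF' a' = y := by
  obtain ⟨F', F'', k, k', ⟨hc⟩, h₁, h₂⟩ := exists_binaryCofan_of_invariant_family hs'
    (fun i => (hs i).1) (X := F) (fun i y => ∃ z : Zigzag s U i, z.eval hs hF a = y) (by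
      intro i j h g
      constructor
      · rintro ⟨z, hz⟩
        refine ⟨z.bwd h, (hF.bijective (hs i) (hs j) h).1 ?_⟩
        dsimp only
        rw [Zigzag.comp_eval_bwd, hz]
      · rintro ⟨z, rfl⟩
        exact ⟨z.fwd h, rfl⟩)
  have hF' := hF.of_binaryCofan hc
  have hk : Mono k := FinitaryExtensive.mono_inl_of_isColimit hc
  obtain ⟨a', rfl⟩ : ∃ a', a' ≫ k = a := by
    obtain h | ⟨a', rfl⟩ := hU.1.exists_factor_binary hc a
    · exact h
    · obtain ⟨i, ⟨m⟩⟩ := exists_hom_family hs' hU.1.1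
      exact ((h₂ i (m ≫ a' ≫ k')).2 ⟨m ≫ a', by simp⟩ ⟨.base m, rfl⟩).elim
  refine ⟨F', hF', a', k, rfl, fun i y => ?_⟩
  obtain ⟨z, hz⟩ := (h₁ i (y ≫ k)).2 ⟨y, rfl⟩
  refine ⟨z, (cancel_mono k).1 ?_⟩
  rw [← hz, Zigzag.eval_comp]

/-- A small family through which all morphisms from `U` to objects of `LC(T, R)` factor. -/
lemma exists_weakly_initial (hU : ConnectedIn R U) :
    ∃ (S : Type u) (B : S → T) (b : ∀ σ, U ⟶ B σ), (∀ σ, IsTrivializedBySieve R (B σ)) ∧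
      ∀ ⦃F : T⦄ (_ : IsTrivializedBySieve R F) (a : U ⟶ F), ∃ σ, ∃ g : B σ ⟶ F, b σ ≫ g = a := by
  obtain ⟨ι, s, hs, hs'⟩ := exists_small_isSeparating (connectedIn_isSeparating R)
  let rel {F : T} (hF : IsTrivializedBySieve R F) (a : U ⟶ F) :
      Set (Σ i, Zigzag s U i × Zigzag s U i) :=
    {z | z.2.1.eval hs hF a = z.2.2.eval hs hF a}
  -- A morphism `U ⟶ F` that reaches all of `F` is determined, up to isomorphism, by which
  -- zigzags have equal transports; one is chosen for each such relation.
  let S := {ρ : Set (Σ i, Zigzag s U i × Zigzag s U i) //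
    ∃ (F : T) (hF : IsTrivializedBySieve R F) (a : U ⟶ F),
      (∀ i (y : s i ⟶ F), ∃ z : Zigzag s U i, z.eval hs hF a = y) ∧ rel hF a = ρ}
  choose B hB b hb hρ using fun σ : S => σ.2
  refine ⟨S, B, b, hB, fun F hF a => ?_⟩
  obtain ⟨F', hF', a', k, rfl, hz⟩ := exists_reached hs hs' hU hF a
  let σ : S := ⟨rel hF' a', F', hF', a', hz, rfl⟩
  have hσ (i : ι) (z z' : Zigzag s U i) (h : z.eval hs (hB σ) (b σ) = z'.eval hs (hB σ) (b σ)) :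
      z.eval hs hF' a' = z'.eval hs hF' a' := by
    have : (⟨i, z, z'⟩ : Σ i, Zigzag s U i × Zigzag s U i) ∈ rel (hB σ) (b σ) := h
    rwa [hρ σ] at this
  choose ζ hζ using hb σ
  obtain ⟨t, ht⟩ := exists_amalgamation_family hs' (X := B σ) (Y := F')
    (fun i y => (ζ i y).eval hs hF' a') (fun i j h g => by
      refine hσ j _ ((ζ i g).fwd h) ?_
      rw [hζ, Zigzag.eval, hζ])
  refine ⟨σ, t ≫ k, ?_⟩
  rw [← Category.assoc]
  congr 1
  refine hs' _ _ fun Z hZ m => ?_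
  obtain ⟨i⟩ := hZ
  rw [← Category.assoc, ht]
  refine hσ i _ (.base m) ?_
  rw [hζ]
  rfl

end Zigzag

/-- Every connected object of `R` has a universal cover: the part, reached by zigzags, of the product
of a weakly initial family. -/
lemma exists_isUniversalCover {U : T} (hU : ConnectedIn R U) :
    ∃ A, IsUniversalCover R A ∧ Nonempty (U ⟶ A) := by
  obtain ⟨ι, s, hs, hs'⟩ := exists_small_isSeparating (connectedIn_isSeparating R)
  obtain ⟨S, B, b, hB, hb⟩ := exists_weakly_initial hU
  have hB₀ : IsTrivializedBySieve R (∏ᶜ B) :=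
    (IsTrivializedBySieve R).prop_limit _ fun ⟨σ⟩ => hB σ
  obtain ⟨A, hA, η, k, hk, hz⟩ := exists_reached hs hs' hU hB₀ (Pi.lift b)
  have hη ⦃F : T⦄ (hF : IsTrivializedBySieve R F) :
      Function.Bijective (fun x : A ⟶ F => η ≫ x) := by
    refine ⟨fun f g hfg => hs' _ _ fun Z hZ y => ?_, fun a => ?_⟩
    · obtain ⟨i⟩ := hZ
      obtain ⟨z, rfl⟩ := hz i y
      dsimp only at hfg
      rw [← Zigzag.eval_comp hs hA hF, ← Zigzag.eval_comp hs hA hF, hfg]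
    · obtain ⟨σ, g, rfl⟩ := hb hF a
      refine ⟨k ≫ Pi.π B σ ≫ g, ?_⟩
      dsimp only
      rw [← Category.assoc, hk, ← Category.assoc, Pi.lift_π]
  have hA₀ : IsConnectedObject A := by
    refine ⟨isEmpty_isInitial_of_hom η hU.1.1, ?_⟩
    -- The summand through which `η` factors is a retract of `A`, and so all of `A`.
    have key {X₁ X₂ : T} {i₁ : X₁ ⟶ A} {i₂ : X₂ ⟶ A} (hc : IsColimit (BinaryCofan.mk i₁ i₂))
        (g : U ⟶ X₁) (hg : g ≫ i₁ = η) : Nonempty (IsInitial X₂) := by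
      obtain ⟨r, hr⟩ := (hη (hA.of_binaryCofan hc)).2 g
      have : r ≫ i₁ = 𝟙 A := (hη hA).1 (by
        dsimp only at hr ⊢
        rw [← Category.assoc, hr, hg, Category.comp_id])
      exact nonempty_isInitial_of_binaryCofan hc (i₂ ≫ r) (𝟙 _) (by simp [this])
    intro X₁ X₂ i₁ i₂ ⟨hc⟩
    obtain ⟨g, hg⟩ | ⟨g, hg⟩ := hU.1.exists_factor_binary hc η
    · exact Or.inr (key hc g hg)
    · exact Or.inl (key (BinaryCofan.isColimitFlip hc) g hg)
  refine ⟨A, ⟨hA, hA₀, ?_⟩, ⟨η⟩⟩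
  refine hA₀.forall_of_invariant (connectedIn_isSeparating R) (connectedIn_le R)
    (fun V hV h => ∀ ⦃F : T⦄, IsTrivializedBySieve R F → Function.Bijective fun x : A ⟶ F => h ≫ x)
    (fun V V' hV hV' h g => ?_) hU η hη
  refine forall_congr' fun F => forall_congr' fun hF => ?_
  rw [← Function.Bijective.of_comp_iff' (hF.bijective hV hV' h)]
  simp only [Function.comp_def, Category.assoc]

namespace IsUniversalCover

variable {A B : T}

lemma isIso (hA : IsUniversalCover R A) (hB : IsUniversalCover R B) (f : A ⟶ B) : IsIso f := by
  obtain ⟨V, hV, ⟨h⟩⟩ := exists_hom_of_isSeparating (connectedIn_isSeparating R) hA.2.1.1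
  obtain ⟨g, hg⟩ := (hB.2.2 hV (h ≫ f) hA.1).2 h
  dsimp only at hg
  refine ⟨g, (hA.2.2 hV h hA.1).1 ?_, (hB.2.2 hV (h ≫ f) hB.1).1 ?_⟩
  · simpa using hg
  · dsimp only
    rw [← Category.assoc, hg, Category.comp_id]

end IsUniversalCover

/-- Connected objects of `R` lift through all morphisms from a nonempty object of `LC(T, R)` to a
connected object of `LC(T, R)`. -/
lemma exists_lift_of_connected {Z Z' : T} (hZ : IsTrivializedBySieve R Z)
    (hZ₀ : IsConnectedObject Z) (hZ' : IsTrivializedBySieve R Z') (hZ₀' : IsEmpty (IsInitial Z'))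
    (a : Z' ⟶ Z) ⦃V : T⦄ (hV : ConnectedIn R V) (y : V ⟶ Z) : ∃ l, l ≫ a = y := by
  obtain ⟨W, hW, ⟨w⟩⟩ := exists_hom_of_isSeparating (connectedIn_isSeparating R) hZ₀'
  refine hZ₀.forall_of_invariant (connectedIn_isSeparating R) (connectedIn_le R)
    (fun V hV y => ∃ l, l ≫ a = y) (fun V V' hV hV' h g => ⟨?_, ?_⟩) hW (w ≫ a) ⟨w, rfl⟩ hV y
  · rintro ⟨l, hl⟩
    obtain ⟨l', rfl⟩ := (hZ'.bijective hV hV' h).2 l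
    refine ⟨l', (hZ.bijective hV hV' h).1 ?_⟩
    simpa using hl
  · rintro ⟨l, rfl⟩
    exact ⟨h ≫ l, by simp⟩

lemma epi_of_connected {Z Z' : T} (hZ : IsTrivializedBySieve R Z)
    (hZ₀ : IsConnectedObject Z) (hZ' : IsTrivializedBySieve R Z') (hZ₀' : IsEmpty (IsInitial Z'))
    (a : Z' ⟶ Z) : Epi a := by
  refine ⟨fun f g h => connectedIn_isSeparating R _ _ fun V hV y => ?_⟩
  obtain ⟨l, rfl⟩ := exists_lift_of_connected hZ hZ₀ hZ' hZ₀' a hV y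
  rw [Category.assoc, h, Category.assoc]

lemma isTrivializedBySieve_terminal : IsTrivializedBySieve R (⊤_ T) :=
  isTrivializedBySieve_of_bijective fun _ _ _ _ _ =>
    ⟨fun _ _ _ => Subsingleton.elim _ _, fun _ => ⟨terminal.from _, Subsingleton.elim _ _⟩⟩

end UniversalCover

/-! ### The nerve of `LC(T, R)` -/

section Pullback

variable {T : Type (u + 1)} [LargeCategory.{u} T] [IsGrothendieckTopos.{u} T]
  {J : Type u} [SmallCategory J] {F : J ⥤ T} (c : Cocone F) {X : T} (t : X ⟶ c.pt)

/-- The pullback of a diagram along a morphism to the vertex of a cocone. -/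
noncomputable def pullbackDiagram : J ⥤ T where
  obj j := pullback t (c.ι.app j)
  map {j j'} m := pullback.lift (pullback.fst _ _) (pullback.snd _ _ ≫ F.map m) (by
    rw [Category.assoc, c.w, pullback.condition])
  map_id j := pullback.hom_ext (by simp) (by simp)
  map_comp m m' := pullback.hom_ext (by simp [pullback.lift_fst])
    (by simp [pullback.lift_snd, pullback.lift_snd_assoc])

/-- The pullback of a cocone along a morphism to its vertex. -/
noncomputable def pullbackCocone : Cocone (pullbackDiagram c t) where
  pt := X
  ι :=
    { app j := pullback.fst _ _
      naturality j j' m := by simp [pullbackDiagram, pullback.lift_fst] }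

variable {c}

lemma nonempty_isColimit_pullbackCocone (hc : IsColimit c) :
    Nonempty (IsColimit (pullbackCocone c t)) := by
  let α : pullbackDiagram c t ⟶ F :=
    { app j := pullback.snd _ _
      naturality j j' m := by simp [pullbackDiagram, pullback.lift_snd] }
  refine isUniversalColimit hc (pullbackCocone c t) α t ?_ (fun j j' m => ?_) fun j =>
    IsPullback.of_hasPullback t (c.ι.app j)
  · ext j
    exact (pullback.condition (f := t) (g := c.ι.app j)).symm
  · refine IsPullback.of_right ?_ (α.naturality m) (IsPullback.of_hasPullback t (c.ι.app j'))
    rw [show (pullbackDiagram c t).map m ≫ pullback.fst t (c.ι.app j') = pullback.fst _ _ from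
      pullback.lift_fst _ _ _, c.w m]
    exact IsPullback.of_hasPullback t (c.ι.app j)

end Pullback

section Cover

variable {T : Type (u + 1)} [LargeCategory.{u} T] [IsGrothendieckTopos.{u} T]
  [IsLocallyConnected T] (R : CoveringSieve T)

/-- A small set of universal covers suffices: those of a small separating family. -/
lemma exists_universalCover_family : ∃ (ι : Type u) (A : ι → T), (∀ i, IsUniversalCover R (A i)) ∧
    ∀ ⦃V : T⦄, ConnectedIn R V → ∃ i, Nonempty (V ⟶ A i) := by
  obtain ⟨ι, s, hs, hs'⟩ := exists_small_isSeparating (connectedIn_isSeparating R)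
  choose A hA hA' using fun i => exists_isUniversalCover (hs i)
  refine ⟨ι, A, hA, fun V hV => ?_⟩
  obtain ⟨i, ⟨m⟩⟩ := exists_hom_family hs' hV.1.1
  obtain ⟨B, hB, ⟨b⟩⟩ := exists_isUniversalCover hV
  obtain ⟨g, -⟩ := ((hA i).2.2 (hs i) (hA' i).some hB.1).2 (m ≫ b)
  have := (hA i).isIso hB g
  exact ⟨i, ⟨b ≫ inv g⟩⟩

/-- An index set for a small family of representatives of the universal covers for `R`. -/
def CoverIndex : Type u := (exists_universalCover_family R).choose

/-- A small family of representatives of the universal covers for `R`. -/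
noncomputable def cover (i : CoverIndex R) : LC R :=
  ⟨(exists_universalCover_family R).choose_spec.choose i,
    ((exists_universalCover_family R).choose_spec.choose_spec.1 i).1⟩

lemma isUniversalCover_cover (i : CoverIndex R) : IsUniversalCover R (cover R i).obj :=
  (exists_universalCover_family R).choose_spec.choose_spec.1 i

variable {R} in
lemma ConnectedIn.exists_hom_cover {V : T} (hV : ConnectedIn R V) :
    ∃ i, Nonempty (V ⟶ (cover R i).obj) :=
  (exists_universalCover_family R).choose_spec.choose_spec.2 hV

/-- The small category of universal covers for `R`. -/
abbrev CoverCat := InducedCategory (LC R) (cover R)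

/-- The inclusion of the universal covers in `T`. -/
noncomputable abbrev coverFunctor : CoverCat R ⥤ T := inducedFunctor (cover R) ⋙ ObjectProperty.ι _

/-- The morphism of `CoverCat R` given by a morphism of `T`. -/
noncomputable def CoverCat.homMk {i j : CoverCat R} (f : (cover R i).obj ⟶ (cover R j).obj) :
    i ⟶ j :=
  InducedCategory.homMk (ObjectProperty.homMk f)

instance {i j : CoverCat R} (f : i ⟶ j) : IsIso f := by
  have := (isUniversalCover_cover R i).isIso (isUniversalCover_cover R j) ((coverFunctor R).map f)
  exact isIso_of_reflects_iso f (coverFunctor R)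

/-- The presheaf `A ↦ Hom(A, X)` on the universal covers for `R`. -/
noncomputable abbrev nerve : T ⥤ (CoverCat R)ᵒᵖ ⥤ Type u :=
  yoneda ⋙ (Functor.whiskeringLeft _ _ _).obj (coverFunctor R).op

variable {R}

/-- Each object of `LC(T, R)` is canonically a colimit of universal covers. -/
lemma bijective_nerve_map {F : T} (hF : IsTrivializedBySieve R F) (X : T) :
    Function.Bijective (fun t : F ⟶ X => (nerve R).map t) := by
  have hsep := connectedIn_isSeparating R
  refine ⟨fun f g hfg => hsep _ _ fun V hV y => ?_, fun φ => ?_⟩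
  · obtain ⟨i, ⟨η⟩⟩ := hV.exists_hom_cover
    obtain ⟨y, rfl⟩ := ((isUniversalCover_cover R i).2.2 hV η hF).2 y
    have := ConcreteCategory.congr_hom (NatTrans.congr_app hfg (op i)) y
    exact (Category.assoc _ _ _).trans ((congr_arg (η ≫ ·) this).trans (Category.assoc _ _ _).symm)
  · choose i η using fun (V : T) (hV : ConnectedIn R V) => hV.exists_hom_cover
    have hy ⦃V : T⦄ (hV : ConnectedIn R V) (y : V ⟶ F) := ((isUniversalCover_cover R (i V hV)).2.2
      hV (η V hV).some hF).2 y
    choose l hl using hy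
    have key ⦃V : T⦄ (hV : ConnectedIn R V) (y : V ⟶ F) (j : CoverIndex R)
        (k : V ⟶ (cover R j).obj) (l' : (cover R j).obj ⟶ F) (h : k ≫ l' = y) :
        k ≫ φ.app (op j) l' = (η V hV).some ≫ φ.app (op (i V hV)) (l hV y) := by
      obtain ⟨m, hm⟩ := ((isUniversalCover_cover R (i V hV)).2.2 hV (η V hV).some
        (cover R j).property).2 k
      have hm' : m ≫ l' = l hV y := ((isUniversalCover_cover R (i V hV)).2.2 hV (η V hV).some
        hF).1 (by
          dsimp only at hm ⊢
          rw [← Category.assoc, hm, h]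
          exact (hl hV y).symm)
      have := φ.naturality_apply (CoverCat.homMk R m).op l'
      rw [← hm', ← hm]
      exact (Category.assoc _ _ _).trans (congr_arg ((η V hV).some ≫ ·) this.symm)
    obtain ⟨t, ht⟩ := exists_amalgamation hsep
      (fun V hV y => (η V hV).some ≫ φ.app (op (i V hV)) (l hV y)) (fun V V' hV hV' h g => by
        refine (key hV' (h ≫ g) (i V hV) (h ≫ (η V hV).some) (l hV g) ?_).symm.trans
          (Category.assoc _ _ _)
        rw [Category.assoc]
        exact congr_arg (h ≫ ·) (hl hV g))
    refine ⟨t, ?_⟩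
    ext ⟨j⟩ y
    change y ≫ t = φ.app (op j) y
    obtain ⟨V, hV, ⟨k⟩⟩ := exists_hom_of_isSeparating hsep (isUniversalCover_cover R j).2.1.1
    refine hsep _ _ fun V hV k => ?_
    rw [← Category.assoc, ht hV, key hV _ j k y rfl]

section Realization

variable (P : (CoverCat R)ᵒᵖ ⥤ Type u)

/-- The diagram of universal covers indexed by the elements of the presheaf `P`. -/
noncomputable abbrev realizationDiagram : P.Elementsᵒᵖ ⥤ T :=
  (CategoryOfElements.π P).leftOp ⋙ coverFunctor R

/-- The object of `T` with nerve `P`. -/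
noncomputable def realization : T := colimit (realizationDiagram P)

/-- The morphism from a universal cover to `realization P` given by an element of `P`. -/
noncomputable def realizationHom {i : CoverCat R} (x : P.obj (op i)) :
    (cover R i).obj ⟶ realization P :=
  colimit.ι (realizationDiagram P) (op ⟨op i, x⟩)

variable {P}

lemma realizationHom_map {i j : CoverCat R} (m : (cover R i).obj ⟶ (cover R j).obj)
    (x : P.obj (op j)) :
    realizationHom P (P.map (CoverCat.homMk R m).op x) = m ≫ realizationHom P x :=
  (colimit.w (realizationDiagram P)
    (Quiver.Hom.op (CategoryOfElements.homMk (⟨op j, x⟩ : P.Elements) ⟨op i, _⟩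
      (CoverCat.homMk R m).op rfl))).symm

/-- A morphism `V ⟶ realization P` is locally given by elements of `P`; transporting these to a
universal cover under `V` yields a locally constant function. -/
lemma exists_classifying {i : CoverCat R} {V : T}
    (v : V ⟶ (cover R i).obj) (x : V ⟶ realization P) :
    ∃ t : V ⟶ ∐ fun _ : P.obj (op i) => ⊤_ T, ∀ ⦃Z : T⦄, ConnectedIn R Z → ∀ (k : Z ⟶ V)
      ⦃j : CoverCat R⦄ (y : Z ⟶ (cover R j).obj) (d : P.obj (op j))
      (b : (cover R i).obj ⟶ (cover R j).obj), k ≫ x = y ≫ realizationHom P d → k ≫ v ≫ b = y →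
      k ≫ t = terminal.from Z ≫ Sigma.ι (fun _ : P.obj (op i) => ⊤_ T)
        (P.map (CoverCat.homMk R b).op d) := by
  have hsep := connectedIn_isSeparating R
  have hb ⦃Z : T⦄ (hZ : ConnectedIn R Z) {j : CoverCat R} (k : Z ⟶ V)
      (y : Z ⟶ (cover R j).obj) := ((isUniversalCover_cover R i).2.2 hZ (k ≫ v) (cover R j).2).2 y
  choose b hb using hb
  have hb' ⦃Z : T⦄ (hZ : ConnectedIn R Z) {j : CoverCat R} (k : Z ⟶ V) (y : Z ⟶ (cover R j).obj)
      (b' : (cover R i).obj ⟶ (cover R j).obj) (h : k ≫ v ≫ b' = y) : b hZ k y = b' :=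
    ((isUniversalCover_cover R i).2.2 hZ (k ≫ v) (cover R j).2).1 (by
      dsimp only
      rw [Category.assoc k v b', h]
      exact hb hZ k y)
  have aux {Z W W' A B B' : T} (g : Z ⟶ W) (μ : W ⟶ W') (f : W ⟶ V) (f' : W' ⟶ V) (s : W ⟶ B)
      (s' : W' ⟶ B') (m : B ⟶ B') (v : V ⟶ A) (β : A ⟶ B) (h₁ : μ ≫ f' = f)
      (h₂ : μ ≫ s' = s ≫ m) (h₃ : (g ≫ f) ≫ v ≫ β = g ≫ s) :
      ((g ≫ μ) ≫ f') ≫ v ≫ β ≫ m = (g ≫ μ) ≫ s' := by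
    simp only [Category.assoc, h₁, h₂] at h₃ ⊢
    rw [reassoc_of% h₃]
  let q (e : P.Elementsᵒᵖ) : (cover R e.unop.1.unop).obj ⟶ realization P :=
    realizationHom P e.unop.2
  have hφ (e : P.Elementsᵒᵖ) : ∃ φ : pullback x (q e) ⟶ ∐ fun _ : P.obj (op i) => ⊤_ T,
      ∀ ⦃Z : T⦄ (hZ : ConnectedIn R Z) (g : Z ⟶ pullback x (q e)),
        g ≫ φ = terminal.from Z ≫ Sigma.ι (fun _ : P.obj (op i) => ⊤_ T)
          (P.map (CoverCat.homMk R (b hZ (g ≫ pullback.fst x (q e))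
            (g ≫ pullback.snd x (q e)))).op e.unop.2) := by
    refine exists_amalgamation hsep _ fun Z Z' hZ hZ' h g => ?_
    rw [hb' hZ' _ _ (b hZ (g ≫ pullback.fst x (q e)) (g ≫ pullback.snd x (q e))),
      ← Category.assoc, terminal.comp_from]
    have := hb hZ (g ≫ pullback.fst x (q e)) (g ≫ pullback.snd x (q e))
    simp only [Category.assoc] at this ⊢
    rw [this]
  choose φ hφ using hφ
  let c' : Cocone (pullbackDiagram (colimit.cocone (realizationDiagram P)) x) :=
    { pt := ∐ fun _ : P.obj (op i) => ⊤_ T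
      ι :=
        { app := φ
          naturality e e' m := by
            refine hsep _ _ fun Z hZ g => ?_
            let μ : pullback x (q e) ⟶ pullback x (q e') :=
              (pullbackDiagram (colimit.cocone (realizationDiagram P)) x).map m
            let m' : (cover R e.unop.1.unop).obj ⟶ (cover R e'.unop.1.unop).obj :=
              m.unop.val.unop.hom.hom
            have hμ₁ : μ ≫ pullback.fst x (q e') = pullback.fst x (q e) := pullback.lift_fst _ _ _
            have hμ₂ : μ ≫ pullback.snd x (q e') = pullback.snd x (q e) ≫ m' :=
              pullback.lift_snd _ _ _
            refine (Category.assoc _ _ _).symm.trans ((hφ e' hZ (g ≫ μ)).trans ?_)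
            refine Eq.trans ?_ (congr_arg (g ≫ ·) (Category.comp_id (φ e)).symm)
            refine Eq.trans ?_ (hφ e hZ g).symm
            rw [hb' hZ _ _ (b hZ (g ≫ pullback.fst x (q e)) (g ≫ pullback.snd x (q e)) ≫ m')]
            · congr 2
              refine Eq.trans ?_ (congr_arg _ (CategoryOfElements.map_snd m.unop))
              exact ConcreteCategory.congr_hom (P.map_comp m.unop.val (CoverCat.homMk R
                (b hZ (g ≫ pullback.fst x (q e)) (g ≫ pullback.snd x (q e)))).op) e'.unop.2
            · exact aux g μ _ _ _ _ m' v _ hμ₁ hμ₂ ((Category.assoc _ _ _).symm.trans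
                (hb hZ (g ≫ pullback.fst x (q e)) (g ≫ pullback.snd x (q e)))) } }
  obtain ⟨hc'⟩ := nonempty_isColimit_pullbackCocone x
    (colimit.isColimit (realizationDiagram P))
  refine ⟨hc'.desc c', fun Z hZ k j y d a h₁ h₂ => ?_⟩
  let e : P.Elementsᵒᵖ := op ⟨op j, d⟩
  have h₃ : pullback.fst x (q e) ≫ hc'.desc c' = φ e := hc'.fac c' e
  let l : Z ⟶ pullback x (q e) := pullback.lift k y h₁
  have hl₁ : l ≫ pullback.fst x (q e) = k := pullback.lift_fst _ _ _
  have hl₂ : l ≫ pullback.snd x (q e) = y := pullback.lift_snd _ _ _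
  have h₄ := hφ e hZ l
  rw [hb' hZ _ _ a (by rw [hl₁, hl₂, h₂])] at h₄
  exact (congr_arg (· ≫ hc'.desc c') hl₁).symm.trans ((Category.assoc _ _ _).trans
    ((congr_arg (l ≫ ·) h₃).trans h₄))

lemma existsUnique_comp_realizationHom {i : CoverCat R} {V : T} (hV : ConnectedIn R V)
    (v : V ⟶ (cover R i).obj) (x : V ⟶ realization P) : 
    ∃! d : P.obj (op i), v ≫ realizationHom P d = x := by
  have hsep := connectedIn_isSeparating R
  let hc := coproductIsCoproduct (fun _ : P.obj (op i) => ⊤_ T)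
  obtain ⟨t, ht⟩ := exists_classifying v x
  have hid : CoverCat.homMk R (𝟙 (cover R i).obj) = 𝟙 i := rfl
  have uniq (d) (hd : v ≫ realizationHom P d = x) : t = terminal.from V ≫
      Sigma.ι (fun _ : P.obj (op i) => ⊤_ T) d := by
    have := ht hV (𝟙 V) v d (𝟙 _) (by rw [hd, Category.id_comp])
      ((Category.id_comp _).trans (Category.comp_id _))
    rwa [Category.id_comp, hid, op_id, P.map_id] at this
  obtain ⟨d, g, hg⟩ := hV.1.exists_factor hc t
  replace hg : g ≫ Sigma.ι (fun _ : P.obj (op i) => ⊤_ T) d = t := hg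
  refine ⟨d, ?_, fun d' hd' => ?_⟩
  · obtain ⟨hc'⟩ := nonempty_isColimit_pullbackCocone x
      (colimit.isColimit (realizationDiagram P))
    refine hc'.hom_ext fun ⟨⟨⟨j⟩, d'⟩⟩ => hsep _ _ fun Z hZ k => ?_
    let p : pullback x (realizationHom P d') ⟶ V := pullback.fst _ _
    let q : pullback x (realizationHom P d') ⟶ (cover R j).obj := pullback.snd _ _
    have hpq : p ≫ x = q ≫ realizationHom P d' := pullback.condition
    change Z ⟶ pullback x (realizationHom P d') at k
    change k ≫ p ≫ v ≫ realizationHom P d = k ≫ p ≫ x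
    obtain ⟨b, hb⟩ := ((isUniversalCover_cover R i).2.2 hZ (k ≫ p ≫ v) (cover R j).2).2 (k ≫ q)
    simp only [Category.assoc] at hb
    have h₁ := ht hZ (k ≫ p) (k ≫ q) d' b (by simp only [Category.assoc, hpq])
      (by simpa only [Category.assoc] using hb)
    have h₂ : P.map (CoverCat.homMk R b).op d' = d :=
      (eq_of_comp_inj_eq hc hZ.1.1 (k ≫ p ≫ g) (terminal.from Z) (by
        refine Eq.trans ?_ h₁
        rw [← hg]
        simp only [Category.assoc]
        rfl)).symm
    rw [← h₂, realizationHom_map, hpq, reassoc_of% hb]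
  · exact eq_of_comp_inj_eq hc hV.1.1 (terminal.from V) (terminal.from V)
      ((uniq d' hd').symm.trans (hg.symm.trans
        (by rw [Subsingleton.elim g (terminal.from V)]; rfl)))

lemma isTrivializedBySieve_realization : IsTrivializedBySieve R (realization P) := by
  refine isTrivializedBySieve_of_bijective fun U V hU hV g => ?_
  obtain ⟨i, ⟨η⟩⟩ := hU.exists_hom_cover
  have h₁ : Function.Bijective fun d : P.obj (op i) => η ≫ realizationHom P d :=
    Function.bijective_iff_existsUnique _ |>.2 (existsUnique_comp_realizationHom hU η)
  have h₂ : Function.Bijective fun d : P.obj (op i) => (g ≫ η) ≫ realizationHom P d :=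
    Function.bijective_iff_existsUnique _ |>.2 (existsUnique_comp_realizationHom hV (g ≫ η))
  rw [← Function.Bijective.of_comp_iff _ h₁]
  simpa only [Function.comp_def, Category.assoc] using h₂

/-- Every presheaf on the universal covers is the nerve of an object of `LC(T, R)`. -/
lemma nonempty_nerve_iso (P : (CoverCat R)ᵒᵖ ⥤ Type u) :
    ∃ F, IsTrivializedBySieve R F ∧ Nonempty ((nerve R).obj F ≅ P) := by
  refine ⟨realization P, isTrivializedBySieve_realization, ⟨Iso.symm ?_⟩⟩
  have hbij (i : CoverCat R) :
      Function.Bijective fun d : P.obj (op i) => realizationHom P d := by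
    obtain ⟨V, hV, ⟨k⟩⟩ := exists_hom_of_isSeparating (connectedIn_isSeparating R)
      (isUniversalCover_cover R i).2.1.1
    rw [← Function.Bijective.of_comp_iff'
      ((isUniversalCover_cover R i).2.2 hV k isTrivializedBySieve_realization)]
    exact Function.bijective_iff_existsUnique _ |>.2 (existsUnique_comp_realizationHom hV k)
  exact NatIso.ofComponents (fun i => (Equiv.ofBijective _ (hbij i.unop)).toIso)
    (fun {i j} m => by
      ext d
      exact realizationHom_map m.unop.hom.hom d)

end Realization

/-- The nerve is an equivalence from `LC(T, R)` to the presheaves on the universal covers. -/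
lemma isEquivalence_nerve :
    (ObjectProperty.ι (IsTrivializedBySieve R) ⋙ nerve R).IsEquivalence where
  faithful := ⟨fun {F G} f g h => ObjectProperty.hom_ext _ ((bijective_nerve_map F.2 G.1).1 h)⟩
  full := ⟨fun {F G} φ => by
    obtain ⟨t, ht⟩ := (bijective_nerve_map F.2 G.1).2 φ
    exact ⟨ObjectProperty.homMk t, ht⟩⟩
  essSurj := ⟨fun P => by
    obtain ⟨F, hF, e⟩ := nonempty_nerve_iso P
    exact ⟨⟨F, hF⟩, e⟩⟩

/-- A full inclusion of `LC(T, R)` in a full subcategory of `T` has a right adjoint. -/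
lemma isLeftAdjoint_ιOfLE {K : ObjectProperty T} (h : IsTrivializedBySieve R ≤ K) :
    (ObjectProperty.ιOfLE h).IsLeftAdjoint := by
  refine Functor.isLeftAdjoint_of_rightAdjointObjIsDefined_eq_top ?_
  refine top_le_iff.1 fun X _ => ?_
  obtain ⟨F, hF, ⟨e⟩⟩ := nonempty_nerve_iso ((nerve R).obj X.obj)
  obtain ⟨ε, hε⟩ := (bijective_nerve_map hF X.obj).2 e.hom
  have hbij (G : LC R) : Function.Bijective fun f : G ⟶ ⟨F, hF⟩ =>
      (ObjectProperty.homMk (f.hom ≫ ε) : (ObjectProperty.ιOfLE h).obj G ⟶ X) := by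
    refine ⟨fun f g hfg => ?_, fun t => ?_⟩
    · refine ObjectProperty.hom_ext _ ((bijective_nerve_map G.2 F).1 ?_)
      have : f.hom ≫ ε = g.hom ≫ ε := congr_arg InducedCategory.Hom.hom hfg
      have := congr_arg (nerve R).map this
      dsimp only at hε ⊢
      rwa [Functor.map_comp, Functor.map_comp, hε, cancel_mono] at this
    · obtain ⟨f, hf⟩ := (bijective_nerve_map G.2 F).2 ((nerve R).map t.hom ≫ e.inv)
      refine ⟨ObjectProperty.homMk f, ObjectProperty.hom_ext _
        ((bijective_nerve_map G.2 X.obj).1 ?_)⟩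
      dsimp only at hε hf ⊢
      refine ((nerve R).map_comp _ _).trans ?_
      rw [hε]
      exact (congr_arg (· ≫ e.hom) hf).trans (by simp)
  exact ⟨⟨F, hF⟩, ⟨⟨Equiv.ofBijective _ (hbij _), fun f g => ObjectProperty.hom_ext _
    (Category.assoc _ _ _)⟩⟩⟩

end Cover

/-! ### Connected locally constant objects -/

section ConnectedLC

variable {T : Type (u + 1)} [LargeCategory.{u} T] [IsGrothendieckTopos.{u} T]
  [IsLocallyConnected T] {R : CoveringSieve T}

/-- A morphism to a connected object of `LC(T, R)` is the coequalizer of its kernel pair, and it is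
enough to test the latter on universal covers. -/
lemma exists_factor_of_kernel {Y Y' X : T} (hY : IsTrivializedBySieve R Y)
    (hY₀ : IsConnectedObject Y) (hY' : IsTrivializedBySieve R Y') (hY₀' : IsEmpty (IsInitial Y'))
    (a : Y' ⟶ Y) (g : Y' ⟶ X)
    (h : ∀ j (x y : (cover R j).obj ⟶ Y'), x ≫ a = y ≫ a → x ≫ g = y ≫ g) :
    ∃ g' : Y ⟶ X, a ≫ g' = g := by
  have hsep := connectedIn_isSeparating R
  choose l hl using exists_lift_of_connected hY hY₀ hY' hY₀' a
  have key ⦃V : T⦄ (hV : ConnectedIn R V) (x y : V ⟶ Y') (hxy : x ≫ a = y ≫ a) :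
      x ≫ g = y ≫ g := by
    obtain ⟨j, ⟨η⟩⟩ := hV.exists_hom_cover
    obtain ⟨x, rfl⟩ := ((isUniversalCover_cover R j).2.2 hV η hY').2 x
    obtain ⟨y, rfl⟩ := ((isUniversalCover_cover R j).2.2 hV η hY').2 y
    dsimp only at hxy ⊢
    rw [Category.assoc, Category.assoc] at hxy ⊢
    rw [h j x y (((isUniversalCover_cover R j).2.2 hV η hY).1 hxy)]
  obtain ⟨g', hg'⟩ := exists_amalgamation hsep (fun V hV y => l hV y ≫ g)
    (fun V V' hV hV' k y => by
      rw [← Category.assoc]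
      refine key hV' _ _ ?_
      rw [hl, Category.assoc, hl])
  refine ⟨g', hsep _ _ fun V hV y => ?_⟩
  rw [← Category.assoc, hg' hV]
  exact key hV _ _ (hl hV _)

/-- The connected objects belonging to `LC(T, R)` for some `R`. -/
def ConnectedLC : ObjectProperty T :=
  fun X => IsConnectedObject X ∧ ∃ R, IsTrivializedBySieve R X

omit [IsLocallyConnected T] in
lemma IsUniversalCover.connectedLC {A : T} (hA : IsUniversalCover R A) : ConnectedLC A :=
  ⟨hA.2.1, R, hA.1⟩

omit [IsLocallyConnected T] in
lemma ConnectedLC.exists_common {X Y : T} (hX : ConnectedLC X) (hY : ConnectedLC Y) :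
    ∃ R, IsTrivializedBySieve R X ∧ IsTrivializedBySieve R Y := by
  obtain ⟨_, R, hR⟩ := hX
  obtain ⟨_, R', hR'⟩ := hY
  exact ⟨R ⊓ R', isTrivializedBySieve_le inf_le_left _ hR,
    isTrivializedBySieve_le inf_le_right _ hR'⟩

lemma ConnectedLC.epi {X Y : T} (hX : ConnectedLC X) (hY : ConnectedLC Y) (f : X ⟶ Y) : Epi f := by
  obtain ⟨R, hX', hY'⟩ := hX.exists_common hY
  exact epi_of_connected hY' hY.1 hX' hX.1.1 f

/-- The right Ore condition, by way of a universal cover for a sieve that trivializes the three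
objects. -/
lemma rightOreCondition_connectedLC :
    GrothendieckTopology.RightOreCondition (ConnectedLC (T := T)).FullSubcategory := by
  intro X Y Z f g
  obtain ⟨R₁, hX, hY⟩ := X.2.exists_common Y.2
  obtain ⟨R₂, hZ⟩ := Z.2.2
  have hX := isTrivializedBySieve_le (inf_le_left : R₁ ⊓ R₂ ≤ R₁) _ hX
  have hY := isTrivializedBySieve_le (inf_le_left : R₁ ⊓ R₂ ≤ R₁) _ hY
  have hZ := isTrivializedBySieve_le (inf_le_right : R₁ ⊓ R₂ ≤ R₂) _ hZ
  obtain ⟨V, hV, ⟨y⟩⟩ := exists_hom_of_isSeparating (connectedIn_isSeparating (R₁ ⊓ R₂)) Y.2.1.1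
  obtain ⟨z, hz⟩ := exists_lift_of_connected hX X.2.1 hZ Z.2.1.1 g.hom hV (y ≫ f.hom)
  obtain ⟨A, hA, ⟨η⟩⟩ := exists_isUniversalCover hV
  obtain ⟨y, rfl⟩ := (hA.2.2 hV η hY).2 y
  obtain ⟨z, rfl⟩ := (hA.2.2 hV η hZ).2 z
  refine ⟨⟨A, hA.connectedLC⟩, ObjectProperty.homMk y, ObjectProperty.homMk z,
    ObjectProperty.hom_ext _ ((hA.2.2 hV η hX).1 ?_)⟩
  simpa using hz.symm

/-- Every connected locally constant object is covered by another one, through which it can be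
compared with the universal covers for `R`. -/
lemma ConnectedLC.exists_cover {W : T} (hW : ConnectedLC W) (R : CoveringSieve T) :
    ∃ (i : CoverIndex R) (W' : T) (_ : ConnectedLC W') (_ : W' ⟶ W) (a : W' ⟶ (cover R i).obj),
      ∀ ⦃F : T⦄, IsTrivializedBySieve R F →
        Function.Bijective (fun x : (cover R i).obj ⟶ F => a ≫ x) := by
  obtain ⟨R', hW'⟩ := hW.2
  have hsep := connectedIn_isSeparating (R ⊓ R')
  obtain ⟨V, hV, ⟨w⟩⟩ := exists_hom_of_isSeparating hsep hW.1.1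
  have hVR : ConnectedIn R V := connectedIn_mono inf_le_left _ hV
  obtain ⟨i, ⟨k⟩⟩ := hVR.exists_hom_cover
  obtain ⟨A, hA, ⟨η⟩⟩ := exists_isUniversalCover hV
  obtain ⟨w, rfl⟩ := (hA.2.2 hV η (isTrivializedBySieve_le inf_le_right _ hW')).2 w
  obtain ⟨a, rfl⟩ := (hA.2.2 hV η (isTrivializedBySieve_le inf_le_left _ (cover R i).2)).2 k
  refine ⟨i, A, hA.connectedLC, w, a, fun F hF => ?_⟩
  have h := (isUniversalCover_cover R i).2.2 hVR (η ≫ a) hF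
  rw [← Function.Bijective.of_comp_iff'
    (hA.2.2 hV η (isTrivializedBySieve_le inf_le_left _ hF))]
  simpa [Function.comp_def] using h

/-! ### Sums of locally constant objects -/

omit [IsLocallyConnected T] in
lemma mem_canonicalTopology_of_isSeparating {K : ObjectProperty T} (hK : K.IsSeparating) {X : T}
    (S : Sieve X) (hS : ∀ ⦃Z : T⦄, K Z → ∀ g : Z ⟶ X, S g) : S ∈ Sheaf.canonicalTopology T X := by
  refine Sheaf.mem_finestTopology_of_forall_isSheafFor ?_
  rintro _ ⟨W, rfl⟩ Y f
  exact isSheafFor_of_isSeparating hK (S.pullback f) (fun Z hZ g => hS hZ _) W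

lemma TrivializedBy.of_hom {F U V : T} (h : TrivializedBy F U) (k : V ⟶ U)
    (hV : IsConnectedObject V) : TrivializedBy F V :=
  trivializedBy_of_bijective IsLocallyConnected.isSeparating le_rfl
    fun _ hW g => h.bijective k hV g hW

/-- The sieve of the final object generated by some members of a family of objects. -/
noncomputable def familySieve {ι : Type u} (s : ι → T) (M : Set ι) : Sieve (⊤_ T) :=
  Sieve.generate (fun U _ => ∃ i ∈ M, s i = U)

/-- A locally constant object is trivialized by a covering sieve generated by members of a given
separating family of connected objects. -/
lemma IsLocallyConstant.exists_familySieve {ι : Type u} {s : ι → T}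
    (hs : (ObjectProperty.ofObj s).IsSeparating) (hs' : ∀ i, IsConnectedObject (s i)) {F : T}
    (hF : IsLocallyConstant T F) : ∃ (M : Set ι)
      (hM : familySieve s M ∈ Sheaf.canonicalTopology T (⊤_ T)),
        IsTrivializedBySieve (⟨familySieve s M, hM⟩ : CoveringSieve T) F := by
  refine ⟨{i | TrivializedBy F (s i)}, ?_, ?_⟩
  · refine (Sheaf.canonicalTopology T).transitive hF _ ?_
    rintro U - ⟨V, a, -, hV, -⟩
    refine mem_canonicalTopology_of_isSeparating hs _ ?_
    rintro _ ⟨i⟩ g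
    exact ⟨s i, 𝟙 _, terminal.from _, ⟨i, hV.of_hom (g ≫ a) (hs' i), rfl⟩, Subsingleton.elim _ _⟩
  · rintro U h ⟨_, k, _, ⟨i, hi, rfl⟩, -⟩ hU
    exact TrivializedBy.of_hom hi k hU

lemma IsLocallyConstant.exists_isTrivializedBySieve {F : T} (hF : IsLocallyConstant T F) :
    ∃ R : CoveringSieve T, IsTrivializedBySieve R F := by
  obtain ⟨ι, s, hs', hs⟩ := exists_small_isSeparating (IsLocallyConnected.isSeparating (T := T))
  obtain ⟨M, hM, h⟩ := hF.exists_familySieve hs hs'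
  exact ⟨_, h⟩

/-- A quotient of a universal cover is determined by the kernel of the projection. -/
lemma nonempty_iso_of_kernel {A Y Y' : T} (hA : IsUniversalCover R A)
    (hY : IsTrivializedBySieve R Y) (hY₀ : IsConnectedObject Y) (hY' : IsTrivializedBySieve R Y')
    (hY₀' : IsConnectedObject Y') (q : A ⟶ Y) (q' : A ⟶ Y')
    (h : ∀ j (x y : (cover R j).obj ⟶ A), x ≫ q = y ≫ q ↔ x ≫ q' = y ≫ q') :
    Nonempty (Y ≅ Y') := by
  obtain ⟨f, hf⟩ := exists_factor_of_kernel hY hY₀ hA.1 hA.2.1.1 q q' fun j x y => (h j x y).1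
  obtain ⟨g, hg⟩ := exists_factor_of_kernel hY' hY₀' hA.1 hA.2.1.1 q' q fun j x y => (h j x y).2
  have := epi_of_connected hY hY₀ hA.1 hA.2.1.1 q
  have := epi_of_connected hY' hY₀' hA.1 hA.2.1.1 q'
  exact ⟨⟨f, g, by rw [← cancel_epi q, reassoc_of% hf, hg, Category.comp_id],
    by rw [← cancel_epi q', reassoc_of% hg, hf, Category.comp_id]⟩⟩

/-- Up to isomorphism, there is only a small set of connected objects of `LC(T, R)`. -/
lemma essentiallySmall_connected_inf_isTrivializedBySieve (R : CoveringSieve T) :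
    ObjectProperty.EssentiallySmall.{u} (IsConnectedObject ⊓ IsTrivializedBySieve R) := by
  let A (i : CoverIndex R) : T := (cover R i).obj
  let I := Σ i : CoverIndex R, Set (Σ j, (A j ⟶ A i) × (A j ⟶ A i))
  let p (k : I) (Y : T) : Prop := (IsConnectedObject Y ∧ IsTrivializedBySieve R Y) ∧
    ∃ q : A k.1 ⟶ Y, ∀ j x y, x ≫ q = y ≫ q ↔ (⟨j, x, y⟩ : Σ j, (A j ⟶ A k.1) × (A j ⟶ A k.1)) ∈ k.2
  refine ⟨ObjectProperty.ofObj fun k : {k : I // ∃ Y, p k Y} => k.2.choose, inferInstance,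
    fun Y hY => ?_⟩
  obtain ⟨V, hV, ⟨y⟩⟩ := exists_hom_of_isSeparating (connectedIn_isSeparating R) hY.1.1
  obtain ⟨i, ⟨η⟩⟩ := hV.exists_hom_cover
  obtain ⟨q, -⟩ := ((isUniversalCover_cover R i).2.2 hV η hY.2).2 y
  let k : I := ⟨i, {b | b.2.1 ≫ q = b.2.2 ≫ q}⟩
  have hk : ∃ Y, p k Y := ⟨Y, ⟨hY.1, hY.2⟩, q, fun _ _ _ => Iff.rfl⟩
  obtain ⟨h, q', hq'⟩ := hk.choose_spec
  obtain ⟨e⟩ := nonempty_iso_of_kernel (isUniversalCover_cover R i) hY.2 hY.1 h.2 h.1 q q'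
    fun j x y => (hq' j x y).symm
  exact ⟨_, ⟨⟨k, hk⟩⟩, ⟨e⟩⟩

/-- Up to isomorphism, there is only a small set of connected locally constant objects. -/
instance essentiallySmall_connectedLC :
    ObjectProperty.EssentiallySmall.{u} (ConnectedLC (T := T)) := by
  obtain ⟨ι, s, hs', hs⟩ := exists_small_isSeparating (IsLocallyConnected.isSeparating (T := T))
  let Q (M : {M : Set ι // familySieve s M ∈ Sheaf.canonicalTopology T (⊤_ T)}) :
    ObjectProperty T :=
      IsConnectedObject ⊓ IsTrivializedBySieve (⟨familySieve s M.1, M.2⟩ : CoveringSieve T)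
  have h (M) : ObjectProperty.EssentiallySmall.{u} (Q M) :=
    essentiallySmall_connected_inf_isTrivializedBySieve _
  refine ObjectProperty.EssentiallySmall.of_le (Q := ⨆ M, Q M) fun Y hY => ?_
  obtain ⟨hY₀, R, hR⟩ := hY
  obtain ⟨M, hM, h⟩ :=
    (isTrivializedBySieve_le_isLocallyConstant R _ hR).exists_familySieve hs hs'
  exact le_iSup Q ⟨M, hM⟩ Y ⟨hY₀, h⟩

/-- A summand that is contained in an object of `LC(T, R)` is in `LC(T, R)`. -/
lemma isTrivializedBySieve_of_summand {I : Type u} {C : I → T} {c : Cofan C} (hc : IsColimit c)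
    {Y : T} (hY : IsTrivializedBySieve R Y) (m : Y ⟶ c.pt) [Mono m] {i : I} (g : C i ⟶ Y)
    (hg : g ≫ m = c.inj i) : IsTrivializedBySieve R (C i) := by
  obtain ⟨hd⟩ := nonempty_isColimit_pullback_cofan hc m _ _
    fun k => IsPullback.of_hasPullback m (c.inj k)
  have h : IsTrivializedBySieve R (pullback m (c.inj i)) :=
    IsTrivializedBySieve.of_cofan hd hY i
  have h₁ : pullback.fst m (c.inj i) = pullback.snd m (c.inj i) ≫ g := by
    rw [← cancel_mono m, pullback.condition, Category.assoc, hg]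
  refine (IsTrivializedBySieve R).prop_of_iso ⟨pullback.snd m (c.inj i),
    pullback.lift g (𝟙 _) (by rw [hg, Category.id_comp]), pullback.hom_ext ?_ ?_, ?_⟩ h
  · rw [Category.assoc, pullback.lift_fst, Category.id_comp, h₁]
  · rw [Category.assoc, pullback.lift_snd, Category.id_comp, Category.comp_id]
  · rw [pullback.lift_snd]

lemma exists_cofan_connectedLC_of_factor {X : T} (h : ∀ ⦃C : T⦄, IsConnectedObject C →
    ∀ f : C ⟶ X, ∃ (R : CoveringSieve T) (Y : T) (_ : IsTrivializedBySieve R Y) (m : Y ⟶ X)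
      (_ : Mono m) (g : C ⟶ Y), g ≫ m = f) :
    ∃ (I : Type u) (Y : I → T) (i : ∀ k, Y k ⟶ X), Nonempty (IsColimit (Cofan.mk X i)) ∧
      ∀ k, ConnectedLC (Y k) := by
  obtain ⟨I, C, i, ⟨hc⟩, hC⟩ := exists_cofan_connected X
  refine ⟨I, C, i, ⟨hc⟩, fun k => ⟨hC k, ?_⟩⟩
  obtain ⟨R, Y, hY, m, hm, g, hg⟩ := h (hC k) (i k)
  exact ⟨R, isTrivializedBySieve_of_summand hc hY m g hg⟩

/-- The objects of `SLC T` are the coproducts of connected locally constant objects. -/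
lemma IsSumOfLocallyConstant.exists_cofan {X : T} (hX : IsSumOfLocallyConstant T X) :
    ∃ (I : Type u) (Y : I → T) (i : ∀ k, Y k ⟶ X), Nonempty (IsColimit (Cofan.mk X i)) ∧
      ∀ k, ConnectedLC (Y k) := by
  obtain ⟨I, Y, i, hY, ⟨hc⟩⟩ := hX
  refine exists_cofan_connectedLC_of_factor fun C hC f => ?_
  obtain ⟨k, g, hg⟩ := hC.exists_factor hc f
  obtain ⟨R, hR⟩ := (hY k).exists_isTrivializedBySieve
  exact ⟨R, Y k, hR, i k, mono_inj_of_isColimit hc k, g, hg⟩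

lemma ConnectedLC.isLocallyConstant {X : T} (hX : ConnectedLC X) : IsLocallyConstant T X := by
  obtain ⟨-, R, hR⟩ := hX
  exact isTrivializedBySieve_le_isLocallyConstant R _ hR

lemma ConnectedLC.isSum {X : T} (hX : ConnectedLC X) : IsSumOfLocallyConstant T X := by
  obtain ⟨-, R, hR⟩ := hX
  exact isTrivializedBySieve_le_isSumOfLocallyConstant R _ hR

lemma isSum_of_cofan_connectedLC {X : T} (h : ∃ (I : Type u) (Y : I → T) (i : ∀ k, Y k ⟶ X),
    Nonempty (IsColimit (Cofan.mk X i)) ∧ ∀ k, ConnectedLC (Y k)) :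
    IsSumOfLocallyConstant T X := by
  obtain ⟨I, Y, i, hc, hY⟩ := h
  exact ⟨I, Y, i, fun k => (hY k).isLocallyConstant, hc⟩

lemma IsSumOfLocallyConstant.exists_factor {X C : T} (hX : IsSumOfLocallyConstant T X)
    (hC : IsConnectedObject C) (f : C ⟶ X) : ∃ (R : CoveringSieve T) (Y : T)
      (_ : IsTrivializedBySieve R Y) (m : Y ⟶ X) (_ : Mono m) (g : C ⟶ Y), g ≫ m = f := by
  obtain ⟨I, Y, i, ⟨hc⟩, hY⟩ := hX.exists_cofan
  obtain ⟨k, g, hg⟩ := hC.exists_factor hc f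
  obtain ⟨-, R, hR⟩ := hY k
  exact ⟨R, Y k, hR, i k, mono_inj_of_isColimit hc k, g, hg⟩

lemma isSum_of_binaryCofan {X₁ X₂ X : T} {i₁ : X₁ ⟶ X} {i₂ : X₂ ⟶ X}
    (hc : IsColimit (BinaryCofan.mk i₁ i₂)) (h₁ : IsSumOfLocallyConstant T X₁)
    (h₂ : IsSumOfLocallyConstant T X₂) : IsSumOfLocallyConstant T X := by
  have : Mono i₁ := FinitaryExtensive.mono_inl_of_isColimit hc
  have : Mono i₂ := FinitaryExtensive.mono_inr_of_isColimit hc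
  refine isSum_of_cofan_connectedLC (exists_cofan_connectedLC_of_factor fun C hC f => ?_)
  obtain ⟨g, rfl⟩ | ⟨g, rfl⟩ := hC.exists_factor_binary hc f
  · obtain ⟨R, Z, hZ, m, hm, g, rfl⟩ := h₁.exists_factor hC g
    exact ⟨R, Z, hZ, m ≫ i₁, mono_comp _ _, g, by simp⟩
  · obtain ⟨R, Z, hZ, m, hm, g, rfl⟩ := h₂.exists_factor hC g
    exact ⟨R, Z, hZ, m ≫ i₂, mono_comp _ _, g, by simp⟩

lemma isSum_of_isInitial {X : T} (hX : IsInitial X) : IsSumOfLocallyConstant T X :=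
  isSum_of_cofan_connectedLC (exists_cofan_connectedLC_of_factor fun _ hC f =>
    ((isEmpty_isInitial_of_hom f hC.1).false hX).elim)

end ConnectedLC

/-! ### `SLC T` is a topos -/

section SLCTopos

variable {T : Type (u + 1)} [LargeCategory.{u} T] [IsGrothendieckTopos.{u} T]

lemma IsConnectedObject.of_epi {Y Q : T} (hY : IsConnectedObject Y) (f : Y ⟶ Q) [Epi f] :
    IsConnectedObject Q := by
  refine ⟨isEmpty_isInitial_of_hom f hY.1, ?_⟩
  have key {X₁ X₂ : T} {i₁ : X₁ ⟶ Q} {i₂ : X₂ ⟶ Q} (hc : IsColimit (BinaryCofan.mk i₁ i₂))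
      (g : Y ⟶ X₁) (hg : g ≫ i₁ = f) : Nonempty (IsInitial X₂) := by
    let l : ⊤_ T ⟶ (⊤_ T) ⨿ (⊤_ T) := coprod.inl
    let r : ⊤_ T ⟶ (⊤_ T) ⨿ (⊤_ T) := coprod.inr
    obtain ⟨a, ha₁, ha₂⟩ : ∃ a : Q ⟶ _, i₁ ≫ a = terminal.from _ ≫ l ∧
        i₂ ≫ a = terminal.from _ ≫ r :=
      ⟨_, (BinaryCofan.IsColimit.desc' hc _ _).2.1, (BinaryCofan.IsColimit.desc' hc _ _).2.2⟩
    obtain ⟨b, hb₁, hb₂⟩ : ∃ b : Q ⟶ _, i₁ ≫ b = terminal.from _ ≫ l ∧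
        i₂ ≫ b = terminal.from _ ≫ l :=
      ⟨_, (BinaryCofan.IsColimit.desc' hc _ _).2.1, (BinaryCofan.IsColimit.desc' hc _ _).2.2⟩
    have hab : a = b := by
      rw [← cancel_epi f, ← hg, Category.assoc, Category.assoc, ha₁, hb₁]
    exact nonempty_isInitial_of_binaryCofan (coprodIsCoprod (⊤_ T) (⊤_ T)) (terminal.from X₂)
      (terminal.from X₂) (by rw [← hb₂, ← hab, ha₂])
  intro X₁ X₂ i₁ i₂ ⟨hc⟩
  obtain ⟨g, hg⟩ | ⟨g, hg⟩ := hY.exists_factor_binary hc f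
  · exact Or.inr (key hc g hg)
  · exact Or.inl (key (BinaryCofan.isColimitFlip hc) g hg)

variable [IsLocallyConnected T]

variable (T) in
/-- The category of connected locally constant objects. -/
abbrev ConnLC := (ConnectedLC (T := T)).FullSubcategory

variable (T) in
/-- The atomic topology on the category of connected locally constant objects. -/
abbrev atomicTopology : GrothendieckTopology (ConnLC T) :=
  GrothendieckTopology.atomic rightOreCondition_connectedLC

variable (T) in
/-- The presheaf represented by an object of `T` on the connected locally constant objects. -/
abbrev connNerve : T ⥤ (ConnLC T)ᵒᵖ ⥤ Type u :=
  yoneda ⋙ (Functor.whiskeringLeft _ _ _).obj (ObjectProperty.ι _).op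

/-- A morphism between connected locally constant objects is the coequalizer of its kernel pair, so
that representable presheaves are atomic sheaves. -/
lemma isSheaf_connNerve (X : T) :
    Presieve.IsSheaf (atomicTopology T) ((connNerve T).obj X) := by
  rintro Y S ⟨Y', a, ha⟩ x hx
  obtain ⟨R, hY', hY⟩ := Y'.2.exists_common Y.2
  obtain ⟨t, ht⟩ := exists_factor_of_kernel hY Y.2.1 hY' Y'.2.1.1 a.hom (x a ha)
    fun j u v huv => hx (Y₁ := Y') (Y₂ := Y')
      (Z := ⟨_, (isUniversalCover_cover R j).connectedLC⟩) (ObjectProperty.homMk u)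
      (ObjectProperty.homMk v) ha ha (ObjectProperty.hom_ext _ huv)
  refine ⟨t, fun Z b hb => ?_, fun t' ht' => ?_⟩
  · obtain ⟨W, w, z, hwz⟩ := rightOreCondition_connectedLC a b
    have := W.2.epi Z.2 z.hom
    refine (cancel_epi z.hom).1 ?_
    refine Eq.trans ?_ (hx w z ha hb hwz)
    have h : w.hom ≫ a.hom = z.hom ≫ b.hom := congr_arg InducedCategory.Hom.hom hwz
    change z.hom ≫ b.hom ≫ t = w.hom ≫ x a ha
    rw [← ht, ← Category.assoc, ← h, Category.assoc]
  · have := Y'.2.epi Y.2 a.hom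
    exact (cancel_epi a.hom).1 ((ht' a ha).trans ht.symm)

/-- An object of `SLC T` is the coproduct of its connected summands, and so its morphisms are given
by their values on connected locally constant objects. -/
lemma bijective_connNerve_map {X : T} (hX : IsSumOfLocallyConstant T X) (X' : T) :
    Function.Bijective (fun t : X ⟶ X' => (connNerve T).map t) := by
  obtain ⟨I, Y, i, ⟨hc⟩, hY⟩ := hX.exists_cofan
  refine ⟨fun f g hfg => Cofan.IsColimit.hom_ext hc _ _ fun k => ?_, fun φ => ?_⟩
  · exact ConcreteCategory.congr_hom (NatTrans.congr_app hfg (op ⟨Y k, hY k⟩)) (i k)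
  · refine ⟨Cofan.IsColimit.desc hc fun k => φ.app (op ⟨Y k, hY k⟩) (i k), ?_⟩
    ext ⟨Z⟩ z
    obtain ⟨k, g, rfl⟩ := Z.2.1.exists_factor hc z
    refine Eq.trans ?_ (φ.naturality_apply
      (ObjectProperty.homMk g : Z ⟶ ⟨Y k, hY k⟩).op (i k)).symm
    refine (Category.assoc _ _ _).trans (congr_arg (g ≫ ·) ?_)
    exact Cofan.IsColimit.fac hc _ k

/-- The inclusion of the universal covers for `R` in the connected locally constant objects. -/
noncomputable def CoverCat.toConnLC (R : CoveringSieve T) : CoverCat R ⥤ ConnLC T where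
  obj i := ⟨(cover R i).obj, (isUniversalCover_cover R i).connectedLC⟩
  map f := ObjectProperty.homMk f.hom.hom

section Sheaf

variable {F : (ConnLC T)ᵒᵖ ⥤ Type u} (hF : Presieve.IsSheaf (atomicTopology T) F)

include hF in
lemma injective_map_of_isSheaf {Y Y' : ConnLC T} (a : Y' ⟶ Y) :
    Function.Injective (F.map a.op) := by
  intro s t hst
  refine (hF (Sieve.generate (Presieve.singleton a))
    ⟨Y', a, Y', 𝟙 _, a, Presieve.singleton_self a, Category.id_comp _⟩).isSeparatedFor.ext ?_
  rintro Z _ ⟨W, b, _, ⟨⟩, rfl⟩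
  rw [op_comp, F.map_comp]
  exact congr_arg (F.map b.op) hst

include hF in
lemma exists_map_eq_of_isSheaf {Y Y' : ConnLC T} (a : Y' ⟶ Y) (s : F.obj (op Y'))
    (hs : ∀ (W : ConnLC T) (u v : W ⟶ Y'), u ≫ a = v ≫ a → F.map u.op s = F.map v.op s) :
    ∃ t, F.map a.op t = s := by
  have h := (Presieve.isSheafFor_iff_generate _).2 (hF (Sieve.generate (Presieve.singleton a))
    ⟨Y', a, Y', 𝟙 _, a, Presieve.singleton_self a, Category.id_comp _⟩)
  exact (Presieve.isSheafFor_singleton.1 h s fun u v huv => hs _ u v huv).exists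

include hF in
/-- Each section of `F` over a connected object is induced by one that separates morphisms, which
lives on the quotient by the kernel of the given section. -/
lemma exists_mono_section (Y : ConnLC T) (s : F.obj (op Y)) :
    ∃ (Q : ConnLC T) (f : Y ⟶ Q) (t : F.obj (op Q)), F.map f.op t = s ∧
      ∀ (W : ConnLC T) (u v : W ⟶ Q), F.map u.op t = F.map v.op t → u = v := by
  obtain ⟨hY₀, R, hY⟩ := Y.2
  -- The quotient is the object of `LC(T, R)` whose nerve is the image of `Hom(-, Y)` in `F`.
  let P : (CoverCat R)ᵒᵖ ⥤ Type u :=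
    { obj i := {x : F.obj (op ((CoverCat.toConnLC R).obj i.unop)) //
        ∃ u : (CoverCat.toConnLC R).obj i.unop ⟶ Y, F.map u.op s = x}
      map {i j} f := ↾fun x => ⟨F.map ((CoverCat.toConnLC R).map f.unop).op x.1, by
        obtain ⟨_, u, rfl⟩ := x
        refine ⟨(CoverCat.toConnLC R).map f.unop ≫ u, ?_⟩
        rw [op_comp, F.map_comp]
        rfl⟩
      map_id i := by
        ext x
        exact ConcreteCategory.congr_hom (F.map_id _) x.1
      map_comp f g := by
        ext x
        exact ConcreteCategory.congr_hom (F.map_comp ((CoverCat.toConnLC R).map f.unop).op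
          ((CoverCat.toConnLC R).map g.unop).op) x.1 }
  obtain ⟨Q, hQ, ⟨e⟩⟩ := nonempty_nerve_iso P
  let π : (nerve R).obj Y.obj ⟶ P :=
    { app i := ↾fun u => ⟨F.map (ObjectProperty.homMk u :
        (CoverCat.toConnLC R).obj i.unop ⟶ Y).op s, _, rfl⟩
      naturality i j f := by
        ext u
        exact ConcreteCategory.congr_hom (F.map_comp (ObjectProperty.homMk u :
          (CoverCat.toConnLC R).obj i.unop ⟶ Y).op ((CoverCat.toConnLC R).map f.unop).op) s }
  obtain ⟨f, hf⟩ := (bijective_nerve_map hY Q).2 (π ≫ e.inv)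
  have hf' (i : CoverCat R) (u : (cover R i).obj ⟶ Y.obj) :
      e.hom.app (op i) (u ≫ f) = π.app (op i) u := by
    have h₁ : (nerve R).map f ≫ e.hom = π := by
      dsimp only at hf
      rw [hf, Category.assoc, e.inv_hom_id, Category.comp_id]
    exact ConcreteCategory.congr_hom (NatTrans.congr_app h₁ (op i)) u
  have he (i : CoverCat R) : Function.Injective (e.hom.app (op i)) := fun x y hxy => by
    have h (x) : e.inv.app (op i) (e.hom.app (op i) x) = x :=
      ConcreteCategory.congr_hom (NatTrans.congr_app e.hom_inv_id (op i)) x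
    rw [← h x, hxy, h]
  have hfl (i : CoverCat R) (u : (cover R i).obj ⟶ Q) : ∃ v, v ≫ f = u := by
    obtain ⟨v, hv⟩ := (e.hom.app (op i) u).2
    exact ⟨v.hom, he i ((hf' i v.hom).trans (Subtype.ext hv))⟩
  have : Epi f := by
    refine ⟨fun g h hgh => connectedIn_isSeparating R _ _ fun V hV y => ?_⟩
    obtain ⟨i, ⟨η⟩⟩ := hV.exists_hom_cover
    obtain ⟨y, rfl⟩ := ((isUniversalCover_cover R i).2.2 hV η hQ).2 y
    obtain ⟨v, rfl⟩ := hfl i y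
    simp only [Category.assoc, hgh]
  let Q' : ConnLC T := ⟨Q, hY₀.of_epi f, R, hQ⟩
  let f' : Y ⟶ Q' := ObjectProperty.homMk f
  -- Morphisms from `W` to objects of `LC(T, R)` can be compared on universal covers for `R`.
  have hW (W : ConnLC T) : ∃ (i : CoverCat R) (W' : ConnLC T) (w : W' ⟶ W)
      (a : W'.obj ⟶ (cover R i).obj), ∀ ⦃Z : T⦄, IsTrivializedBySieve R Z →
        Function.Bijective fun x : (cover R i).obj ⟶ Z => a ≫ x := by
    obtain ⟨i, W', hW', w, a, h⟩ := W.2.exists_cover R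
    exact ⟨i, ⟨W', hW'⟩, ObjectProperty.homMk w, a, h⟩
  let C (i : CoverCat R) : ConnLC T := (CoverCat.toConnLC R).obj i
  let mk {A B : ConnLC T} (x : A.obj ⟶ B.obj) : A ⟶ B := ObjectProperty.homMk x
  obtain ⟨t, ht⟩ := exists_map_eq_of_isSheaf hF f' s fun W u v huv => by
    obtain ⟨i, W', w, a, ha⟩ := hW W
    obtain ⟨u', hu'⟩ := (ha hY).2 (w ≫ u).hom
    obtain ⟨v', hv'⟩ := (ha hY).2 (w ≫ v).hom
    have hu : w ≫ u = (mk a : W' ⟶ C i) ≫ (mk u' : C i ⟶ Y) :=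
      ObjectProperty.hom_ext _ hu'.symm
    have hv : w ≫ v = (mk a : W' ⟶ C i) ≫ (mk v' : C i ⟶ Y) :=
      ObjectProperty.hom_ext _ hv'.symm
    have huv' : u' ≫ f = v' ≫ f := (ha hQ).1 (by
      have h : u.hom ≫ f = v.hom ≫ f := congr_arg InducedCategory.Hom.hom huv
      dsimp only at hu' hv' ⊢
      rw [← Category.assoc, hu', ← Category.assoc, hv', ObjectProperty.FullSubcategory.comp_hom,
        ObjectProperty.FullSubcategory.comp_hom, Category.assoc, Category.assoc, h])
    have hs := congr_arg Subtype.val ((hf' i u').symm.trans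
      ((congr_arg (e.hom.app (op i)) huv').trans (hf' i v')))
    refine injective_map_of_isSheaf hF w ?_
    have hc {A B : ConnLC T} (g : A ⟶ B) (h : B ⟶ Y) :
        F.map g.op (F.map h.op s) = F.map (g ≫ h).op s := by
      rw [op_comp, F.map_comp]; rfl
    rw [hc, hc, hu, hv, ← hc, ← hc]
    exact congr_arg _ hs
  refine ⟨Q', f', t, ht, fun W u v huv => ?_⟩
  obtain ⟨i, W', w, a, ha⟩ := hW W
  obtain ⟨u', hu'⟩ := (ha hQ).2 (w ≫ u).hom
  obtain ⟨v', hv'⟩ := (ha hQ).2 (w ≫ v).hom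
  have hu : w ≫ u = (mk a : W' ⟶ C i) ≫ (mk u' : C i ⟶ Q') :=
    ObjectProperty.hom_ext _ hu'.symm
  have hv : w ≫ v = (mk a : W' ⟶ C i) ≫ (mk v' : C i ⟶ Q') :=
    ObjectProperty.hom_ext _ hv'.symm
  have hc {A B C : ConnLC T} (g : A ⟶ B) (h : B ⟶ C) (t : F.obj (op C)) :
      F.map g.op (F.map h.op t) = F.map (g ≫ h).op t := by
    rw [op_comp, F.map_comp]; rfl
  have huv' : F.map (mk u' : C i ⟶ Q').op t = F.map (mk v' : C i ⟶ Q').op t := by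
    refine injective_map_of_isSheaf hF (mk a : W' ⟶ C i) ?_
    rw [hc, hc, ← hu, ← hv, ← hc, ← hc, huv]
  have hval (x : (cover R i).obj ⟶ Q) : (e.hom.app (op i) x).1 =
      F.map (mk x : C i ⟶ Q').op t := by
    obtain ⟨y, rfl⟩ := hfl i x
    rw [hf']
    refine Eq.trans ?_ (hc (mk y : C i ⟶ Y) f' t)
    rw [ht]
    rfl
  have h₁ : u' = v' := he i (Subtype.ext ((hval u').trans (huv'.trans (hval v').symm)))
  have := W'.2.epi W.2 w.hom
  refine ObjectProperty.hom_ext _ ((cancel_epi w.hom).1 ?_)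
  exact hu'.symm.trans (h₁ ▸ hv')

include hF in
/-- Every sheaf for the atomic topology is a coproduct of representable ones. -/
lemma nonempty_connNerve_iso : ∃ X, IsSumOfLocallyConstant T X ∧
    Nonempty ((connNerve T).obj X ≅ F) := by
  have : HasColimitsOfShape (ConnLC T)ᵒᵖ (Type u) :=
    hasColimitsOfShape_of_essentiallySmall.{u} _ _
  let κ (Y : ConnLC T) (s : F.obj (op Y)) : (colimit F : Type u) := colimit.ι F (op Y) s
  have hκ {Y Y' : ConnLC T} (a : Y' ⟶ Y) (s : F.obj (op Y)) : κ Y' (F.map a.op s) = κ Y s :=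
    ConcreteCategory.congr_hom (colimit.w F a.op) s
  have hc {A B C : ConnLC T} (g : A ⟶ B) (h : B ⟶ C) (t : F.obj (op C)) :
      F.map g.op (F.map h.op t) = F.map (g ≫ h).op t := by
    rw [op_comp, F.map_comp]; rfl
  have hex (k : (colimit F : Type u)) : ∃ (Q : ConnLC T) (t : F.obj (op Q)), κ Q t = k ∧
      ∀ (W : ConnLC T) (u v : W ⟶ Q), F.map u.op t = F.map v.op t → u = v := by
    obtain ⟨⟨Y⟩, s, hs⟩ := Types.jointly_surjective_of_isColimit (colimit.isColimit F) k
    obtain ⟨Q, f, t, ht, h⟩ := exists_mono_section hF Y s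
    refine ⟨Q, t, ?_, h⟩
    rw [← hκ f, ht]
    exact hs
  choose Q t ht hmono using hex
  -- The sections of class `k` are those induced by `t k`.
  have hu (Y : ConnLC T) (s : F.obj (op Y)) : ∃ u : Y ⟶ Q (κ Y s), F.map u.op (t (κ Y s)) = s := by
    generalize hk : κ Y s = k
    let c : Cocone F :=
      { pt := ULift.{u} Prop
        ι :=
          { app Y := ↾fun s => ⟨∃ u : Y.unop ⟶ Q k, F.map u.op (t k) = s⟩
            naturality Y Y' a := by
              ext s
              refine congr_arg ULift.up (propext ⟨?_, ?_⟩)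
              · rintro ⟨u, hu⟩
                have hfac : ∃ u' : Y.unop ⟶ Q k, a.unop ≫ u' = u := by
                  obtain ⟨R, hY, hY'⟩ := Y.unop.2.exists_common Y'.unop.2
                  obtain ⟨u', hu'⟩ := exists_factor_of_kernel hY Y.unop.2.1 hY' Y'.unop.2.1.1
                    a.unop.hom u.hom fun j x y hxy => by
                      refine congr_arg InducedCategory.Hom.hom (hmono k
                        ((CoverCat.toConnLC R).obj j) (ObjectProperty.homMk x ≫ u)
                        (ObjectProperty.homMk y ≫ u) ?_)
                      have hxy' : (ObjectProperty.homMk x : (CoverCat.toConnLC R).obj j ⟶ _) ≫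
                        a.unop = ObjectProperty.homMk y ≫ a.unop := ObjectProperty.hom_ext _ hxy
                      rw [← hc, ← hc, hu]
                      change F.map _ (F.map a.unop.op s) = F.map _ (F.map a.unop.op s)
                      rw [hc, hc, hxy']
                  exact ⟨ObjectProperty.homMk u', ObjectProperty.hom_ext _ hu'⟩
                obtain ⟨u', rfl⟩ := hfac
                refine ⟨u', injective_map_of_isSheaf hF a.unop ?_⟩
                rw [hc, hu]
                rfl
              · rintro ⟨u, rfl⟩
                exact ⟨a.unop ≫ u, (hc _ _ _).symm⟩ } }
    have h₁ (Y : ConnLC T) (s : F.obj (op Y)) : colimit.desc F c (κ Y s) = c.ι.app (op Y) s :=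
      ConcreteCategory.congr_hom (colimit.ι_desc c (op Y)) s
    have h₂ : c.ι.app (op Y) s = c.ι.app (op (Q k)) (t k) := by
      rw [← h₁, ← h₁, hk, ht]
    have h₃ : (c.ι.app (op (Q k)) (t k)).down :=
      ⟨𝟙 _, by rw [op_id, F.map_id]; rfl⟩
    rw [← h₂] at h₃
    exact h₃
  choose υ hυ using hu
  let X : T := ∐ fun k => (Q k).obj
  let hX := coproductIsCoproduct fun k => (Q k).obj
  have uniq {Y : ConnLC T} {k k' : (colimit F : Type u)} (h : k = k') (u : Y ⟶ Q k)
      (u' : Y ⟶ Q k') (huu' : F.map u.op (t k) = F.map u'.op (t k')) :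
      u.hom ≫ Sigma.ι (fun k => (Q k).obj) k = u'.hom ≫ Sigma.ι (fun k => (Q k).obj) k' := by
    subst h
    rw [hmono _ _ u u' huu']
  refine ⟨X, isSum_of_cofan_connectedLC ⟨_, _, _, ⟨hX⟩, fun k => (Q k).2⟩, ⟨Iso.symm ?_⟩⟩
  refine NatIso.ofComponents (fun Y => (Equiv.ofBijective
    (fun s : F.obj Y => (υ Y.unop s).hom ≫ Sigma.ι (fun k => (Q k).obj) (κ Y.unop s))
    ⟨fun s s' h => ?_, fun y => ?_⟩).toIso) fun {Y Y'} a => ?_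
  · have hk : κ Y.unop s = κ Y.unop s' := eq_of_comp_inj_eq hX Y.unop.2.1.1 _ _ h
    have key {k k' : (colimit F : Type u)} (hk : k = k') (u : Y.unop ⟶ Q k)
      (u' : Y.unop ⟶ Q k') (h : u.hom ≫ Sigma.ι (fun k => (Q k).obj) k =
        u'.hom ≫ Sigma.ι (fun k => (Q k).obj) k') :
        F.map u.op (t k) = F.map u'.op (t k') := by
      subst hk
      have : Mono (Sigma.ι (fun k => (Q k).obj) k) := mono_inj_of_isColimit hX k
      rw [ObjectProperty.hom_ext _ ((cancel_mono _).1 h)]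
    have := key hk _ _ h
    rwa [hυ, hυ] at this
  · obtain ⟨k, g, rfl⟩ := Y.unop.2.1.exists_factor hX y
    let g' : Y.unop ⟶ Q k := ObjectProperty.homMk g
    refine ⟨F.map g'.op (t k), uniq ((hκ g' (t k)).trans (ht k)) _ g' (hυ _ _)⟩
  · ext s
    refine (uniq (hκ a.unop s) _ (a.unop ≫ υ _ s) ?_).trans (Category.assoc _ _ _)
    exact (hυ _ _).trans ((congr_arg (F.map a) (hυ _ s)).symm.trans (hc a.unop (υ _ s) _))

end Sheaf

variable (T) in
/-- The functor from `SLC T` to the sheaves on the connected locally constant objects. -/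
noncomputable def slcToSheaf : SLC T ⥤ Sheaf (atomicTopology T) (Type u) :=
  ObjectProperty.lift _ (ObjectProperty.ι _ ⋙ connNerve T) fun X =>
    (isSheaf_iff_isSheaf_of_type _ _).2 (isSheaf_connNerve X.obj)

instance : (slcToSheaf T).IsEquivalence where
  faithful := ⟨fun {X Y} f g h => ObjectProperty.hom_ext _
    ((bijective_connNerve_map X.2 Y.1).1 (congr_arg (sheafToPresheaf _ _).map h))⟩
  full := ⟨fun {X Y} φ => by
    obtain ⟨t, ht⟩ := (bijective_connNerve_map X.2 Y.1).2 φ.hom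
    exact ⟨ObjectProperty.homMk t, ObjectProperty.hom_ext _ ht⟩⟩
  essSurj := ⟨fun F => by
    obtain ⟨X, hX, ⟨e⟩⟩ := nonempty_connNerve_iso ((isSheaf_iff_isSheaf_of_type _ _).1 F.2)
    exact ⟨⟨X, hX⟩, ⟨ObjectProperty.isoMk _ e⟩⟩⟩

instance isGrothendieckTopos_slc : IsGrothendieckTopos.{u} (SLC T) where
  exists_site := ⟨SmallModel.{u} (ConnLC T), inferInstance,
    (equivSmallModel.{u} (ConnLC T)).inverse.inducedTopology (atomicTopology T),
    ⟨(slcToSheaf T).asEquivalence.trans ((equivSmallModel.{u} (ConnLC T)).sheafCongr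
      (atomicTopology T) _ (Type u))⟩⟩

end SLCTopos

/-! ### Fibers of base points -/

section Points

variable {T : Type (u + 1)} [LargeCategory.{u} T] [IsGrothendieckTopos.{u} T]
  [IsLocallyConnected T]

/-- The inclusion of `LC(T, R)` in `SLC T`. -/
abbrev LC.toSLC (R : CoveringSieve T) : LC R ⥤ SLC T :=
  ObjectProperty.ιOfLE (isTrivializedBySieve_le_isSumOfLocallyConstant R)

instance (R : CoveringSieve T) : (LC.toSLC R).IsLeftAdjoint := isLeftAdjoint_ιOfLE _

instance (R : CoveringSieve T) : HasFiniteLimits (LC R) := ⟨fun _ _ _ => inferInstance⟩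

instance (R : CoveringSieve T) : PreservesFiniteLimits (LC.toSLC R) where
  preservesFiniteLimits J _ _ := by
    have : PreservesLimitsOfShape J (LC.toSLC R ⋙ ObjectProperty.ι _) :=
      inferInstanceAs (PreservesLimitsOfShape J (ObjectProperty.ι (IsTrivializedBySieve R)))
    exact preservesLimitsOfShape_of_reflects_of_preserves (LC.toSLC R) (ObjectProperty.ι _)

omit [IsLocallyConnected T] in
lemma nonempty_isColimit_slc {I : Type u} {Y : I → SLC T} {X : SLC T} (i : ∀ k, Y k ⟶ X)
    (h : IsColimit (Cofan.mk X.obj fun k => (i k).hom)) : Nonempty (IsColimit (Cofan.mk X i)) :=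
  ⟨isColimitOfReflects (ObjectProperty.ι _)
    ((isColimitMapCoconeCofanMkEquiv (ObjectProperty.ι _) _ _).symm h)⟩

namespace BasePoint

variable (p : BasePoint T) {R : CoveringSieve T}

instance : PreservesFiniteLimits p.obj := p.property.1

omit [IsLocallyConnected T] in
/-- The elements of the fiber of a coproduct come from the summands. -/
lemma exists_of_cofan {I : Type u} {X : SLC T} {Y : I → T} {i : ∀ k, Y k ⟶ X.obj}
    (hc : IsColimit (Cofan.mk X.obj i)) (hY : ∀ k, IsSumOfLocallyConstant T (Y k))
    (x : p.obj.obj X) : ∃ (k : I) (y : p.obj.obj ⟨Y k, hY k⟩),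
      p.obj.map (ObjectProperty.homMk (i k)) y = x := by
  have := p.property.2
  obtain ⟨hd⟩ := nonempty_isColimit_slc (Y := fun k => ⟨Y k, hY k⟩) (X := X)
    (fun k => ObjectProperty.homMk (i k)) hc
  obtain ⟨⟨k⟩, y, hy⟩ := Types.jointly_surjective_of_isColimit (isColimitOfPreserves p.obj hd) x
  exact ⟨k, y, hy⟩

omit [IsLocallyConnected T] in
lemma surjective_map_of_epi {X Y : SLC T} (f : X ⟶ Y) [Epi f.hom] :
    Function.Surjective (p.obj.map f) := by
  have := p.property.2
  have : Epi f := (ObjectProperty.ι _).epi_of_epi_map (inferInstanceAs (Epi f.hom))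
  exact (epi_iff_surjective _).1 inferInstance

omit [IsLocallyConnected T] in
lemma isEmpty_isInitial_of_mem {X : SLC T} (x : p.obj.obj X) : IsEmpty (IsInitial X.obj) := by
  refine ⟨fun h => ?_⟩
  have := p.property.2
  have h' : IsInitial X := IsInitial.ofUniqueHom (fun Z => ObjectProperty.homMk (h.to Z.obj))
    fun Z f => ObjectProperty.hom_ext _ (h.hom_ext _ _)
  exact ((Types.initial_iff_empty _).1 ⟨IsInitial.isInitialObj p.obj X h'⟩).false x

/-- A point of a universal cover corepresents the fiber functor. -/
lemma bijective_fiber {A : LC R} (hA : IsUniversalCover R A.obj) (e : (p.fiber R).obj A)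
    (F : LC R) : Function.Bijective fun f : A ⟶ F => (p.fiber R).map f e := by
  have hsep := connectedIn_isSeparating R
  refine ⟨fun f g hfg => ?_, fun y => ?_⟩
  · -- The equalizer of `f` and `g` has a point, and so is not initial.
    obtain ⟨a, -⟩ := Fork.IsLimit.lift' (isLimitOfHasEqualizerOfPreservesLimit (p.fiber R) f g)
      (↾fun _ : PUnit => e) (by ext; exact hfg)
    obtain ⟨V, hV, ⟨v⟩⟩ := exists_hom_of_isSeparating hsep
      (p.isEmpty_isInitial_of_mem (a PUnit.unit))
    have h : v ≫ (equalizer.ι f g).hom ≫ f.hom = v ≫ (equalizer.ι f g).hom ≫ g.hom :=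
      congr_arg (v ≫ ·) (congr_arg InducedCategory.Hom.hom (equalizer.condition f g))
    rw [← Category.assoc, ← Category.assoc] at h
    exact ObjectProperty.hom_ext _ ((hA.2.2 hV _ F.2).1 h)
  · obtain ⟨a, ha₁, ha₂⟩ := BinaryFan.IsLimit.lift'
      (isLimitOfHasBinaryProductOfPreservesLimit (p.fiber R) A F)
      (↾fun _ : PUnit => e) (↾fun _ : PUnit => y)
    replace ha₁ : (p.fiber R).map prod.fst (a PUnit.unit) = e :=
      ConcreteCategory.congr_hom ha₁ PUnit.unit
    replace ha₂ : (p.fiber R).map prod.snd (a PUnit.unit) = y :=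
      ConcreteCategory.congr_hom ha₂ PUnit.unit
    -- The summand of `A ⨯ F` through `(e, y)` projects isomorphically to `A`; its second projection
    -- is the required morphism.
    obtain ⟨I, Y, i, ⟨hc⟩, hY⟩ := exists_cofan_connected (A ⨯ F).obj
    have hY' (k : I) : IsTrivializedBySieve R (Y k) :=
      IsTrivializedBySieve.of_cofan hc (A ⨯ F).property k
    obtain ⟨k, w, hw⟩ := p.exists_of_cofan (X := (LC.toSLC R).obj (A ⨯ F)) hc
      (fun k => isTrivializedBySieve_le_isSumOfLocallyConstant R _ (hY' k)) (a PUnit.unit)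
    let Z : LC R := ⟨Y k, hY' k⟩
    let j : Z ⟶ A ⨯ F := ObjectProperty.homMk (i k)
    change (p.fiber R).obj Z at w
    change (p.fiber R).map j w = _ at hw
    obtain ⟨V, hV, ⟨η⟩⟩ := exists_hom_of_isSeparating hsep hA.2.1.1
    obtain ⟨l, hl⟩ := exists_lift_of_connected hA.1 hA.2.1 Z.2 (hY k).1
      (j ≫ (prod.fst : A ⨯ F ⟶ A)).hom hV η
    obtain ⟨r, rfl⟩ := (hA.2.2 hV η Z.2).2 l
    let r' : A ⟶ Z := ObjectProperty.homMk r
    have hr : r' ≫ j ≫ prod.fst = 𝟙 A := ObjectProperty.hom_ext _ ((hA.2.2 hV η A.2).1 (by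
      refine Eq.trans ?_ (hl.trans (Category.comp_id _).symm)
      exact (Category.assoc _ _ _).symm))
    have : Epi r := epi_of_connected Z.2 (hY k) hA.1 hA.2.1.1 r
    obtain ⟨e', rfl⟩ : ∃ e', (p.fiber R).map r' e' = w :=
      @surjective_map_of_epi _ _ _ p _ _ ((LC.toSLC R).map r') this w
    have hcomp {X Y Z : LC R} (f : X ⟶ Y) (g : Y ⟶ Z) (x) :
        (p.fiber R).map g ((p.fiber R).map f x) = (p.fiber R).map (f ≫ g) x :=
      (ConcreteCategory.congr_hom ((p.fiber R).map_comp f g) x).symm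
    have he : e' = e := by
      rw [← ha₁, ← hw, hcomp, hcomp, hr]
      exact (ConcreteCategory.congr_hom ((p.fiber R).map_id A) e').symm
    refine ⟨r' ≫ j ≫ prod.snd, ?_⟩
    dsimp only
    rw [← hcomp, ← hcomp, ← he, hw, ha₂]

/-- The fiber functor is corepresented by a universal cover with a point. -/
noncomputable def fiberIso (i : CoverIndex R) (e : (p.fiber R).obj (cover R i)) :
    coyoneda.obj (op (cover R i)) ≅ p.fiber R :=
  NatIso.ofComponents (fun F => (Equiv.ofBijective _
    (p.bijective_fiber (isUniversalCover_cover R i) e F)).toIso) fun {F G} f => by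
      ext g
      exact ConcreteCategory.congr_hom ((p.fiber R).map_comp g f) e

/-- The universal covers for `R` cover the final object, and so one of them has a point over `p`. -/
lemma exists_fiber_nonempty (R : CoveringSieve T) :
    ∃ i : CoverIndex R, Nonempty ((p.fiber R).obj (cover R i)) := by
  let X : LC R := ⟨⊤_ T, isTrivializedBySieve_terminal⟩
  have hX : IsTerminal X := IsTerminal.ofUniqueHom
    (fun Z => ObjectProperty.homMk (terminal.from Z.obj))
    fun Z f => ObjectProperty.hom_ext _ (Subsingleton.elim _ _)
  have hX' : IsTerminal ((p.fiber R).obj X) := IsTerminal.isTerminalObj (p.fiber R) X hX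
  let x : (p.fiber R).obj X := hX'.from PUnit PUnit.unit
  obtain ⟨I, Y, i, ⟨hc⟩, hY⟩ := exists_cofan_connected (⊤_ T)
  have hY' (k : I) : IsTrivializedBySieve R (Y k) :=
    IsTrivializedBySieve.of_cofan hc isTrivializedBySieve_terminal k
  obtain ⟨k, y, -⟩ := p.exists_of_cofan (X := (LC.toSLC R).obj X) hc
    (fun k => isTrivializedBySieve_le_isSumOfLocallyConstant R _ (hY' k)) x
  obtain ⟨V, hV, ⟨v⟩⟩ := exists_hom_of_isSeparating (connectedIn_isSeparating R) (hY k).1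
  obtain ⟨j, ⟨η⟩⟩ := hV.exists_hom_cover
  obtain ⟨a, -⟩ := ((isUniversalCover_cover R j).2.2 hV η (hY' k)).2 v
  have : Epi a := epi_of_connected (hY' k) (hY k) (cover R j).2
    (isUniversalCover_cover R j).2.1.1 a
  obtain ⟨e, -⟩ := @surjective_map_of_epi _ _ _ p _ _
    ((LC.toSLC R).map (ObjectProperty.homMk a : cover R j ⟶ ⟨Y k, hY' k⟩)) this y
  exact ⟨j, ⟨e⟩⟩

end BasePoint

/-- An object of `SLC T` that is connected in `T` is connected in `SLC T`. -/
lemma isConnectedObject_slc {X : SLC T} (hX : IsConnectedObject X.obj) : IsConnectedObject X := by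
  have hinit {Z : SLC T} (h : IsInitial Z.obj) : IsInitial Z :=
    IsInitial.ofUniqueHom (fun W => ObjectProperty.homMk (h.to W.obj))
      fun W f => ObjectProperty.hom_ext _ (h.hom_ext _ _)
  refine ⟨⟨fun h => hX.1.false ?_⟩, fun X₁ X₂ i₁ i₂ ⟨hc⟩ => ?_⟩
  · let O : SLC T := ⟨⊥_ T, isSum_of_isInitial initialIsInitial⟩
    exact initialIsInitial.ofIso
      ((ObjectProperty.ι _).mapIso ((hinit (Z := O) initialIsInitial).uniqueUpToIso h))
  · let S : SLC T := ⟨X₁.obj ⨿ X₂.obj,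
      isSum_of_binaryCofan (coprodIsCoprod X₁.obj X₂.obj) X₁.2 X₂.2⟩
    let j₁ : X₁ ⟶ S := ObjectProperty.homMk coprod.inl
    let j₂ : X₂ ⟶ S := ObjectProperty.homMk coprod.inr
    -- The coproduct in `T` is also a coproduct in `SLC T`.
    obtain ⟨a, ha₁, ha₂⟩ : ∃ a : X ⟶ S, i₁ ≫ a = j₁ ∧ i₂ ≫ a = j₂ :=
      ⟨_, (BinaryCofan.IsColimit.desc' hc j₁ j₂).2.1, (BinaryCofan.IsColimit.desc' hc j₁ j₂).2.2⟩
    let b : S ⟶ X := ObjectProperty.homMk (coprod.desc i₁.hom i₂.hom)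
    have hb₁ : j₁ ≫ b = i₁ := ObjectProperty.hom_ext _ (coprod.inl_desc _ _)
    have hb₂ : j₂ ≫ b = i₂ := ObjectProperty.hom_ext _ (coprod.inr_desc _ _)
    have hab : a ≫ b = 𝟙 X := BinaryCofan.IsColimit.hom_ext hc
      (by change i₁ ≫ a ≫ b = i₁ ≫ 𝟙 X; rw [reassoc_of% ha₁, hb₁, Category.comp_id])
      (by change i₂ ≫ a ≫ b = i₂ ≫ 𝟙 X; rw [reassoc_of% ha₂, hb₂, Category.comp_id])
    have hba : b ≫ a = 𝟙 S := ObjectProperty.hom_ext _ (coprod.hom_ext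
      (congr_arg InducedCategory.Hom.hom
        (show j₁ ≫ b ≫ a = j₁ ≫ 𝟙 S by rw [reassoc_of% hb₁, ha₁, Category.comp_id]))
      (congr_arg InducedCategory.Hom.hom
        (show j₂ ≫ b ≫ a = j₂ ≫ 𝟙 S by rw [reassoc_of% hb₂, ha₂, Category.comp_id])))
    have hd : IsColimit (BinaryCofan.mk i₁.hom i₂.hom) :=
      IsColimit.ofIsoColimit (coprodIsCoprod X₁.obj X₂.obj) (BinaryCofan.ext
        ((ObjectProperty.ι _).mapIso ⟨b, a, hba, hab⟩)
        (congr_arg InducedCategory.Hom.hom hb₁) (congr_arg InducedCategory.Hom.hom hb₂))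
    obtain ⟨⟨h⟩⟩ | ⟨⟨h⟩⟩ := hX.2 _ _ ⟨hd⟩
    · exact Or.inl ⟨hinit h⟩
    · exact Or.inr ⟨hinit h⟩

/-- If `P` meets each connected component, each universal cover has a point over some element of
`P`. -/
lemma MeetsEveryComponent.exists_fiber_nonempty {P : Set (BasePoint T)}
    (hP : MeetsEveryComponent P) {R : CoveringSieve T} (i : CoverIndex R) :
    ∃ p ∈ P, Nonempty ((p.fiber R).obj (cover R i)) := by
  obtain ⟨I, Y, j, ⟨hc⟩, hY⟩ := exists_cofan_connected (⊤_ T)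
  have hY' (k : I) : IsTrivializedBySieve R (Y k) :=
    IsTrivializedBySieve.of_cofan hc isTrivializedBySieve_terminal k
  obtain ⟨k, a, -⟩ := (isUniversalCover_cover R i).2.1.exists_factor hc (terminal.from _)
  obtain ⟨hb⟩ := nonempty_isColimit_binaryCofan_of_cofan hc k
  let toS {X : T} (h : IsTrivializedBySieve R X) : SLC T :=
    ⟨X, isTrivializedBySieve_le_isSumOfLocallyConstant R X h⟩
  let C : SLC T := toS (hY' k)
  let C' : SLC T := toS (isTrivializedBySieve_terminal.of_binaryCofan
    (BinaryCofan.isColimitFlip hb))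
  let Z : SLC T := toS isTrivializedBySieve_terminal
  obtain ⟨p, hp, ⟨y⟩⟩ := @hP C C' Z (ObjectProperty.homMk (j k)) (ObjectProperty.homMk
    (Sigma.desc (fun l : {l // l ≠ k} => j l.1)))
    ⟨IsTerminal.ofUniqueHom (fun Z => ObjectProperty.homMk (terminal.from Z.obj))
      fun Z f => ObjectProperty.hom_ext _ (Subsingleton.elim _ _)⟩
    ⟨isColimitOfReflects (ObjectProperty.ι _) ((isColimitMapCoconeBinaryCofanEquiv _ _ _).symm hb)⟩
    (isConnectedObject_slc (hY k))
  have : Epi a := epi_of_connected (hY' k) (hY k) (cover R i).2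
    (isUniversalCover_cover R i).2.1.1 a
  obtain ⟨e, -⟩ := @BasePoint.surjective_map_of_epi _ _ _ p _ _
    ((LC.toSLC R).map (ObjectProperty.homMk a : cover R i ⟶ ⟨Y k, hY' k⟩)) this y
  exact ⟨p, hp, ⟨e⟩⟩

end Points

/-! ### The groupoids of base points -/

section Groupoid

variable {T : Type (u + 1)} [LargeCategory.{u} T] [IsGrothendieckTopos.{u} T]
  [IsLocallyConnected T]

section Cover

variable {P : Set (BasePoint T)} (hP : MeetsEveryComponent P) (R : CoveringSieve T)

/-- A base point in `P` over a universal cover. -/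
noncomputable def coverPoint (i : CoverIndex R) : PointGroupoid P R :=
  ⟨⟨(hP.exists_fiber_nonempty i).choose, (hP.exists_fiber_nonempty i).choose_spec.1⟩⟩

/-- The universal covers corepresent the fiber functors of the chosen base points. -/
noncomputable def coverPointIso (i : CoverIndex R) :
    coyoneda.obj (op (cover R i)) ≅ (coverPoint hP R i).pt.1.fiber R :=
  BasePoint.fiberIso _ i (hP.exists_fiber_nonempty i).choose_spec.2.some

instance {i j : (CoverCat R)ᵒᵖ} (f : i ⟶ j) : IsIso f := (isIso_unop_iff f).1 inferInstance

variable {R} in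
/-- The isomorphism of corepresented functors induced by a morphism of universal covers. -/
noncomputable def coyonedaIso {i j : (CoverCat R)ᵒᵖ} (f : i ⟶ j) :
    coyoneda.obj (op (cover R i.unop)) ≅ coyoneda.obj (op (cover R j.unop)) :=
  coyoneda.mapIso ((inducedFunctor (cover R)).op.mapIso (asIso f))

/-- The functor from the groupoid of universal covers to the groupoid of base points. -/
noncomputable def coverToPoint : (CoverCat R)ᵒᵖ ⥤ PointGroupoid P R where
  obj i := coverPoint hP R i.unop
  map {i j} f := (coverPointIso hP R i.unop).symm ≪≫ coyonedaIso f ≪≫ coverPointIso hP R j.unop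
  map_id i := Iso.ext (by
    have h : (coyonedaIso (𝟙 i)).hom = 𝟙 _ := by simp [coyonedaIso]
    change _ ≫ _ ≫ _ = 𝟙 _
    rw [h, Category.id_comp]
    exact (coverPointIso hP R i.unop).inv_hom_id)
  map_comp {i j k} f g := Iso.ext (by
    have h : (coyonedaIso (f ≫ g)).hom = (coyonedaIso f).hom ≫ (coyonedaIso g).hom := by
      simp [coyonedaIso]
    refine Eq.trans (b := (coverPointIso hP R i.unop).inv ≫ (coyonedaIso (f ≫ g)).hom ≫
      (coverPointIso hP R k.unop).hom) rfl ?_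
    refine Eq.trans ?_ (b := ((coverPointIso hP R i.unop).inv ≫ (coyonedaIso f).hom ≫
      (coverPointIso hP R j.unop).hom) ≫ (coverPointIso hP R j.unop).inv ≫ (coyonedaIso g).hom ≫
        (coverPointIso hP R k.unop).hom) rfl
    rw [h]
    simp)

instance : (coverToPoint hP R).IsEquivalence where
  faithful := ⟨fun {i j} f g h => by
    have h' : (coverPointIso hP R i.unop).inv ≫ (coyonedaIso f).hom ≫
        (coverPointIso hP R j.unop).hom = (coverPointIso hP R i.unop).inv ≫ (coyonedaIso g).hom ≫
          (coverPointIso hP R j.unop).hom := congr_arg Iso.hom h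
    rw [cancel_epi, cancel_mono] at h'
    exact (inducedFunctor (cover R)).op.map_injective (coyoneda.map_injective h')⟩
  full := ⟨fun {i j} α => by
    let α' : (coverPoint hP R i.unop).pt.1.fiber R ≅ (coverPoint hP R j.unop).pt.1.fiber R := α
    obtain ⟨t, ht⟩ := coyoneda.map_surjective ((coverPointIso hP R i.unop).hom ≫ α'.hom ≫
      (coverPointIso hP R j.unop).inv)
    obtain ⟨f, rfl⟩ := (inducedFunctor (cover R)).op.map_surjective (X := i) (Y := j) t
    refine ⟨f, Iso.ext (?_ : (coverPointIso hP R i.unop).inv ≫ (coyonedaIso f).hom ≫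
      (coverPointIso hP R j.unop).hom = α'.hom)⟩
    rw [Iso.inv_comp_eq, ← Iso.eq_comp_inv]
    exact ht.trans (Category.assoc _ _ _).symm⟩
  essSurj := ⟨fun p => by
    obtain ⟨i, ⟨e⟩⟩ := p.pt.1.exists_fiber_nonempty R
    exact ⟨op i, ⟨(Groupoid.isoEquivHom _ _).symm
      ((coverPointIso hP R i).symm ≪≫ p.pt.1.fiberIso i e :
        (coverPoint hP R i).pt.1.fiber R ≅ p.pt.1.fiber R)⟩⟩⟩

end Cover

/-- The fibers of an object of `LC(T, R)` at the points of `P`, with the action of `G_R`. -/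
def fiberFunctor (P : Set (BasePoint T)) (R : CoveringSieve T) :
    LC R ⥤ ClassifyingCat.{u} (PointGroupoid P R) where
  obj F :=
    { obj p := (p.pt.1.fiber R).obj F
      map {p q} α := (show p.pt.1.fiber R ≅ q.pt.1.fiber R from α).hom.app F
      map_id _ := rfl
      map_comp _ _ := rfl }
  map f :=
    { app p := (p.pt.1.fiber R).map f
      naturality {p q} α := ((show p.pt.1.fiber R ≅ q.pt.1.fiber R from α).hom.naturality f).symm }
  map_id F := by
    ext p : 2
    exact (p.pt.1.fiber R).map_id F
  map_comp f g := by
    ext p : 2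
    exact (p.pt.1.fiber R).map_comp f g

variable {P : Set (BasePoint T)}

/-- `LC(T, R)` is the classifying topos of the groupoid of base points. -/
lemma MeetsEveryComponent.isEquivalence_fiberFunctor (hP : MeetsEveryComponent P)
    (R : CoveringSieve T) : (fiberFunctor P R).IsEquivalence := by
  have : (ObjectProperty.ι (IsTrivializedBySieve R) ⋙ nerve R).IsEquivalence :=
    isEquivalence_nerve
  let e : ObjectProperty.ι (IsTrivializedBySieve R) ⋙ nerve R ≅
      fiberFunctor P R ⋙ (Functor.whiskeringLeft _ _ (Type u)).obj (coverToPoint hP R) :=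
    NatIso.ofComponents (fun F => NatIso.ofComponents
      (fun i => (ObjectProperty.fullyFaithfulι _).homEquiv.symm.toIso ≪≫
        (coverPointIso hP R i.unop).app F)
      (fun {i j} f => by
        ext x
        let y : cover R i.unop ⟶ F := ObjectProperty.homMk x
        refine Eq.trans (b := (coverPointIso hP R j.unop).hom.app F
          ((coyonedaIso f).hom.app F y)) rfl (Eq.trans ?_
          (b := (coverPointIso hP R j.unop).hom.app F ((coyonedaIso f).hom.app F
            ((coverPointIso hP R i.unop).inv.app F
              ((coverPointIso hP R i.unop).hom.app F y)))) rfl)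
        rw [Iso.hom_inv_id_app_apply]))
      (fun {F G} f => by
        ext i x
        exact (coverPointIso hP R i.unop).hom.naturality_apply f
          (ObjectProperty.homMk x : cover R i.unop ⟶ F))
  have := Functor.isEquivalence_of_iso e
  exact Functor.isEquivalence_of_comp_right _
    ((Functor.whiskeringLeft _ _ (Type u)).obj (coverToPoint hP R))

lemma MeetsEveryComponent.isGrothendieckTopos (hP : MeetsEveryComponent P)
    (R : CoveringSieve T) : IsGrothendieckTopos.{u} (ClassifyingCat.{u} (PointGroupoid P R)) where
  exists_site := ⟨CoverCat R, inferInstance, ⊥,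
    ⟨((coverToPoint hP R).asEquivalence.congrLeft (E := Type u)).symm.trans
      (sheafBotEquivalence _).symm⟩⟩

/-- Each isomorphism of fiber functors on `LC(T, R)` extends to `LC(T, R')`. -/
lemma surjective_restrict {R' R : CoveringSieve T} (h : R' ≤ R) (p q : BasePoint T)
    (α : p.fiber R ≅ q.fiber R) :
    ∃ α' : p.fiber R' ≅ q.fiber R', Functor.isoWhiskerLeft (LC.inclusion h) α' = α := by
  obtain ⟨i, ⟨e⟩⟩ := p.exists_fiber_nonempty R
  obtain ⟨i', ⟨e'⟩⟩ := p.exists_fiber_nonempty R'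
  obtain ⟨r, hr⟩ := (p.bijective_fiber (isUniversalCover_cover R' i') e'
    ((LC.inclusion h).obj (cover R i))).2 e
  have : Epi r.hom := epi_of_connected (isTrivializedBySieve_le h _ (cover R i).2)
    (isUniversalCover_cover R i).2.1 (cover R' i').2 (isUniversalCover_cover R' i').2.1.1 r.hom
  obtain ⟨ε', hε'⟩ : ∃ ε', (q.fiber R').map r ε' = α.hom.app _ e :=
    @BasePoint.surjective_map_of_epi _ _ _ q _ _ ((LC.toSLC R').map r) this _
  let α' := (p.fiberIso i' e').symm ≪≫ q.fiberIso i' ε'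
  have hα' (F : LC R') (f : cover R' i' ⟶ F) :
      α'.hom.app F ((p.fiber R').map f e') = (q.fiber R').map f ε' := by
    change (q.fiberIso i' ε').hom.app F ((p.fiberIso i' e').inv.app F
      ((p.fiberIso i' e').hom.app F f)) = _
    rw [Iso.hom_inv_id_app_apply]
    rfl
  refine ⟨α', Iso.ext ?_⟩
  ext F x
  obtain ⟨f, rfl⟩ := (p.bijective_fiber (isUniversalCover_cover R i) e F).2 x
  have h₁ := hα' _ (r ≫ (LC.inclusion h).map f)
  rw [Functor.map_comp, Functor.map_comp] at h₁
  refine Eq.trans ?_ (h₁.trans ?_)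
  · exact congr_arg (fun y => α'.hom.app ((LC.inclusion h).obj F)
      ((p.fiber R').map ((LC.inclusion h).map f) y)) hr.symm
  · exact (congr_arg ((q.fiber R').map ((LC.inclusion h).map f)) hε').trans
      (α.hom.naturality_apply f e).symm

/-- The fundamental progroupoid is strict. -/
lemma isStrictProgroupoid_fundamentalProgroupoid (P : Set (BasePoint T)) :
    IsStrictProgroupoid (fundamentalProgroupoid T P) where
  isCofiltered := inferInstance
  bijective_obj R' R φ := ⟨fun x y h => by
      cases x
      cases y
      exact congr_arg PointGroupoid.mk (congr_arg PointGroupoid.pt h :),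
    fun y => ⟨⟨y.pt⟩, rfl⟩⟩
  surjective_map R' R φ p q α := surjective_restrict φ.le p.pt.1 q.pt.1 α

end Groupoid

/-! ### Functors determined by their values on summands -/

section Summands

variable {X : Type v₁} [Category.{w₁} X] {E : Type v₂} [Category.{w₂} E]

/-- The objects with property `K` generate by coproducts if each object is a coproduct of objects
with property `K`, through the summands of which factor the morphisms from objects with
property `K`. -/
def GeneratesByCoproducts (K : ObjectProperty X) : Prop :=
  ∀ A, ∃ (I : Type u) (Y : I → X) (i : ∀ k, Y k ⟶ A), Nonempty (IsColimit (Cofan.mk A i)) ∧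
    (∀ k, K (Y k)) ∧ ∀ ⦃W⦄, K W → ∀ y : W ⟶ A, ∃ k g, g ≫ i k = y

variable {K : ObjectProperty X}

lemma nonempty_isColimit_map_cofan (F : X ⥤ E) [F.IsLeftAdjoint] {I : Type u} {Y : I → X} {A : X}
    {i : ∀ k, Y k ⟶ A} (hc : IsColimit (Cofan.mk A i)) :
    Nonempty (IsColimit (Cofan.mk (F.obj A) fun k => F.map (i k))) :=
  ⟨isColimitMapCoconeCofanMkEquiv F _ _ (isColimitOfPreserves F hc)⟩

namespace GeneratesByCoproducts

/-- Natural transformations from an inverse image functor agree if they do on generating summands. -/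
lemma natTrans_ext (hK : GeneratesByCoproducts.{u} K) {F G : X ⥤ E} [F.IsLeftAdjoint]
    {α β : F ⟶ G} (h : ∀ ⦃Y⦄, K Y → α.app Y = β.app Y) : α = β := by
  ext A
  obtain ⟨I, Y, i, ⟨hc⟩, hY, -⟩ := hK A
  obtain ⟨hc'⟩ := nonempty_isColimit_map_cofan F hc
  refine Cofan.IsColimit.hom_ext hc' _ _ fun k => ?_
  change F.map (i k) ≫ _ = F.map (i k) ≫ _
  rw [α.naturality, β.naturality, h (hY k)]

/-- A natural transformation can be defined on generating summands. -/
lemma exists_natTrans (hK : GeneratesByCoproducts.{u} K) {F G : X ⥤ E} [F.IsLeftAdjoint]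
    (α : ∀ ⦃Y⦄, K Y → (F.obj Y ⟶ G.obj Y))
    (hα : ∀ ⦃Y Y'⦄ (hY : K Y) (hY' : K Y') (f : Y ⟶ Y'),
      F.map f ≫ α hY' = α hY ≫ G.map f) :
    ∃ β : F ⟶ G, ∀ ⦃Y⦄ (hY : K Y), β.app Y = α hY := by
  choose I Y i hc hY hfac using hK
  have hc' (A : X) := (nonempty_isColimit_map_cofan F (hc A).some).some
  let b (A : X) : F.obj A ⟶ G.obj A :=
    Cofan.IsColimit.desc (hc' A) fun k => α (hY A k) ≫ G.map (i A k)
  have hb' (A : X) (k) : F.map (i A k) ≫ b A = α (hY A k) ≫ G.map (i A k) :=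
    Cofan.IsColimit.fac (hc' A) _ k
  have hb (A : X) {W : X} (hW : K W) (y : W ⟶ A) : F.map y ≫ b A = α hW ≫ G.map y := by
    obtain ⟨k, g, rfl⟩ := hfac A hW y
    rw [F.map_comp, Category.assoc, hb', G.map_comp, ← Category.assoc, hα hW (hY A k),
      Category.assoc]
  refine ⟨{ app := b, naturality := fun A B f => ?_ }, fun W hW => ?_⟩
  · refine Cofan.IsColimit.hom_ext (hc' A) _ _ fun k => ?_
    change F.map (i A k) ≫ _ = F.map (i A k) ≫ _
    rw [← Category.assoc, ← F.map_comp, hb B (hY A k), ← Category.assoc, hb', Category.assoc,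
      G.map_comp]
  · have := hb W hW (𝟙 W)
    rwa [F.map_id, G.map_id, Category.id_comp, Category.comp_id] at this

/-- A natural isomorphism can be defined on generating summands. -/
lemma exists_iso (hK : GeneratesByCoproducts.{u} K) {F G : X ⥤ E} [F.IsLeftAdjoint]
    [G.IsLeftAdjoint] (α : ∀ ⦃Y⦄, K Y → (F.obj Y ≅ G.obj Y))
    (hα : ∀ ⦃Y Y'⦄ (hY : K Y) (hY' : K Y') (f : Y ⟶ Y'),
      F.map f ≫ (α hY').hom = (α hY).hom ≫ G.map f) :
    ∃ β : F ≅ G, ∀ ⦃Y⦄ (hY : K Y), β.hom.app Y = (α hY).hom := by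
  obtain ⟨β, hβ⟩ := hK.exists_natTrans (fun Y hY => (α hY).hom) hα
  obtain ⟨γ, hγ⟩ := hK.exists_natTrans (F := G) (G := F) (fun Y hY => (α hY).inv)
    fun Y Y' hY hY' f => by
      rw [Iso.comp_inv_eq, Category.assoc, hα hY hY', Iso.inv_hom_id_assoc]
  refine ⟨⟨β, γ, hK.natTrans_ext fun Y hY => ?_, hK.natTrans_ext fun Y hY => ?_⟩, hβ⟩
  · simp [hβ hY, hγ hY]
  · simp [hβ hY, hγ hY]

end GeneratesByCoproducts

end Summands

/-! ### Left exactness can be tested on summands -/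

section LeftExact

variable {E : Type (u + 1)} [LargeCategory.{u} E] [IsGrothendieckTopos.{u} E]

/-- Composing a cospan with a monomorphism does not change its pullback. -/
lemma isPullback_comp_mono_iff {C : Type v₁} [Category.{w₁} C] {P X Y Z W : C} {p : P ⟶ X}
    {q : P ⟶ Y} {a : X ⟶ Z} {b : Y ⟶ Z} (m : Z ⟶ W) [Mono m] :
    IsPullback p q (a ≫ m) (b ≫ m) ↔ IsPullback p q a b := by
  refine ⟨fun h => ?_, fun h => ?_⟩
  · refine ⟨⟨(cancel_mono m).1 (by simpa using h.w)⟩, ⟨PullbackCone.IsLimit.mk _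
      (fun c => h.lift c.fst c.snd ?_) (fun c => h.lift_fst _ _ _) (fun c => h.lift_snd _ _ _)
      fun c n h₁ h₂ => h.hom_ext (h₁.trans (h.lift_fst _ _ _).symm)
        (h₂.trans (h.lift_snd _ _ _).symm)⟩⟩
    rw [← Category.assoc, c.condition, Category.assoc]
  · refine ⟨⟨by rw [← Category.assoc, h.w, Category.assoc]⟩, ⟨PullbackCone.IsLimit.mk _
      (fun c => h.lift c.fst c.snd ?_) (fun c => h.lift_fst _ _ _) (fun c => h.lift_snd _ _ _)
      fun c n h₁ h₂ => h.hom_ext (h₁.trans (h.lift_fst _ _ _).symm)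
        (h₂.trans (h.lift_snd _ _ _).symm)⟩⟩
    exact (cancel_mono m).1 (by simpa using c.condition)

/-- A square is a pullback if its restrictions to the summands of a coproduct are. -/
lemma isPullback_of_cofan {I : Type u} {X' P' : I → E} {P X Y Z : E} {i : ∀ k, X' k ⟶ X}
    (hX : IsColimit (Cofan.mk X i)) {j : ∀ k, P' k ⟶ P} (hP : IsColimit (Cofan.mk P j))
    {a : P ⟶ X} {b : P ⟶ Y} {f : X ⟶ Z} {g : Y ⟶ Z} {a' : ∀ k, P' k ⟶ X' k}
    (w : ∀ k, a' k ≫ i k = j k ≫ a) (h : ∀ k, IsPullback (a' k) (j k ≫ b) (i k ≫ f) g) :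
    IsPullback a b f g := by
  have w₀ : a ≫ f = b ≫ g := Cofan.IsColimit.hom_ext hP _ _ fun k => by
    change j k ≫ _ = j k ≫ _
    rw [← Category.assoc, ← w, Category.assoc, (h k).w, Category.assoc]
  let t : P ⟶ pullback f g := pullback.lift a b w₀
  have ht₁ : t ≫ pullback.fst f g = a := pullback.lift_fst _ _ _
  have ht₂ : t ≫ pullback.snd f g = b := pullback.lift_snd _ _ _
  have hk (k : I) : IsPullback (j k ≫ t) (a' k) (pullback.fst f g) (i k) := by
    refine (IsPullback.of_bot (v₂₁ := pullback.snd f g) (v₂₂ := f) (h₃₁ := g) ?_ ?_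
      (IsPullback.of_hasPullback f g)).flip
    · rw [Category.assoc, ht₂]
      exact h k
    · rw [Category.assoc, ht₁, w]
  obtain ⟨hQ⟩ := nonempty_isColimit_pullback_cofan hX (pullback.fst f g) _ _ hk
  have : IsIso t := by
    refine ⟨Cofan.IsColimit.desc hQ j, Cofan.IsColimit.hom_ext hP _ _ fun k => ?_,
      Cofan.IsColimit.hom_ext hQ _ _ fun k => ?_⟩
    · change j k ≫ t ≫ _ = j k ≫ 𝟙 _
      rw [← Category.assoc, Category.comp_id]
      exact Cofan.IsColimit.fac hQ _ k
    · change (j k ≫ t) ≫ _ ≫ t = (j k ≫ t) ≫ 𝟙 _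
      rw [Category.comp_id, ← Category.assoc]
      exact congr_arg (· ≫ t) (Cofan.IsColimit.fac hQ _ k)
  exact IsPullback.of_iso_pullback ⟨w₀⟩ (asIso t) ht₁ ht₂

variable {S : Type (u + 1)} [LargeCategory.{u} S] [IsGrothendieckTopos.{u} S] (F : S ⥤ E)

/-- A functor preserves the pullback of the pair `a`, `b`. -/
def PreservesPullbackOf {X Y Z : S} (a : X ⟶ Z) (b : Y ⟶ Z) : Prop :=
  ∀ ⦃P⦄ (p : P ⟶ X) (q : P ⟶ Y), IsPullback p q a b →
    IsPullback (F.map p) (F.map q) (F.map a) (F.map b)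

variable {F}

omit [IsGrothendieckTopos.{u} E] [IsGrothendieckTopos.{u} S] in
lemma PreservesPullbackOf.symm {X Y Z : S} {a : X ⟶ Z} {b : Y ⟶ Z}
    (h : PreservesPullbackOf F a b) : PreservesPullbackOf F b a :=
  fun _ p q hpq => (h q p hpq.flip).flip

lemma PreservesPullbackOf.of_cofan [F.IsLeftAdjoint] {I : Type u} {X' : I → S} {X Y Z : S}
    {i : ∀ k, X' k ⟶ X} (hX : IsColimit (Cofan.mk X i)) {a : X ⟶ Z} {b : Y ⟶ Z}
    (h : ∀ k, PreservesPullbackOf F (i k ≫ a) b) : PreservesPullbackOf F a b := by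
  intro P p q hpq
  have hk (k : I) := IsPullback.of_hasPullback p (i k)
  obtain ⟨hP⟩ := nonempty_isColimit_pullback_cofan hX p _ _ hk
  obtain ⟨hX'⟩ := nonempty_isColimit_map_cofan F hX
  obtain ⟨hP'⟩ := nonempty_isColimit_map_cofan F hP
  refine isPullback_of_cofan hX' hP' (a' := fun k => F.map (pullback.snd p (i k)))
    (fun k => ?_) fun k => ?_
  · rw [← F.map_comp, ← F.map_comp, pullback.condition]
  · rw [← F.map_comp, ← F.map_comp]
    exact h k _ _ ((hk k).flip.paste_vert hpq)

/-- Left exactness of an inverse image functor can be tested on the terminal object and on the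
pullbacks of summands. -/
lemma GeneratesByCoproducts.preservesFiniteLimits {K : ObjectProperty S}
    (hK : GeneratesByCoproducts.{u} K) [F.IsLeftAdjoint]
    (hF₀ : PreservesLimit (Functor.empty.{0} S) F)
    (hF : ∀ ⦃X Y Z : S⦄ (a : X ⟶ Z) (b : Y ⟶ Z), K X → K Y → K Z → PreservesPullbackOf F a b) :
    PreservesFiniteLimits F := by
  have key ⦃X Y Z : S⦄ (a : X ⟶ Z) (b : Y ⟶ Z) : PreservesPullbackOf F a b := by
    obtain ⟨IX, X', i, ⟨hX⟩, hX', -⟩ := hK X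
    refine .of_cofan hX fun k => .symm ?_
    obtain ⟨IY, Y', j, ⟨hY⟩, hY', -⟩ := hK Y
    refine .of_cofan hY fun l => .symm ?_
    obtain ⟨IZ, Z', m, ⟨hZ⟩, hZ', hfac⟩ := hK Z
    obtain ⟨s, a', ha'⟩ := hfac (hX' k) (i k ≫ a)
    obtain ⟨t, b', hb'⟩ := hfac (hY' l) (j l ≫ b)
    obtain ⟨hFZ⟩ := nonempty_isColimit_map_cofan F hZ
    rw [← ha', ← hb']
    intro P p q hpq
    by_cases hst : s = t
    · subst hst
      have h₁ : Mono (m s) := mono_inj_of_isColimit hZ s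
      have h₂ : Mono (F.map (m s)) := mono_inj_of_isColimit hFZ s
      rw [isPullback_comp_mono_iff] at hpq
      rw [F.map_comp, F.map_comp, isPullback_comp_mono_iff]
      exact hF a' b' (hX' k) (hY' l) (hZ' s) p q hpq
    · have hinit {E : Type (u + 1)} [LargeCategory.{u} E] [IsGrothendieckTopos.{u} E]
          {A : IZ → E} {B : E} {n : ∀ r, A r ⟶ B} (hB : IsColimit (Cofan.mk B n)) {W : E}
          (x : W ⟶ A s) (y : W ⟶ A t) (hxy : x ≫ n s = y ≫ n t) : Nonempty (IsInitial W) := by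
        by_contra h
        exact hst (eq_of_comp_inj_eq hB (not_nonempty_iff.1 h) x y hxy)
      obtain ⟨hP⟩ := hinit hZ (p ≫ a') (q ≫ b') (by
        rw [Category.assoc, Category.assoc, hpq.w])
      let hFP : IsInitial (F.obj P) := IsInitial.isInitialObj F P hP
      refine ⟨⟨hFP.hom_ext _ _⟩, ⟨PullbackCone.IsLimit.mk _ (fun c => ?_) (fun c => ?_)
        (fun c => ?_) fun c n _ _ => ?_⟩⟩
      all_goals
        have hc := Nonempty.some <| hinit hFZ (c.fst ≫ F.map a') (c.snd ≫ F.map b') (by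
          simpa only [Category.assoc, F.map_comp] using c.condition)
      · exact hc.to _
      all_goals exact hc.hom_ext _ _
  have : PreservesLimitsOfShape WalkingCospan F := by
    refine ⟨fun {D} => ?_⟩
    have h := (IsPullback.of_hasPullback (D.map WalkingCospan.Hom.inl)
      (D.map WalkingCospan.Hom.inr))
    have : PreservesLimit (cospan (D.map WalkingCospan.Hom.inl)
        (D.map WalkingCospan.Hom.inr)) F :=
      preservesLimit_of_preserves_limit_cone h.isLimit
        ((isLimitMapConePullbackConeEquiv F h.w).symm (key _ _ _ _ h).isLimit)
    exact preservesLimit_of_iso_diagram F (diagramIsoCospan D).symm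
  have : PreservesLimitsOfShape (Discrete.{0} PEmpty) F :=
    preservesLimitsOfShape_pempty_of_preservesTerminal F
  exact preservesFiniteLimits_of_preservesTerminal_and_pullbacks F

end LeftExact

/-! ### Extending functors from connected objects to disjoint sums -/

section SumExtension

variable {T : Type (u + 1)} [LargeCategory.{u} T] [IsGrothendieckTopos.{u} T]
  [IsLocallyConnected T]

lemma generatesByCoproducts_slc :
    GeneratesByCoproducts.{u} ((ConnectedLC (T := T)).inverseImage (ObjectProperty.ι
      (IsSumOfLocallyConstant T))) := by
  intro X
  obtain ⟨I, Y, i, ⟨hc⟩, hY⟩ := X.2.exists_cofan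
  refine ⟨I, fun k => ⟨Y k, (hY k).isSum⟩, fun k => ObjectProperty.homMk (i k),
    nonempty_isColimit_slc _ hc, hY, fun W hW y => ?_⟩
  obtain ⟨k, g, hg⟩ := hW.1.exists_factor hc y.hom
  exact ⟨k, ObjectProperty.homMk g, ObjectProperty.hom_ext _ hg⟩

lemma generatesByCoproducts_lc (R : CoveringSieve T) :
    GeneratesByCoproducts.{u} ((IsConnectedObject (C := T)).inverseImage (ObjectProperty.ι
      (IsTrivializedBySieve R))) := by
  intro X
  obtain ⟨I, Y, i, ⟨hc⟩, hY⟩ := exists_cofan_connected X.obj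
  refine ⟨I, fun k => ⟨Y k, IsTrivializedBySieve.of_cofan hc X.2 k⟩,
    fun k => ObjectProperty.homMk (i k), ⟨isColimitOfReflects (ObjectProperty.ι _)
    ((isColimitMapCoconeCofanMkEquiv (ObjectProperty.ι _) _ _).symm hc)⟩, hY, fun W hW y => ?_⟩
  obtain ⟨k, g, hg⟩ := hW.exists_factor hc y.hom
  exact ⟨k, ObjectProperty.homMk g, ObjectProperty.hom_ext _ hg⟩

variable {E : Type (u + 1)} [LargeCategory.{u} E] [IsGrothendieckTopos.{u} E] (D : ConnLC T ⥤ E)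

/-- The presheaves `Y ↦ Hom(D Y, e)` on the connected locally constant objects. -/
abbrev restrictedYoneda : E ⥤ (ConnLC T)ᵒᵖ ⥤ Type u :=
  yoneda ⋙ (Functor.whiskeringLeft _ _ _).obj D.op

/-- The functor `e ↦ Hom(Hom(-, X), Hom(D -, e))` is corepresented by the coproduct of the objects
`D Yₖ`, where the `Yₖ` are the connected summands of `X`. -/
lemma exists_universal (X : SLC T) : ∃ (A : E)
    (φ : (connNerve T).obj X.obj ⟶ (restrictedYoneda D).obj A), ∀ (e : E)
      (ψ : (connNerve T).obj X.obj ⟶ (restrictedYoneda D).obj e),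
        ∃! t : A ⟶ e, φ ≫ (restrictedYoneda D).map t = ψ := by
  obtain ⟨I, Y, i, ⟨hc⟩, hY⟩ := X.2.exists_cofan
  let Y' (k : I) : ConnLC T := ⟨Y k, hY k⟩
  have hmono (k : I) : Mono (i k) := mono_inj_of_isColimit hc k
  choose κ g hg using fun (W : ConnLC T) (y : W.obj ⟶ X.obj) => W.2.1.exists_factor hc y
  replace hg (W : ConnLC T) (y : W.obj ⟶ X.obj) : g W y ≫ i _ = y := hg W y
  let inj (k : I) : D.obj (Y' k) ⟶ ∐ fun k => D.obj (Y' k) := Sigma.ι (fun k => D.obj (Y' k)) k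
  let φ (W : ConnLC T) (y : W.obj ⟶ X.obj) : D.obj W ⟶ ∐ fun k => D.obj (Y' k) :=
    D.map (ObjectProperty.homMk (g W y) : W ⟶ Y' _) ≫ inj _
  have uniq {W : ConnLC T} {k k' : I} (y : W ⟶ Y' k) (y' : W ⟶ Y' k')
      (h : y.hom ≫ i k = y'.hom ≫ i k') : D.map y ≫ inj k = D.map y' ≫ inj k' := by
    obtain rfl : k = k' := eq_of_comp_inj_eq hc W.2.1.1 y.hom y'.hom h
    rw [ObjectProperty.hom_ext _ ((cancel_mono (i k)).1 h)]
  have hφ {W : ConnLC T} (y : W.obj ⟶ X.obj) {k : I} (y' : W ⟶ Y' k) (h : y'.hom ≫ i k = y) :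
      φ W y = D.map y' ≫ inj k :=
    uniq _ y' ((hg W y).trans h.symm)
  refine ⟨∐ fun k => D.obj (Y' k),
    { app W := ↾(φ W.unop)
      naturality W W' w := by
        ext y
        refine (hφ _ (w.unop ≫ ObjectProperty.homMk (g W.unop y)) ?_).trans ?_
        · exact (Category.assoc _ _ _).trans (congr_arg (w.unop.hom ≫ ·) (hg W.unop y))
        · rw [D.map_comp, Category.assoc]
          rfl }, fun e ψ => ⟨Sigma.desc fun k => ψ.app (op (Y' k)) (i k), ?_, fun t ht => ?_⟩⟩
  · ext W y
    change (D.map _ ≫ inj _) ≫ Sigma.desc (fun k => ψ.app (op (Y' k)) (i k)) = ψ.app W y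
    rw [Category.assoc, show inj _ ≫ Sigma.desc (fun k => ψ.app (op (Y' k)) (i k)) = _ from
      Sigma.ι_desc _ _]
    refine (ψ.naturality_apply (ObjectProperty.homMk (g W.unop y) : W.unop ⟶ Y' _).op
      (i _)).symm.trans ?_
    exact congr_arg (ψ.app W) (hg W.unop y)
  · refine Sigma.hom_ext _ _ fun k => ?_
    rw [Sigma.ι_desc, ← ht]
    have h : φ (Y' k) (i k) = inj k := by
      rw [hφ (i k) (𝟙 (Y' k)) (Category.id_comp _), D.map_id, Category.id_comp]
    exact congr_arg (· ≫ t) h.symm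

/-- The values of the extended functor. -/
noncomputable def sumExtensionObj (X : SLC T) : E := (exists_universal D X).choose

/-- The universal natural transformation to the extended functor. -/
noncomputable def sumExtensionUnit (X : SLC T) :
    (connNerve T).obj X.obj ⟶ (restrictedYoneda D).obj (sumExtensionObj D X) :=
  (exists_universal D X).choose_spec.choose

lemma existsUnique_sumExtension (X : SLC T) (e : E)
    (ψ : (connNerve T).obj X.obj ⟶ (restrictedYoneda D).obj e) :
    ∃! t : sumExtensionObj D X ⟶ e, sumExtensionUnit D X ≫ (restrictedYoneda D).map t = ψ :=
  (exists_universal D X).choose_spec.choose_spec e ψ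

/-- The bijection that defines the extended functor. -/
noncomputable def sumExtensionEquiv (X : SLC T) (e : E) : (sumExtensionObj D X ⟶ e) ≃
    ((connNerve T).obj X.obj ⟶ (restrictedYoneda D).obj e) :=
  Equiv.ofBijective (fun t => sumExtensionUnit D X ≫ (restrictedYoneda D).map t)
    (Function.bijective_iff_existsUnique _ |>.2 (existsUnique_sumExtension D X e))

lemma sumExtensionEquiv_apply {X : SLC T} {e : E} (t : sumExtensionObj D X ⟶ e) :
    sumExtensionEquiv D X e t = sumExtensionUnit D X ≫ (restrictedYoneda D).map t := rfl

lemma sumExtensionEquiv_comp {X : SLC T} {e e' : E} (t : sumExtensionObj D X ⟶ e) (s : e ⟶ e') :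
    sumExtensionEquiv D X e' (t ≫ s) =
      sumExtensionEquiv D X e t ≫ (restrictedYoneda D).map s := by
  rw [sumExtensionEquiv_apply, Functor.map_comp, sumExtensionEquiv_apply, Category.assoc]

/-- The action of the extended functor on morphisms. -/
noncomputable def sumExtensionMap {X X' : SLC T} (t : X ⟶ X') :
    sumExtensionObj D X ⟶ sumExtensionObj D X' :=
  (sumExtensionEquiv D X _).symm ((connNerve T).map t.hom ≫ sumExtensionUnit D X')

lemma sumExtensionEquiv_map_comp {X X' : SLC T} {e : E} (t : X ⟶ X')
    (s : sumExtensionObj D X' ⟶ e) : sumExtensionEquiv D X e (sumExtensionMap D t ≫ s) =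
      (connNerve T).map t.hom ≫ sumExtensionEquiv D X' e s := by
  rw [sumExtensionEquiv_comp]
  exact (congr_arg (· ≫ (restrictedYoneda D).map s) (Equiv.apply_symm_apply _ _)).trans
    (Category.assoc _ _ _)

lemma sumExtensionEquiv_map {X X' : SLC T} (t : X ⟶ X') :
    sumExtensionEquiv D X _ (sumExtensionMap D t) =
      (connNerve T).map t.hom ≫ sumExtensionUnit D X' :=
  Equiv.apply_symm_apply _ _

/-- The extension of a functor on the connected locally constant objects to disjoint sums. -/
noncomputable def sumExtension : SLC T ⥤ E where
  obj := sumExtensionObj D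
  map := sumExtensionMap D
  map_id X := by
    apply (sumExtensionEquiv D X _).injective
    rw [sumExtensionEquiv_map, sumExtensionEquiv_apply, CategoryTheory.Functor.map_id,
      Category.comp_id]
    exact (congr_arg (· ≫ _) ((connNerve T).map_id X.obj)).trans (Category.id_comp _)
  map_comp {X X' X''} t t' := by
    apply (sumExtensionEquiv D X _).injective
    rw [sumExtensionEquiv_map_comp, sumExtensionEquiv_map, sumExtensionEquiv_map,
      ← Category.assoc, ← Functor.map_comp]
    rfl

variable {D} in
/-- The extension has a right adjoint if the presheaves `Y ↦ Hom(D Y, e)` are sheaves. -/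
lemma isLeftAdjoint_sumExtension (hD : ∀ e, Presieve.IsSheaf (atomicTopology T)
    ((restrictedYoneda D).obj e)) : (sumExtension D).IsLeftAdjoint := by
  refine Functor.isLeftAdjoint_of_rightAdjointObjIsDefined_eq_top ?_
  refine top_le_iff.1 fun e _ => ?_
  obtain ⟨Z, hZ, ⟨ε⟩⟩ := nonempty_connNerve_iso (hD e)
  let q (X : SLC T) : (X ⟶ ⟨Z, hZ⟩) ≃ ((sumExtension D).obj X ⟶ e) :=
    (ObjectProperty.fullyFaithfulι _).homEquiv.trans
      ((Equiv.ofBijective _ (bijective_connNerve_map X.2 Z)).trans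
        (ε.homToEquiv.trans (sumExtensionEquiv D X e).symm))
  exact ⟨⟨Z, hZ⟩, ⟨⟨q _, fun {X X'} t s => by
    apply (sumExtensionEquiv D X e).injective
    refine Eq.trans ?_ (sumExtensionEquiv_map_comp D t (q X' s)).symm
    refine (Equiv.apply_symm_apply _ _).trans (Eq.trans ?_
      (congr_arg ((connNerve T).map t.hom ≫ ·) (Equiv.apply_symm_apply _ _).symm))
    refine Eq.trans ?_ (Category.assoc _ _ _)
    exact congr_arg (· ≫ ε.hom) ((connNerve T).map_comp t.hom s.hom)⟩⟩⟩

/-- The extension does not change the values on connected objects. -/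
noncomputable def sumExtensionIso (W : ConnLC T) :
    D.obj W ≅ (sumExtension D).obj ⟨W.obj, W.2.isSum⟩ where
  hom := (sumExtensionUnit D ⟨W.obj, W.2.isSum⟩).app (op W) (𝟙 W.obj)
  inv := (sumExtensionEquiv D _ _).symm
    { app V := ↾fun y => D.map (ObjectProperty.homMk y : V.unop ⟶ W)
      naturality V V' v := by
        ext y
        exact D.map_comp v.unop (ObjectProperty.homMk y : V.unop ⟶ W) }
  hom_inv_id := by
    refine (ConcreteCategory.congr_hom (NatTrans.congr_app
      ((sumExtensionEquiv D ⟨W.obj, W.2.isSum⟩ (D.obj W)).apply_symm_apply _) (op W))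
        (𝟙 W.obj)).trans ?_
    exact D.map_id W
  inv_hom_id := by
    apply (sumExtensionEquiv D ⟨W.obj, W.2.isSum⟩ _).injective
    refine (sumExtensionEquiv_comp D _ _).trans ?_
    rw [Equiv.apply_symm_apply]
    refine Eq.trans ?_ ((congr_arg (_ ≫ ·) ((restrictedYoneda D).map_id _)).trans
      (Category.comp_id _)).symm
    ext V y
    refine ((sumExtensionUnit D ⟨W.obj, W.2.isSum⟩).naturality_apply
      (ObjectProperty.homMk y : V.unop ⟶ W).op (𝟙 W.obj)).symm.trans ?_
    exact congr_arg ((sumExtensionUnit D ⟨W.obj, W.2.isSum⟩).app V) (Category.comp_id y)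

lemma sumExtensionIso_hom_naturality {W W' : ConnLC T} (w : W ⟶ W') :
    D.map w ≫ (sumExtensionIso D W').hom = (sumExtensionIso D W).hom ≫
      (sumExtension D).map (ObjectProperty.homMk w.hom) := by
  let t : (⟨W.obj, W.2.isSum⟩ : SLC T) ⟶ ⟨W'.obj, W'.2.isSum⟩ := ObjectProperty.homMk w.hom
  have h₁ := (sumExtensionUnit D ⟨W'.obj, W'.2.isSum⟩).naturality_apply w.op (𝟙 W'.obj)
  have h₂ := ConcreteCategory.congr_hom (NatTrans.congr_app (sumExtensionEquiv_map D t) (op W))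
    (𝟙 W.obj)
  refine h₁.symm.trans (Eq.trans ?_ h₂.symm)
  exact congr_arg ((sumExtensionUnit D ⟨W'.obj, W'.2.isSum⟩).app (op W))
    ((Category.comp_id w.hom).trans (Category.id_comp w.hom).symm)

end SumExtension

/-! ### Gluing topos morphisms along the subcategories `LC(T, R)` -/

section Glue

variable {T : Type (u + 1)} [LargeCategory.{u} T] [IsGrothendieckTopos.{u} T]
  [IsLocallyConnected T] {E : Type (u + 1)} [LargeCategory.{u} E] [IsGrothendieckTopos.{u} E]

omit [IsGrothendieckTopos.{u} E] in
/-- A functor on `LC(T, R)` that preserves colimits sends a morphism between connected objects to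
the coequalizer of its kernel pair. -/
lemma existsUnique_of_kernel {R : CoveringSieve T} (G : LC R ⥤ E) [G.IsLeftAdjoint] {Y Y' : LC R}
    (hY : IsConnectedObject Y.obj) (hY' : IsConnectedObject Y'.obj) (a : Y' ⟶ Y) {e : E}
    (s : G.obj Y' ⟶ e) (hs : ∀ (W : LC R) (u v : W ⟶ Y'), IsConnectedObject W.obj →
      u ≫ a = v ≫ a → G.map u ≫ s = G.map v ≫ s) : ∃! t : G.obj Y ⟶ e, G.map a ≫ t = s := by
  have hepi : Epi a.hom := epi_of_connected Y.2 hY Y'.2 hY'.1 a.hom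
  have hfac (c : Cofork (pullback.fst a a) (pullback.snd a a)) : ∃ t : Y ⟶ c.pt, a ≫ t = c.π := by
    obtain ⟨t, ht⟩ := exists_factor_of_kernel Y.2 hY Y'.2 hY'.1 a.hom c.π.hom fun j x y hxy => by
      have hxy' : (ObjectProperty.homMk x : cover R j ⟶ Y') ≫ a = ObjectProperty.homMk y ≫ a :=
        ObjectProperty.hom_ext _ hxy
      have h : (ObjectProperty.homMk x : cover R j ⟶ Y') ≫ c.π = ObjectProperty.homMk y ≫ c.π := by
        rw [← pullback.lift_fst _ _ hxy', Category.assoc, c.condition, ← Category.assoc,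
          pullback.lift_snd]
      exact congr_arg InducedCategory.Hom.hom h
    exact ⟨ObjectProperty.homMk t, ObjectProperty.hom_ext _ ht⟩
  choose d hd using hfac
  have hcancel {Z : LC R} {t t' : Y ⟶ Z} (h : a ≫ t = a ≫ t') : t = t' :=
    ObjectProperty.hom_ext _ ((cancel_epi a.hom).1 (congr_arg InducedCategory.Hom.hom h))
  have hcoeq : IsColimit (Cofork.ofπ a pullback.condition) :=
    Cofork.IsColimit.mk _ d hd fun c m hm => hcancel (hm.trans (hd c).symm)
  have hG := isColimitMapCoconeCoforkEquiv G _ (isColimitOfPreserves G hcoeq)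
  have hs' : G.map (pullback.fst a a) ≫ s = G.map (pullback.snd a a) ≫ s := by
    obtain ⟨I, K, i, ⟨hc⟩, hK, -⟩ := generatesByCoproducts_lc R (pullback a a)
    obtain ⟨hc'⟩ := nonempty_isColimit_map_cofan G hc
    refine Cofan.IsColimit.hom_ext hc' _ _ fun k => ?_
    change G.map (i k) ≫ _ = G.map (i k) ≫ _
    rw [← Category.assoc, ← Category.assoc, ← G.map_comp, ← G.map_comp]
    refine hs _ _ _ (hK k) ?_
    rw [Category.assoc, pullback.condition, Category.assoc]
  refine ⟨Cofork.IsColimit.desc hG s hs', Cofork.IsColimit.π_desc' hG s hs', fun t ht => ?_⟩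
  exact Cofork.IsColimit.hom_ext hG (ht.trans (Cofork.IsColimit.π_desc' hG s hs').symm)

variable (T E) in
/-- A compatible system of topos morphisms from `E` to the toposes `LC(T, R)`. -/
structure LCSystem where
  /-- The inverse image functors. -/
  obj (R : CoveringSieve T) : LC R ⥤ E
  isLeftAdjoint (R : CoveringSieve T) : (obj R).IsLeftAdjoint
  preservesFiniteLimits (R : CoveringSieve T) : PreservesFiniteLimits (obj R)
  /-- The compatibility isomorphisms. -/
  iso {R' R : CoveringSieve T} (h : R' ≤ R) : LC.inclusion h ⋙ obj R' ≅ obj R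
  iso_comp {R'' R' R : CoveringSieve T} (h' : R'' ≤ R') (h : R' ≤ R) (X : LC R) :
    (iso (h'.trans h)).hom.app X =
      (iso h').hom.app ((LC.inclusion h).obj X) ≫ (iso h).hom.app X

namespace LCSystem

variable (S : LCSystem T E)

instance (R : CoveringSieve T) : (S.obj R).IsLeftAdjoint := S.isLeftAdjoint R

instance (R : CoveringSieve T) : PreservesFiniteLimits (S.obj R) := S.preservesFiniteLimits R

/-- A sieve trivializing the connected locally constant object `Y`. -/
noncomputable def level (Y : ConnLC T) : CoveringSieve T := Y.2.2.choose

omit [IsLocallyConnected T] in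
lemma isTrivializedBySieve_level (Y : ConnLC T) : IsTrivializedBySieve (level Y) Y.obj :=
  Y.2.2.choose_spec

/-- The values of the glued functor. -/
noncomputable def glueObj (Y : ConnLC T) : E := (S.obj (level Y)).obj
  ⟨Y.obj, isTrivializedBySieve_level Y⟩

/-- The value of the glued functor at `Y` can be computed on any `LC(T, R)` that contains `Y`. -/
noncomputable def glueIso (Y : ConnLC T) {R : CoveringSieve T}
    (hY : IsTrivializedBySieve R Y.obj) : (S.obj R).obj ⟨Y.obj, hY⟩ ≅ S.glueObj Y :=
  (S.iso (inf_le_left : R ⊓ level Y ≤ R)).symm.app ⟨Y.obj, hY⟩ ≪≫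
    (S.iso (inf_le_right : R ⊓ level Y ≤ level Y)).app ⟨Y.obj, isTrivializedBySieve_level Y⟩

omit [IsLocallyConnected T] in
lemma iso_hom_app_glueIso (Y : ConnLC T) {Q R : CoveringSieve T} (h : Q ≤ R)
    (hY : IsTrivializedBySieve R Y.obj) :
    (S.iso h).hom.app ⟨Y.obj, hY⟩ ≫ (S.glueIso Y hY).hom =
      (S.glueIso Y (isTrivializedBySieve_le h _ hY)).hom := by
  have key {Q : CoveringSieve T} (h : Q ≤ R) (h' : Q ≤ level Y) :
      (S.iso h).hom.app ⟨Y.obj, hY⟩ ≫ (S.glueIso Y hY).hom =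
        (S.iso h').hom.app ⟨Y.obj, isTrivializedBySieve_level Y⟩ := by
    have h₁ := S.iso_comp (le_inf h h') inf_le_left ⟨Y.obj, hY⟩
    have h₂ := S.iso_comp (le_inf h h') inf_le_right ⟨Y.obj, isTrivializedBySieve_level Y⟩
    refine (congr_arg (· ≫ (S.glueIso Y hY).hom) h₁).trans (Eq.trans ?_ h₂.symm)
    refine (Category.assoc _ _ _).trans (congr_arg (_ ≫ ·) ?_)
    exact (S.iso (inf_le_left : R ⊓ level Y ≤ R)).hom_inv_id_app_assoc _ _
  have h₁ := S.iso_comp (inf_le_left : Q ⊓ level Y ≤ Q) h ⟨Y.obj, hY⟩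
  have h₂ := key ((inf_le_left : Q ⊓ level Y ≤ Q).trans h) inf_le_right
  refine (cancel_epi ((S.iso (inf_le_left : Q ⊓ level Y ≤ Q)).hom.app
    ⟨Y.obj, isTrivializedBySieve_le h _ hY⟩)).1 ?_
  refine (Category.assoc _ _ _).symm.trans ((congr_arg (· ≫ (S.glueIso Y hY).hom)
    h₁.symm).trans (h₂.trans ?_))
  exact ((S.iso (inf_le_left : Q ⊓ level Y ≤ Q)).hom_inv_id_app_assoc
    ⟨Y.obj, isTrivializedBySieve_le h _ hY⟩ ((S.iso (inf_le_right : Q ⊓ level Y ≤ _)).hom.app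
      ⟨Y.obj, isTrivializedBySieve_level Y⟩)).symm

/-- The action of the glued functor on morphisms. -/
noncomputable def glueMap {Y Y' : ConnLC T} (f : Y ⟶ Y') : S.glueObj Y ⟶ S.glueObj Y' :=
  (S.glueIso Y (isTrivializedBySieve_le inf_le_left _ (isTrivializedBySieve_level Y))).inv ≫
    (S.obj (level Y ⊓ level Y')).map (ObjectProperty.homMk f.hom) ≫
      (S.glueIso Y' (isTrivializedBySieve_le inf_le_right _ (isTrivializedBySieve_level Y'))).hom

lemma glueIso_hom_glueMap {Y Y' : ConnLC T} (f : Y ⟶ Y') {R : CoveringSieve T}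
    (hY : IsTrivializedBySieve R Y.obj) (hY' : IsTrivializedBySieve R Y'.obj) :
    (S.glueIso Y hY).hom ≫ S.glueMap f =
      (S.obj R).map (ObjectProperty.homMk f.hom) ≫ (S.glueIso Y' hY').hom := by
  -- The morphism of `E` computed at `R` does not change when `R` is refined.
  let m (R : CoveringSieve T) (hY : IsTrivializedBySieve R Y.obj)
      (hY' : IsTrivializedBySieve R Y'.obj) : S.glueObj Y ⟶ S.glueObj Y' :=
    (S.glueIso Y hY).inv ≫ (S.obj R).map (ObjectProperty.homMk f.hom) ≫ (S.glueIso Y' hY').hom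
  have key {Q R : CoveringSieve T} (h : Q ≤ R) (hY : IsTrivializedBySieve R Y.obj)
      (hY' : IsTrivializedBySieve R Y'.obj) :
      m Q (isTrivializedBySieve_le h _ hY) (isTrivializedBySieve_le h _ hY') = m R hY hY' := by
    let g : (⟨Y.obj, hY⟩ : LC R) ⟶ ⟨Y'.obj, hY'⟩ := ObjectProperty.homMk f.hom
    have h₁ := S.iso_hom_app_glueIso Y h hY
    have h₂ := S.iso_hom_app_glueIso Y' h hY'
    have h₃ : (S.obj Q).map ((LC.inclusion h).map g) ≫ (S.iso h).hom.app ⟨Y'.obj, hY'⟩ =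
      (S.iso h).hom.app ⟨Y.obj, hY⟩ ≫ (S.obj R).map g := (S.iso h).hom.naturality g
    rw [Iso.inv_comp_eq, ← h₁, ← h₂]
    refine ((Category.assoc _ _ _).symm.trans ((congr_arg (· ≫ (S.glueIso Y' hY').hom) h₃).trans
      ?_)).trans (Category.assoc _ _ _).symm
    refine (Category.assoc _ _ _).trans (congr_arg (_ ≫ ·) ?_)
    exact (Iso.hom_inv_id_assoc _ _).symm
  have h₁ := key (inf_le_left : R ⊓ (level Y ⊓ level Y') ≤ R) hY hY'
  have h₂ := key (inf_le_right : R ⊓ (level Y ⊓ level Y') ≤ _)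
    (isTrivializedBySieve_le inf_le_left _ (isTrivializedBySieve_level Y))
    (isTrivializedBySieve_le inf_le_right _ (isTrivializedBySieve_level Y'))
  rw [← Iso.eq_inv_comp]
  exact h₂.symm.trans h₁

/-- The functor on the connected locally constant objects defined by a compatible system. -/
noncomputable def glue : ConnLC T ⥤ E where
  obj := S.glueObj
  map := S.glueMap
  map_id Y := by
    have h := isTrivializedBySieve_level Y
    rw [← cancel_epi (S.glueIso Y h).hom, S.glueIso_hom_glueMap _ h h, Category.comp_id]
    exact (congr_arg (· ≫ _) ((S.obj _).map_id ⟨Y.obj, h⟩)).trans (Category.id_comp _)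
  map_comp {Y Y' Y''} f g := by
    have h : IsTrivializedBySieve (level Y ⊓ (level Y' ⊓ level Y'')) Y.obj :=
      isTrivializedBySieve_le inf_le_left _ (isTrivializedBySieve_level Y)
    have h' : IsTrivializedBySieve (level Y ⊓ (level Y' ⊓ level Y'')) Y'.obj :=
      isTrivializedBySieve_le (inf_le_right.trans inf_le_left) _ (isTrivializedBySieve_level Y')
    have h'' : IsTrivializedBySieve (level Y ⊓ (level Y' ⊓ level Y'')) Y''.obj :=
      isTrivializedBySieve_le (inf_le_right.trans inf_le_right) _ (isTrivializedBySieve_level Y'')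
    rw [← cancel_epi (S.glueIso Y h).hom, S.glueIso_hom_glueMap _ h h'', ← Category.assoc,
      S.glueIso_hom_glueMap _ h h', Category.assoc, S.glueIso_hom_glueMap _ h' h'',
      ← Category.assoc, ← CategoryTheory.Functor.map_comp]
    rfl

lemma glueIso_hom_map_glue {Y Y' : ConnLC T} (f : Y ⟶ Y') {R : CoveringSieve T}
    (hY : IsTrivializedBySieve R Y.obj) (hY' : IsTrivializedBySieve R Y'.obj) :
    (S.glueIso Y hY).hom ≫ S.glue.map f =
      (S.obj R).map (ObjectProperty.homMk f.hom) ≫ (S.glueIso Y' hY').hom :=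
  S.glueIso_hom_glueMap f hY hY'

lemma epi_map_glue {Y Y' : ConnLC T} (a : Y' ⟶ Y) : Epi (S.glue.map a) := by
  obtain ⟨R, hY', hY⟩ := Y'.2.exists_common Y.2
  let a' : (⟨Y'.obj, hY'⟩ : LC R) ⟶ ⟨Y.obj, hY⟩ := ObjectProperty.homMk a.hom
  have : Epi ((S.obj R).map a') := ⟨fun s t hst => (existsUnique_of_kernel (S.obj R) Y.2.1 Y'.2.1 a'
    ((S.obj R).map a' ≫ t) fun W u v _ huv => by
      rw [← Category.assoc, ← Category.assoc, ← CategoryTheory.Functor.map_comp,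
        ← CategoryTheory.Functor.map_comp, huv]).unique hst rfl⟩
  have h : (S.glueIso Y' hY').hom ≫ S.glue.map a = (S.obj R).map a' ≫ (S.glueIso Y hY).hom :=
    S.glueIso_hom_map_glue a hY' hY
  have h' : Epi ((S.obj R).map a' ≫ (S.glueIso Y hY).hom) := epi_comp _ _
  have : Epi ((S.glueIso Y' hY').hom ≫ S.glue.map a) := by
    rw [h]
    exact h'
  exact epi_of_epi (S.glueIso Y' hY').hom _

/-- The condition for a right adjoint: the glued functor turns atomic covers into effective
epimorphisms, as the functors on the `LC(T, R)` do. -/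
lemma isSheaf_restrictedYoneda_glue (e : E) :
    Presieve.IsSheaf (atomicTopology T) ((restrictedYoneda S.glue).obj e) := by
  rintro Y M ⟨Y', a, ha⟩ x hx
  obtain ⟨R, hY', hY⟩ := Y'.2.exists_common Y.2
  let a' : (⟨Y'.obj, hY'⟩ : LC R) ⟶ ⟨Y.obj, hY⟩ := ObjectProperty.homMk a.hom
  obtain ⟨t, ht, -⟩ := existsUnique_of_kernel (S.obj R) Y.2.1 Y'.2.1 a'
    ((S.glueIso Y' hY').hom ≫ (x a ha : S.glue.obj Y' ⟶ e)) fun W u v hW huv => by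
      let W' : ConnLC T := ⟨W.obj, hW, R, W.2⟩
      let u' : W' ⟶ Y' := ObjectProperty.homMk u.hom
      let v' : W' ⟶ Y' := ObjectProperty.homMk v.hom
      have h : u.hom ≫ a.hom = v.hom ≫ a.hom := congr_arg InducedCategory.Hom.hom huv
      have h' : u' ≫ a = v' ≫ a := ObjectProperty.hom_ext _ h
      have h₁ := S.glueIso_hom_map_glue u' W.2 hY'
      have h₂ := S.glueIso_hom_map_glue v' W.2 hY'
      have h₃ : (S.glue.map u' ≫ x a ha : S.glue.obj W' ⟶ e) = S.glue.map v' ≫ x a ha :=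
        hx u' v' ha ha h'
      refine (Category.assoc _ _ _).symm.trans (Eq.trans ?_ (Category.assoc _ _ _))
      refine (congr_arg (· ≫ (x a ha : S.glue.obj Y' ⟶ e)) h₁).symm.trans (Eq.trans ?_
        (congr_arg (· ≫ (x a ha : S.glue.obj Y' ⟶ e)) h₂))
      exact (Category.assoc _ _ _).trans ((congr_arg (_ ≫ ·) h₃).trans (Category.assoc _ _ _).symm)
  let t' : S.glue.obj Y ⟶ e := (S.glueIso Y hY).inv ≫ t
  have ht' : S.glue.map a ≫ t' = x a ha := by
    refine (cancel_epi (S.glueIso Y' hY').hom).1 (Eq.trans ?_ ht)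
    refine (Category.assoc _ _ _).symm.trans
      ((congr_arg (· ≫ t') (S.glueIso_hom_map_glue a hY' hY)).trans ?_)
    exact (Category.assoc _ _ _).trans (congr_arg (_ ≫ ·) (Iso.hom_inv_id_assoc _ _))
  refine ⟨t', fun Z b hb => ?_, fun t'' ht'' => ?_⟩
  · obtain ⟨W, w, z, hwz⟩ := rightOreCondition_connectedLC a b
    have := S.epi_map_glue z
    refine (cancel_epi (S.glue.map z)).1 ?_
    have h₁ : (S.glue.map w ≫ x a ha : S.glue.obj W ⟶ e) = S.glue.map z ≫ x b hb :=
      hx w z ha hb hwz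
    change S.glue.map z ≫ S.glue.map b ≫ t' = S.glue.map z ≫ x b hb
    rw [← h₁, ← ht', ← Category.assoc, ← Category.assoc, ← S.glue.map_comp, ← S.glue.map_comp,
      hwz]
  · have := S.epi_map_glue a
    exact (cancel_epi (S.glue.map a)).1 ((ht'' a ha).trans ht'.symm)

/-- Inverse image functors on the `LC(T, R)` that are compatible extend to `SLC T`. -/
theorem exists_extension : ∃ f : SLC T ⥤ E, PreservesFiniteLimits f ∧ f.IsLeftAdjoint ∧
    ∃ ε : ∀ R, LC.toSLC R ⋙ f ≅ S.obj R, ∀ ⦃R' R : CoveringSieve T⦄ (h : R' ≤ R) (X : LC R),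
      (ε R').hom.app ((LC.inclusion h).obj X) ≫ (S.iso h).hom.app X = (ε R).hom.app X := by
  have hf := isLeftAdjoint_sumExtension S.isSheaf_restrictedYoneda_glue
  let f := sumExtension S.glue
  have hε (R : CoveringSieve T) : ∃ ε : LC.toSLC R ⋙ f ≅ S.obj R, ∀ (Y : LC R)
      (hY : IsConnectedObject Y.obj), ε.hom.app Y =
        (sumExtensionIso S.glue ⟨Y.obj, hY, R, Y.2⟩).inv ≫
          (S.glueIso ⟨Y.obj, hY, R, Y.2⟩ Y.2).inv := by
    obtain ⟨ε, hε⟩ := (generatesByCoproducts_lc R).exists_iso (F := LC.toSLC R ⋙ f)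
      (G := S.obj R) (fun Y hY => (sumExtensionIso S.glue ⟨Y.obj, hY, R, Y.2⟩).symm ≪≫
        (S.glueIso ⟨Y.obj, hY, R, Y.2⟩ Y.2).symm) fun Y Y' hY hY' t => by
      let w : (⟨Y.obj, hY, R, Y.2⟩ : ConnLC T) ⟶ ⟨Y'.obj, hY', R, Y'.2⟩ :=
        ObjectProperty.homMk t.hom
      have h₁ := sumExtensionIso_hom_naturality S.glue w
      have h₂ := S.glueIso_hom_map_glue w Y.2 Y'.2
      have key {A B C A' B' C' : E} (φ : B ≅ A) (g : C ≅ B) (φ' : B' ≅ A') (g' : C' ≅ B')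
          (x : A ⟶ A') (y : B ⟶ B') (z : C ⟶ C') (h₁ : y ≫ φ'.hom = φ.hom ≫ x)
          (h₂ : g.hom ≫ y = z ≫ g'.hom) : x ≫ φ'.inv ≫ g'.inv = (φ.inv ≫ g.inv) ≫ z := by
        rw [← Iso.inv_comp_eq] at h₁
        rw [← Iso.comp_inv_eq] at h₂
        rw [← h₁, ← h₂]
        simp
      exact key _ _ _ _ _ _ _ h₁ h₂
    exact ⟨ε, hε⟩
  choose ε hε using hε
  have hlex (R : CoveringSieve T) : PreservesFiniteLimits (LC.toSLC R ⋙ f) :=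
    preservesFiniteLimits_of_natIso (ε R).symm
  refine ⟨f, generatesByCoproducts_slc.preservesFiniteLimits ?_
    fun X Y Z a b hX hY hZ P p q hpq => ?_, hf, ε, fun R' R h X => ?_⟩
  · let X : LC (⊤ : CoveringSieve T) := ⟨⊤_ T, isTrivializedBySieve_terminal⟩
    have hX : IsTerminal X := IsTerminal.ofUniqueHom
      (fun Z => ObjectProperty.homMk (terminal.from Z.obj))
      fun Z f => ObjectProperty.hom_ext _ (Subsingleton.elim _ _)
    exact preservesLimit_of_preserves_limit_cone (IsTerminal.isTerminalObj (LC.toSLC _) X hX)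
      ((isLimitMapConeEmptyConeEquiv f _).symm (IsTerminal.isTerminalObj (LC.toSLC _ ⋙ f) X hX))
  · obtain ⟨_, RX, hRX⟩ := hX
    obtain ⟨_, RY, hRY⟩ := hY
    obtain ⟨_, RZ, hRZ⟩ := hZ
    let R := RX ⊓ (RY ⊓ RZ)
    let X' : LC R := ⟨X.obj, isTrivializedBySieve_le inf_le_left _ hRX⟩
    let Y' : LC R := ⟨Y.obj, isTrivializedBySieve_le (inf_le_right.trans inf_le_left) _ hRY⟩
    let Z' : LC R := ⟨Z.obj, isTrivializedBySieve_le (inf_le_right.trans inf_le_right) _ hRZ⟩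
    let a' : X' ⟶ Z' := ObjectProperty.homMk a.hom
    let b' : Y' ⟶ Z' := ObjectProperty.homMk b.hom
    have h₀ := IsPullback.of_hasPullback a' b'
    have h₁ : IsPullback ((LC.toSLC R).map (pullback.fst a' b'))
      ((LC.toSLC R).map (pullback.snd a' b')) a b := h₀.map (LC.toSLC R)
    have h₂ : IsPullback (f.map ((LC.toSLC R).map (pullback.fst a' b')))
      (f.map ((LC.toSLC R).map (pullback.snd a' b'))) (f.map a) (f.map b) :=
      h₀.map (LC.toSLC R ⋙ f)
    let e := h₁.isoIsPullback _ _ hpq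
    refine h₂.of_iso (f.mapIso e) (Iso.refl _) (Iso.refl _) (Iso.refl _) ?_ ?_ (by simp) (by simp)
    · rw [Iso.refl_hom, Category.comp_id, Functor.mapIso_hom, ← f.map_comp,
        h₁.isoIsPullback_hom_fst]
    · rw [Iso.refl_hom, Category.comp_id, Functor.mapIso_hom, ← f.map_comp,
        h₁.isoIsPullback_hom_snd]
  · let α : LC.toSLC R ⋙ f ⟶ S.obj R :=
      Functor.whiskerLeft (LC.inclusion h) (ε R').hom ≫ (S.iso h).hom
    have : α = (ε R).hom := (generatesByCoproducts_lc R).natTrans_ext fun Y hY => by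
      let Y' : ConnLC T := ⟨Y.obj, hY, R, Y.2⟩
      have h₁ := S.iso_hom_app_glueIso Y' h Y.2
      change (ε R').hom.app ((LC.inclusion h).obj Y) ≫ (S.iso h).hom.app Y = (ε R).hom.app Y
      rw [hε R Y hY]
      refine (congr_arg (· ≫ (S.iso h).hom.app Y) (hε R' ((LC.inclusion h).obj Y) hY)).trans ?_
      refine (Category.assoc _ _ _).trans (congr_arg (_ ≫ ·) ?_)
      have key {A B C : E} (g' : A ≅ B) (s : A ⟶ C) (g : C ≅ B) (h : s ≫ g.hom = g'.hom) :
          g'.inv ≫ s = g.inv := by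
        rw [Iso.inv_comp_eq, ← h, Category.assoc, Iso.hom_inv_id, Category.comp_id]
      exact key _ _ _ h₁
    exact NatTrans.congr_app this X

end LCSystem

end Glue

/-! ### The 2-limit cone -/

section TwoLimit

/-- Isomorphisms of 2-cones are families of compatible isomorphisms. -/
def TwoCone.isoMk {I : Type v₁} [Category.{w₁} I] {G : I ⥤ Grpd.{w₂, v₂}} {E : Type v₃}
    [Category.{w₃} E] {c d : TwoCone.{u} G E} (e : ∀ i, (c.proj i).obj ≅ (d.proj i).obj)
    (he : ∀ {i j : I} (φ : i ⟶ j) (X : ClassifyingCat.{u} (G.obj j)),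
      (c.iso φ).hom.app X ≫ (e j).hom.app X =
        (e i).hom.app ((restr G φ).obj X) ≫ (d.iso φ).hom.app X) : c ≅ d where
  hom := ⟨fun i => ObjectProperty.homMk (e i).hom, he⟩
  inv := ⟨fun i => ObjectProperty.homMk (e i).inv, fun {i j} φ X => by
    change (d.iso φ).hom.app X ≫ (e j).inv.app X =
      (e i).inv.app ((restr G φ).obj X) ≫ (c.iso φ).hom.app X
    rw [← cancel_mono ((e j).hom.app X), Category.assoc, Iso.inv_hom_id_app, Category.comp_id,
      Category.assoc, he, Iso.inv_hom_id_app_assoc]⟩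
  hom_inv_id := TwoCone.Hom.ext (funext fun i => ObjectProperty.hom_ext _ (e i).hom_inv_id)
  inv_hom_id := TwoCone.Hom.ext (funext fun i => ObjectProperty.hom_ext _ (e i).inv_hom_id)

variable {T : Type (u + 1)} [LargeCategory.{u} T] [IsGrothendieckTopos.{u} T]
  [IsLocallyConnected T] {P : Set (BasePoint T)}

/-- The fiber functor, with values in the classifying topos of a component of the fundamental
progroupoid. -/
def classify (P : Set (BasePoint T)) (R : CoveringSieve T) :
    LC R ⥤ ClassifyingCat.{u} ((fundamentalProgroupoid T P).obj R) :=
  fiberFunctor P R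

variable (hP : MeetsEveryComponent P)

include hP in
lemma MeetsEveryComponent.isEquivalence_classify (R : CoveringSieve T) :
    (classify P R).IsEquivalence :=
  hP.isEquivalence_fiberFunctor R

/-- The equivalence of `LC(T, R)` with the classifying topos of `G_R`. -/
noncomputable def classifyEquiv (R : CoveringSieve T) :
    LC R ≌ ClassifyingCat.{u} ((fundamentalProgroupoid T P).obj R) :=
  have := hP.isEquivalence_classify R
  (classify P R).asEquivalence

/-- The compatibility of the equivalences `LC(T, R) ≌ 𝔅(G_R)` with restriction, on objects. -/
noncomputable def restrIsoApp {R' R : CoveringSieve T} (φ : R' ⟶ R)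
    (Z : ClassifyingCat.{u} ((fundamentalProgroupoid T P).obj R)) :
    (classifyEquiv hP R').inverse.obj ((restr (fundamentalProgroupoid T P) φ).obj Z) ≅
      (LC.inclusion φ.le).obj ((classifyEquiv hP R).inverse.obj Z) :=
  (classifyEquiv hP R').fullyFaithfulFunctor.preimageIso
    ((classifyEquiv hP R').counitIso.app _ ≪≫
      (restr (fundamentalProgroupoid T P) φ).mapIso ((classifyEquiv hP R).counitIso.symm.app Z))

lemma functor_map_restrIsoApp_hom {R' R : CoveringSieve T} (φ : R' ⟶ R)
    (Z : ClassifyingCat.{u} ((fundamentalProgroupoid T P).obj R)) :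
    (classifyEquiv hP R').functor.map (restrIsoApp hP φ Z).hom =
      (classifyEquiv hP R').counit.app _ ≫ (restr (fundamentalProgroupoid T P) φ).map
        ((classifyEquiv hP R).counitInv.app Z) :=
  (classifyEquiv hP R').fullyFaithfulFunctor.map_preimage _

/-- The compatibility of the equivalences `LC(T, R) ≌ 𝔅(G_R)` with restriction. -/
noncomputable def restrIso {R' R : CoveringSieve T} (φ : R' ⟶ R) :
    restr (fundamentalProgroupoid T P) φ ⋙ (classifyEquiv hP R').inverse ≅
      (classifyEquiv hP R).inverse ⋙ LC.inclusion φ.le :=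
  NatIso.ofComponents (restrIsoApp hP φ) fun {Z Z'} f => by
    apply (classifyEquiv hP R').functor.map_injective
    have h₁ := (classifyEquiv hP R').counit.naturality
      ((restr (fundamentalProgroupoid T P) φ).map f)
    have h₂ := congr_arg (restr (fundamentalProgroupoid T P) φ).map
      ((classifyEquiv hP R).counitInv.naturality f)
    rw [CategoryTheory.Functor.map_comp, CategoryTheory.Functor.map_comp] at h₂
    rw [CategoryTheory.Functor.map_comp, CategoryTheory.Functor.map_comp,
      functor_map_restrIsoApp_hom, functor_map_restrIsoApp_hom]
    refine (Category.assoc _ _ _).symm.trans ((congr_arg (· ≫ _) h₁).trans ?_)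
    refine (Category.assoc _ _ _).trans ((congr_arg (_ ≫ ·) h₂).trans ?_)
    exact (Category.assoc _ _ _).symm

lemma functor_map_restrIso_hom_app {R' R : CoveringSieve T} (φ : R' ⟶ R)
    (Z : ClassifyingCat.{u} ((fundamentalProgroupoid T P).obj R)) :
    (classifyEquiv hP R').functor.map ((restrIso hP φ).hom.app Z) =
      (classifyEquiv hP R').counit.app _ ≫ (restr (fundamentalProgroupoid T P) φ).map
        ((classifyEquiv hP R).counitInv.app Z) :=
  functor_map_restrIsoApp_hom hP φ Z

lemma restrIso_hom_app_classify {R' R : CoveringSieve T} (φ : R' ⟶ R) (X : LC R) :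
    (restrIso hP φ).hom.app ((classifyEquiv hP R).functor.obj X) =
      (classifyEquiv hP R').unitInv.app ((LC.inclusion φ.le).obj X) ≫
        (LC.inclusion φ.le).map ((classifyEquiv hP R).unit.app X) := by
  apply (classifyEquiv hP R').functor.map_injective
  refine (functor_map_restrIso_hom_app hP φ _).trans (Eq.trans ?_
    ((classifyEquiv hP R').functor.map_comp _ _).symm)
  exact congr_arg₂ (· ≫ ·) ((classifyEquiv hP R').counit_app_functor ((LC.inclusion φ.le).obj X))
    (congr_arg (restr (fundamentalProgroupoid T P) φ).map
      ((classifyEquiv hP R).counitInv_app_functor X))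

/-- The 2-limit cone with vertex `SLC T`. -/
noncomputable def slcCone : TwoCone.{u} (fundamentalProgroupoid T P) (SLC T) where
  proj R := ⟨(classifyEquiv hP R).inverse ⋙ LC.toSLC R,
    comp_preservesFiniteLimits _ _, inferInstance⟩
  iso {R' R} φ := Functor.isoWhiskerRight (restrIso hP φ) (LC.toSLC R')
  iso_id R X := by
    refine congr_arg (LC.toSLC R).map ?_
    apply (classifyEquiv hP R).functor.map_injective
    refine (functor_map_restrIso_hom_app hP (𝟙 R) X).trans ?_
    refine Eq.trans ?_ (b := 𝟙 _) ?_
    · exact (classifyEquiv hP R).counitIso.hom_inv_id_app X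
    · exact ((congr_arg (classifyEquiv hP R).functor.map
        ((classifyEquiv hP R).inverse.map_id X)).trans
          ((classifyEquiv hP R).functor.map_id _)).symm
  iso_comp {R'' R' R} φ ψ X := by
    have h : (restrIso hP (φ ≫ ψ)).hom.app X =
        (restrIso hP φ).hom.app ((restr (fundamentalProgroupoid T P) ψ).obj X) ≫
          (LC.inclusion φ.le).map ((restrIso hP ψ).hom.app X) := by
      apply (classifyEquiv hP R'').functor.map_injective
      refine (functor_map_restrIso_hom_app hP (φ ≫ ψ) X).trans (Eq.trans ?_
        ((classifyEquiv hP R'').functor.map_comp _ _).symm)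
      have h₁ := functor_map_restrIso_hom_app hP φ
        ((restr (fundamentalProgroupoid T P) ψ).obj X)
      have h₂ := congr_arg (restr (fundamentalProgroupoid T P) φ).map
        (functor_map_restrIso_hom_app hP ψ X)
      refine Eq.trans ?_ (congr_arg₂ (· ≫ ·) h₁ h₂).symm
      refine Eq.trans (congr_arg (_ ≫ ·) ?_) (Category.assoc _ _ _).symm
      refine (congr_arg (restr (fundamentalProgroupoid T P) φ).map
        ((classifyEquiv hP R').counitIso.inv_hom_id_app_assoc _
          ((restr (fundamentalProgroupoid T P) ψ).map
            ((classifyEquiv hP R).counitInv.app X)))).symm.trans ?_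
      exact (restr (fundamentalProgroupoid T P) φ).map_comp
        ((classifyEquiv hP R').counitIso.inv.app ((restr (fundamentalProgroupoid T P) ψ).obj X))
        ((classifyEquiv hP R').counitIso.hom.app ((restr (fundamentalProgroupoid T P) ψ).obj X) ≫
          (restr (fundamentalProgroupoid T P) ψ).map ((classifyEquiv hP R).counitInv.app X))
    refine (congr_arg (LC.toSLC R'').map h).trans ?_
    refine ((LC.toSLC R'').map_comp _ _).trans ?_
    refine (Category.id_comp _).symm.trans (congr_arg (· ≫ _) ?_)
    exact (((classifyEquiv hP R'').inverse ⋙ LC.toSLC R'').map_id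
      ((restr (fundamentalProgroupoid T P) (φ ≫ ψ)).obj X)).symm

end TwoLimit

/-! ### The universal property of the 2-limit cone -/

section UniversalProperty

variable {T : Type (u + 1)} [LargeCategory.{u} T] [IsGrothendieckTopos.{u} T]
  [IsLocallyConnected T] {E : Type (u + 1)} [LargeCategory.{u} E]

/-- Compatible natural transformations on the `LC(T, R)` extend to `SLC T`. -/
lemma exists_natTrans_slc {f f' : SLC T ⥤ E} [f.IsLeftAdjoint]
    (b : ∀ R, LC.toSLC R ⋙ f ⟶ LC.toSLC R ⋙ f')
    (hb : ∀ ⦃R' R : CoveringSieve T⦄ (h : R' ≤ R) (X : LC R),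
      (b R').app ((LC.inclusion h).obj X) = (b R).app X) :
    ∃ γ : f ⟶ f', ∀ (R : CoveringSieve T) (X : LC R),
      γ.app ((LC.toSLC R).obj X) = (b R).app X := by
  have indep {Y : T} {R R' : CoveringSieve T} (h : IsTrivializedBySieve R Y)
      (h' : IsTrivializedBySieve R' Y) : (b R).app ⟨Y, h⟩ = (b R').app ⟨Y, h'⟩ :=
    (hb (inf_le_left : R ⊓ R' ≤ R) ⟨Y, h⟩).symm.trans (hb (inf_le_right : R ⊓ R' ≤ R') ⟨Y, h'⟩)
  obtain ⟨γ, hγ⟩ := generatesByCoproducts_slc.exists_natTrans (F := f) (G := f')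
    (fun Y hY => (b hY.2.choose).app ⟨Y.obj, hY.2.choose_spec⟩) fun Y Y' hY hY' t => by
      obtain ⟨R, h, h'⟩ := hY.exists_common hY'
      let t' : (⟨Y.obj, h⟩ : LC R) ⟶ ⟨Y'.obj, h'⟩ := ObjectProperty.homMk t.hom
      refine (congr_arg (f.map t ≫ ·) (indep hY'.2.choose_spec h')).trans (Eq.trans ?_
        (congr_arg (· ≫ f'.map t) (indep hY.2.choose_spec h)).symm)
      exact (b R).naturality t'
  refine ⟨γ, fun R X => ?_⟩
  have : Functor.whiskerLeft (LC.toSLC R) γ = b R :=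
    (generatesByCoproducts_lc R).natTrans_ext fun Y hY =>
      (hγ (Y := (LC.toSLC R).obj Y) ⟨hY, R, Y.2⟩).trans (indep _ Y.2)
  exact NatTrans.congr_app this X

variable {P : Set (BasePoint T)} (hP : MeetsEveryComponent P)

include hP in
/-- Natural transformations on `SLC T` can be compared on the classifying toposes of the groupoids
of base points. -/
lemma natTrans_slc_ext {f f' : SLC T ⥤ E} [f.IsLeftAdjoint] {α β : f ⟶ f'}
    (h : ∀ R Z, α.app ((LC.toSLC R).obj ((classifyEquiv hP R).inverse.obj Z)) =
      β.app ((LC.toSLC R).obj ((classifyEquiv hP R).inverse.obj Z))) : α = β := by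
  refine generatesByCoproducts_slc.natTrans_ext fun Y hY => ?_
  obtain ⟨_, R, hR⟩ := hY
  let e : Y ≅ (LC.toSLC R).obj ((classifyEquiv hP R).inverse.obj
      ((classifyEquiv hP R).functor.obj ⟨Y.obj, hR⟩)) :=
    (LC.toSLC R).mapIso ((classifyEquiv hP R).unitIso.app ⟨Y.obj, hR⟩)
  rw [← cancel_mono (f'.map e.hom), ← α.naturality, ← β.naturality, h]

/-- Compatible natural transformations on the classifying toposes of the groupoids of base points
extend to `SLC T`. -/
lemma exists_natTrans_of_classify {f f' : SLC T ⥤ E} [f.IsLeftAdjoint]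
    (t : ∀ R, ((classifyEquiv hP R).inverse ⋙ LC.toSLC R) ⋙ f ⟶
      ((classifyEquiv hP R).inverse ⋙ LC.toSLC R) ⋙ f')
    (ht : ∀ ⦃R' R : CoveringSieve T⦄ (φ : R' ⟶ R)
      (Z : ClassifyingCat.{u} ((fundamentalProgroupoid T P).obj R)),
      f.map ((LC.toSLC R').map ((restrIso hP φ).hom.app Z)) ≫ (t R).app Z =
        (t R').app ((restr _ φ).obj Z) ≫
          f'.map ((LC.toSLC R').map ((restrIso hP φ).hom.app Z))) :
    ∃ γ : f ⟶ f', ∀ R Z, γ.app ((LC.toSLC R).obj ((classifyEquiv hP R).inverse.obj Z)) =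
      (t R).app Z := by
  let u (R : CoveringSieve T) (X : LC R) : (LC.toSLC R).obj X ≅ (LC.toSLC R).obj
      ((classifyEquiv hP R).inverse.obj ((classifyEquiv hP R).functor.obj X)) :=
    (LC.toSLC R).mapIso ((classifyEquiv hP R).unitIso.app X)
  have hu {R : CoveringSieve T} {X Y : LC R} (x : X ⟶ Y) : (u R X).hom ≫ (LC.toSLC R).map
      ((classifyEquiv hP R).inverse.map ((classifyEquiv hP R).functor.map x)) =
        (LC.toSLC R).map x ≫ (u R Y).hom :=
    ((LC.toSLC R).map_comp _ _).symm.trans ((congr_arg (LC.toSLC R).map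
      ((classifyEquiv hP R).unitIso.hom.naturality x).symm).trans ((LC.toSLC R).map_comp _ _))
  let b (R : CoveringSieve T) : LC.toSLC R ⋙ f ⟶ LC.toSLC R ⋙ f' :=
    { app X := f.map (u R X).hom ≫ (t R).app ((classifyEquiv hP R).functor.obj X) ≫
        f'.map (u R X).inv
      naturality X Y x := by
        have h₁ := (t R).naturality ((classifyEquiv hP R).functor.map x)
        have h₂ := hu x
        rw [← Iso.eq_inv_comp] at h₂
        have key {A B A' B' : SLC T} (uA : A ≅ A') (uB : B ≅ B') (x : A ⟶ B) (x' : A' ⟶ B')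
            (h : x' = uA.inv ≫ x ≫ uB.hom) (tA : f.obj A' ⟶ f'.obj A')
            (tB : f.obj B' ⟶ f'.obj B') (ht : f.map x' ≫ tB = tA ≫ f'.map x') :
            f.map x ≫ f.map uB.hom ≫ tB ≫ f'.map uB.inv =
              (f.map uA.hom ≫ tA ≫ f'.map uA.inv) ≫ f'.map x := by
          have h₁ : x = uA.hom ≫ x' ≫ uB.inv := by simp [h]
          have h₂ : f.map x ≫ f.map uB.hom = f.map uA.hom ≫ f.map x' := by
            rw [← f.map_comp, ← f.map_comp, h₁]
            simp
          have h₃ : f'.map uA.inv ≫ f'.map x = f'.map x' ≫ f'.map uB.inv := by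
            rw [← f'.map_comp, ← f'.map_comp, h₁]
            simp
          rw [reassoc_of% h₂, reassoc_of% ht, Category.assoc, Category.assoc, h₃]
        exact key _ _ _ _ h₂ _ _ h₁ }
  obtain ⟨γ, hγ⟩ := exists_natTrans_slc b fun R' R h X => by
    have h₁ := ht (homOfLE h) ((classifyEquiv hP R).functor.obj X)
    rw [restrIso_hom_app_classify] at h₁
    have key {A A₁ A₂ : SLC T} (u' : A ≅ A₁) (u : A ≅ A₂) (t₁ : f.obj A₁ ⟶ f'.obj A₁)
        (t₂ : f.obj A₂ ⟶ f'.obj A₂)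
        (h : f.map (u'.inv ≫ u.hom) ≫ t₂ = t₁ ≫ f'.map (u'.inv ≫ u.hom)) :
        f.map u'.hom ≫ t₁ ≫ f'.map u'.inv = f.map u.hom ≫ t₂ ≫ f'.map u.inv := by
      calc f.map u'.hom ≫ t₁ ≫ f'.map u'.inv =
          f.map u'.hom ≫ (t₁ ≫ f'.map (u'.inv ≫ u.hom)) ≫ f'.map u.inv := by simp
        _ = f.map u'.hom ≫ (f.map (u'.inv ≫ u.hom) ≫ t₂) ≫ f'.map u.inv := by rw [h]
        _ = _ := by simp
    exact key (u R' ((LC.inclusion h).obj X)) (u R X) _ _ h₁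
  refine ⟨γ, fun R Z => (hγ R _).trans ?_⟩
  have h₁ := (t R).naturality ((classifyEquiv hP R).counitInv.app Z)
  have h₂ : (LC.toSLC R).map ((classifyEquiv hP R).inverse.map
      ((classifyEquiv hP R).counitInv.app Z)) = (u R ((classifyEquiv hP R).inverse.obj Z)).hom :=
    congr_arg (LC.toSLC R).map ((classifyEquiv hP R).unit_app_inverse Z).symm
  have key {A A' : SLC T} (u : A ≅ A') (y : A ⟶ A') (hy : y = u.hom) (t₁ : f.obj A ⟶ f'.obj A)
      (t₂ : f.obj A' ⟶ f'.obj A') (h : f.map y ≫ t₂ = t₁ ≫ f'.map y) :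
      f.map u.hom ≫ t₂ ≫ f'.map u.inv = t₁ := by
    subst hy
    rw [reassoc_of% h, ← f'.map_comp, Iso.hom_inv_id, f'.map_id, Category.comp_id]
  exact key _ _ h₂ _ _ h₁

variable [IsGrothendieckTopos.{u} E]

/-- The compatible system of inverse image functors defined by a 2-cone. -/
noncomputable def TwoCone.toLCSystem (d : TwoCone.{u} (fundamentalProgroupoid T P) E) :
    LCSystem T E where
  obj R := (classifyEquiv hP R).functor ⋙ (d.proj R).obj
  isLeftAdjoint R := by
    have := (d.proj R).property.2
    infer_instance
  preservesFiniteLimits R := by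
    have := (d.proj R).property.1
    exact comp_preservesFiniteLimits _ _
  iso {R' R} h := Functor.isoWhiskerLeft (classifyEquiv hP R).functor (d.iso (homOfLE h))
  iso_comp {R'' R' R} h' h X := by
    refine (d.iso_comp (homOfLE h') (homOfLE h) ((classifyEquiv hP R).functor.obj X)).trans ?_
    refine (congr_arg (· ≫ _) ?_).trans (Category.id_comp _)
    exact (d.proj R'').obj.map_id _

/-- The cone with vertex `SLC T` is a 2-limit. -/
lemma isTwoLimit_slcCone : (slcCone hP).IsTwoLimit := by
  intro E _ _
  exact
  { faithful := ⟨fun {h h'} α β hαβ => by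
      have := h.property.2
      refine ObjectProperty.hom_ext _ (natTrans_slc_ext hP fun R Z => ?_)
      exact NatTrans.congr_app (congr_arg InducedCategory.Hom.hom
        (congr_fun (congr_arg TwoCone.Hom.app hαβ) R)) Z⟩
    full := ⟨fun {h h'} θ => by
      have := h.property.2
      obtain ⟨γ, hγ⟩ := exists_natTrans_of_classify hP (f := h.obj) (f' := h'.obj)
        (fun R => (θ.app R).hom) fun R' R φ Z => θ.comm φ Z
      refine ⟨ObjectProperty.homMk γ, TwoCone.Hom.ext (funext fun R => ObjectProperty.hom_ext _ ?_)⟩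
      ext Z
      exact hγ R Z⟩
    essSurj := ⟨fun d => by
      obtain ⟨f, hf₁, hf₂, ε, hε⟩ := (d.toLCSystem hP).exists_extension
      refine ⟨⟨f, hf₁, hf₂⟩, ⟨TwoCone.isoMk (fun R =>
        Functor.isoWhiskerLeft (classifyEquiv hP R).inverse (ε R) ≪≫
          Functor.isoWhiskerRight (classifyEquiv hP R).counitIso (d.proj R).obj) ?_⟩⟩
      intro R' R φ Z
      have h₁ := hε φ.le ((classifyEquiv hP R).inverse.obj Z)
      have h₂ := (ε R').hom.naturality ((restrIso hP φ).hom.app Z)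
      have h₃ := (congr_arg (d.proj R').obj.map (functor_map_restrIso_hom_app hP φ Z)).trans
        ((d.proj R').obj.map_comp _ _)
      have h₄ := (d.iso φ).hom.naturality ((classifyEquiv hP R).counitInv.app Z)
      have h₅ : (d.proj R).obj.map ((classifyEquiv hP R).counitInv.app Z) ≫
          (d.proj R).obj.map ((classifyEquiv hP R).counit.app Z) = 𝟙 _ := by
        rw [← CategoryTheory.Functor.map_comp, ← CategoryTheory.Functor.map_id]
        exact congr_arg (d.proj R).obj.map ((classifyEquiv hP R).counitIso.inv_hom_id_app Z)
      have key {A B C D A' B' C' : E} {k : A ⟶ B} {e₁ : B ⟶ C} {i₁ : C ⟶ D} {e₂ : B ⟶ D}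
          {e₃ : A ⟶ A'} {m : A' ⟶ C} {c' : A' ⟶ B'} {r : B' ⟶ C} {i₂ : B' ⟶ C'} {ci : C' ⟶ D}
          {c : D ⟶ C'} (h₁ : e₁ ≫ i₁ = e₂) (h₂ : k ≫ e₁ = e₃ ≫ m) (h₃ : m = c' ≫ r)
          (h₄ : r ≫ i₁ = i₂ ≫ ci) (h₅ : ci ≫ c = 𝟙 C') : k ≫ e₂ ≫ c = (e₃ ≫ c') ≫ i₂ := by
        rw [← h₁, Category.assoc, reassoc_of% h₂, h₃, Category.assoc, reassoc_of% h₄, h₅,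
          Category.comp_id, Category.assoc]
      exact key h₁ h₂ h₃ h₄ h₅⟩ }

end UniversalProperty

end ToposPi

theorem theorem2p3 (T : Type (u + 1)) [LargeCategory.{u} T] [ToposPi.IsGrothendieckTopos.{u} T]
    [ToposPi.IsLocallyConnected T] (P : Set (ToposPi.BasePoint T))
    (hP : ToposPi.MeetsEveryComponent P) :
    ToposPi.IsStrictProgroupoid (ToposPi.fundamentalProgroupoid T P) ∧
      ToposPi.IsClassifyingTopos.{u} (ToposPi.fundamentalProgroupoid T P) (ToposPi.SLC T) :=
  ⟨ToposPi.isStrictProgroupoid_fundamentalProgroupoid P,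
    { isTopos_component := hP.isGrothendieckTopos
      isTopos := inferInstance
      exists_isTwoLimit := ⟨ToposPi.slcCone hP, ToposPi.isTwoLimit_slcCone hP⟩ }⟩
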